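/- There is a single comparison-based sorting algorithm, and there are absolute constants $c \ge 1$ and $C$, such that for all $n, d \ge 0$ and every permutation $\tau$ of length $n$ and twin-width $d$, the algorithm sorts $\tau$ in at most $C\,(d+1)(n+1)$ steps; in particular it runs in $O(d\cdot n)$ time for $d, n \ge 1$. The algorithm does not know $d$: it is given only $n$ and access to comparisons of the elements of $\tau$. Here a comparison-based algorithm is a program for a word RAM (with constants, copying, addition, truncated subtraction, multiplication, integer division, indirect addressing, comparison of words, branching and loops, at unit cost each, on words of any length $w$ with $2^w \ge (n+2)^c$) whose only access to the input sequence $s_1,\dots,s_n$ is a unit-cost test whether $s_i \le s_j$ for given positions $i,j$. It sorts the sequence if it halts having written a permutation $\sigma$ of the positions with $s_{\sigma_1} \le \dots \le s_{\sigma_n}$. The twin-width of $\tau$ is the least $d$ for which $\tau$ has a $d$-wide merge sequence $R_1,\dots,R_n$, where $R_1$ is the set of the points $(i,\tau_i)$, viewed as degenerate rectangles; each $R_{i+1}$ arises from $R_i$ by replacing two rectangles with the smallest axis-parallel rectangle enclosing both; and in each $R_i$, every rectangle $Q$ has at most $d$ other rectangles whose projection onto the x-axis or onto the y-axis intersects that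 of $Q$. (For $n = 0$ the sequence is empty and the twin-width is $0$.) -/

import Mathlib

/-! ### Twin-width of permutations -/

namespace TwinWidth

/-- Axis-parallel rectangles with corners in the `n × n` grid; `Q.fst` is the lower left corner
and `Q.snd` the upper right corner. The supremum `Q ⊔ Q'` is the smallest axis-parallel
rectangle enclosing both `Q` and `Q'`. -/
abbrev Rect (n : ℕ) := NonemptyInterval (Fin n × Fin n)

/-- Two rectangles are homogeneous if their projections onto the x-axis are disjoint and their
projections onto the y-axis are disjoint. -/
def Homogeneous {n : ℕ} (Q Q' : Rect n) : Prop :=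
  (Q.snd.1 < Q'.fst.1 ∨ Q'.snd.1 < Q.fst.1) ∧ (Q.snd.2 < Q'.fst.2 ∨ Q'.snd.2 < Q.fst.2)

instance {n : ℕ} (Q Q' : Rect n) : Decidable (Homogeneous Q Q') := by
  unfold Homogeneous; infer_instance

/-- The family of the points `(i, τ i)`, viewed as degenerate rectangles. -/
def pointFamily {n : ℕ} (τ : Equiv.Perm (Fin n)) : Finset (Rect n) :=
  Finset.univ.image fun i => NonemptyInterval.pure (i, τ i)

/-- `R'` arises from `R` by replacing two distinct rectangles with the smallest rectangle
enclosing both. -/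
def IsMerge {n : ℕ} (R R' : Finset (Rect n)) : Prop :=
  ∃ Q₁ ∈ R, ∃ Q₂ ∈ R, Q₁ ≠ Q₂ ∧ R' = insert (Q₁ ⊔ Q₂) ((R.erase Q₁).erase Q₂)

/-- Every rectangle of the family is non-homogeneous with at most `d` other rectangles of the
family (the red graph of the family has maximum degree at most `d`). -/
def IsWide {n : ℕ} (d : ℕ) (R : Finset (Rect n)) : Prop :=
  ∀ Q ∈ R, (R.filter fun Q' => Q' ≠ Q ∧ ¬ Homogeneous Q Q').card ≤ d

/-- `R 0, …, R (n - 1)` is a `d`-wide merge sequence of `τ`: it starts with the points of `τ`,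
and each of the `n - 1` steps merges two rectangles. -/
def IsMergeSequence {n : ℕ} (τ : Equiv.Perm (Fin n)) (d : ℕ)
    (R : ℕ → Finset (Rect n)) : Prop :=
  R 0 = pointFamily τ ∧ (∀ i, i + 1 < n → IsMerge (R i) (R (i + 1))) ∧ ∀ i < n, IsWide d (R i)

/-- The twin-width of a permutation: the least `d` for which it has a `d`-wide merge sequence. -/
noncomputable def twinWidth {n : ℕ} (τ : Equiv.Perm (Fin n)) : ℕ :=
  sInf {d | ∃ R, IsMergeSequence τ d R}

/-- Every permutation has a merge sequence, so the infimum defining the twin-width is attained. -/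
theorem exists_isMergeSequence {n : ℕ} (τ : Equiv.Perm (Fin n)) :
    ∃ d R, IsMergeSequence τ d R := by
  rcases Nat.eq_zero_or_pos n with rfl | hn
  · exact ⟨0, fun _ => pointFamily τ, rfl, by simp, by simp⟩
  have : NeZero n := ⟨hn.ne'⟩
  let pt : Fin n → Rect n := fun i => NonemptyInterval.pure (i, τ i)
  let box : ℕ → Rect n := fun i =>
    Nat.rec (pt 0) (fun j b => b ⊔ pt (Fin.ofNat n (j + 1))) i
  have box_fst : ∀ i, (box i).fst.1 = 0 := by
    intro i
    induction i with
    | zero => rfl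
    | succ i ih =>
      change (box i ⊔ pt (Fin.ofNat n (i + 1))).fst.1 = 0
      simp [NonemptyInterval.fst_sup, ih]
  let F : ℕ → Finset (Rect n) := fun i =>
    insert (box i) ((Finset.univ.filter fun j : Fin n => i < j.val).image pt)
  have pt_inj : Function.Injective pt := by
    intro i j h
    have := congrArg (fun Q : Rect n => Q.fst.1) h
    exact this
  have box_ne : ∀ i (j : Fin n), i < j.val → box i ≠ pt j := by
    intro i j hij h
    have h1 := congrArg (fun Q : Rect n => Q.fst.1) h
    have h2 : (0 : Fin n) = j := (box_fst i).symm.trans h1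
    rw [← h2] at hij
    simp at hij
  refine ⟨(Finset.univ : Finset (Fin n)).card + 1, F, ?_, ?_, ?_⟩
  · ext Q
    simp only [F, pointFamily, Finset.mem_insert, Finset.mem_image, Finset.mem_filter,
      Finset.mem_univ, true_and]
    constructor
    · rintro (rfl | ⟨j, -, rfl⟩)
      · exact ⟨0, rfl⟩
      · exact ⟨j, rfl⟩
    · rintro ⟨j, rfl⟩
      by_cases hj : j = 0
      · left; subst hj; rfl
      · right; exact ⟨j, Nat.pos_of_ne_zero fun h => hj (Fin.ext (by simpa using h)), rfl⟩
  · intro i hi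
    have hv : (Fin.ofNat n (i + 1)).val = i + 1 := Nat.mod_eq_of_lt hi
    refine ⟨box i, by simp [F], pt (Fin.ofNat n (i + 1)), ?_, box_ne _ _ (by omega), ?_⟩
    · refine Finset.mem_insert_of_mem (Finset.mem_image.2 ⟨_, ?_, rfl⟩)
      exact Finset.mem_filter.2 ⟨Finset.mem_univ _, by omega⟩
    · change insert (box i ⊔ pt (Fin.ofNat n (i + 1))) _ = _
      congr 1
      ext Q
      simp only [F, Finset.mem_erase, Finset.mem_insert, Finset.mem_image, Finset.mem_filter,
        Finset.mem_univ, true_and]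
      constructor
      · rintro ⟨j, hj, rfl⟩
        refine ⟨fun h => ?_, (box_ne i j (by omega)).symm, Or.inr ⟨j, by omega, rfl⟩⟩
        have := pt_inj h
        rw [this, hv] at hj
        omega
      · rintro ⟨h1, h2, h3 | ⟨j, hj, rfl⟩⟩
        · exact absurd h3 h2
        · refine ⟨j, ?_, rfl⟩
          have : j.val ≠ i + 1 := fun h => h1 (congrArg pt (Fin.ext (h.trans hv.symm)))
          omega
  · intro i _ Q _
    refine (Finset.card_filter_le _ _).trans ((Finset.card_insert_le _ _).trans ?_)
    have h1 : ((Finset.univ.filter fun j : Fin n => i < j.val).image pt).card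
        ≤ (Finset.univ : Finset (Fin n)).card :=
      Finset.card_image_le.trans (Finset.card_filter_le _ _)
    omega

end TwinWidth

/-! ### A comparison-based word RAM

Registers and array cells hold `w`-bit words. The elements of the input sequence are not stored
in them: the only access to the input elements is a test which compares the elements at two
given positions. Programs are structured; each one mentions only finitely many registers
and finitely many arrays. -/

namespace CompRAM

/-- Tests on registers `a`, `b`. -/
inductive Test where
  /-- the word in register `a` is less than the word in register `b` -/
  | lt (a b : ℕ)
  /-- the words in registers `a` and `b` are equal -/
  | eq (a b : ℕ)
  /-- the input element at the position in register `a` is at most the input element at the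
  position in register `b` -/
  | elemLE (a b : ℕ)

/-- Programs. Registers and arrays are named by natural numbers. -/
inductive Prog where
  /-- do nothing -/
  | skip
  /-- register `r` := the constant `k` -/
  | const (r k : ℕ)
  /-- register `r` := register `a` -/
  | move (r a : ℕ)
  /-- register `r` := register `a` + register `b` -/
  | add (r a b : ℕ)
  /-- register `r` := register `a` - register `b` (truncated at zero) -/
  | sub (r a b : ℕ)
  /-- register `r` := register `a` * register `b` -/
  | mul (r a b : ℕ)
  /-- register `r` := register `a` / register `b` (rounded down, zero if the divisor is zero) -/
  | div (r a b : ℕ)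
  /-- register `r` := cell of array `A` at the index in register `i` -/
  | load (r A i : ℕ)
  /-- cell of array `A` at the index in register `i` := register `r` -/
  | store (A i r : ℕ)
  /-- run `p`, then `q` -/
  | seq (p q : Prog)
  /-- run `p` if the test succeeds and `q` otherwise -/
  | ite (c : Test) (p q : Prog)
  /-- run `p` as long as the test succeeds -/
  | loop (c : Test) (p : Prog)

/-- Memory contents: `reg r` is the word in register `r`, and `arr A i` is the word in the `i`-th
cell of array `A`. -/
@[ext] structure State where
  reg : ℕ → ℕ
  arr : ℕ → ℕ → ℕ

/-- Write the value `v`, reduced to a `w`-bit word, to register `r`. -/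
def State.setReg (w : ℕ) (m : State) (r v : ℕ) : State :=
  { m with reg := Function.update m.reg r (v % 2 ^ w) }

/-- Write `v` to the `i`-th cell of array `A`. -/
def State.setArr (m : State) (A i v : ℕ) : State :=
  { m with arr := Function.update m.arr A (Function.update (m.arr A) i v) }

/-- The initial memory on an input of length `n`: register `0` holds `n`, all else is zero. -/
def State.init (n : ℕ) : State where
  reg := fun r => if r = 0 then n else 0
  arr := fun _ _ => 0

/-- A test succeeds in memory `m` on the input sequence `s`. Comparisons of positions outside the
input fail. -/
def Test.Holds {n : ℕ} {α : Type*} [LinearOrder α] (s : Fin n → α) (m : State) : Test → Prop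
  | .lt a b => m.reg a < m.reg b
  | .eq a b => m.reg a = m.reg b
  | .elemLE a b => ∃ (ha : m.reg a < n) (hb : m.reg b < n), s ⟨m.reg a, ha⟩ ≤ s ⟨m.reg b, hb⟩

/-- `Exec w s p m t m'`: with word length `w` and input sequence `s`, program `p` started in
memory `m` halts after exactly `t` steps in memory `m'`. Every elementary instruction and every
evaluation of a test is one step. -/
inductive Exec {n : ℕ} {α : Type*} [LinearOrder α] (w : ℕ) (s : Fin n → α) :
    Prog → State → ℕ → State → Prop
  | skip (m) : Exec w s .skip m 1 m
  | const (m r k) : Exec w s (.const r k) m 1 (m.setReg w r k)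
  | move (m r a) : Exec w s (.move r a) m 1 (m.setReg w r (m.reg a))
  | add (m r a b) : Exec w s (.add r a b) m 1 (m.setReg w r (m.reg a + m.reg b))
  | sub (m r a b) : Exec w s (.sub r a b) m 1 (m.setReg w r (m.reg a - m.reg b))
  | mul (m r a b) : Exec w s (.mul r a b) m 1 (m.setReg w r (m.reg a * m.reg b))
  | div (m r a b) : Exec w s (.div r a b) m 1 (m.setReg w r (m.reg a / m.reg b))
  | load (m r A i) : Exec w s (.load r A i) m 1 (m.setReg w r (m.arr A (m.reg i)))
  | store (m A i r) : Exec w s (.store A i r) m 1 (m.setArr A (m.reg i) (m.reg r))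
  | seq {p q m m₁ m₂ t₁ t₂} : Exec w s p m t₁ m₁ → Exec w s q m₁ t₂ m₂ →
      Exec w s (.seq p q) m (t₁ + t₂) m₂
  | ite_true {c p q m m₁ t} : c.Holds s m → Exec w s p m t m₁ →
      Exec w s (.ite c p q) m (1 + t) m₁
  | ite_false {c p q m m₁ t} : ¬ c.Holds s m → Exec w s q m t m₁ →
      Exec w s (.ite c p q) m (1 + t) m₁
  | loop_true {c p m m₁ m₂ t₁ t₂} : c.Holds s m → Exec w s p m t₁ m₁ →
      Exec w s (.loop c p) m₁ t₂ m₂ → Exec w s (.loop c p) m (1 + t₁ + t₂) m₂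
  | loop_false {c p m} : ¬ c.Holds s m → Exec w s (.loop c p) m 1 m

/-- The first `n` cells of array `0` list the positions of the input sequence, each exactly once,
in an order in which the elements are sorted. -/
def IsSortedOutput {n : ℕ} {α : Type*} [LinearOrder α] (s : Fin n → α) (m : State) : Prop :=
  ∃ σ : Equiv.Perm (Fin n), (∀ k : Fin n, m.arr 0 k = (σ k : ℕ)) ∧ Monotone (s ∘ σ)

/-- With word length `w`, program `p` sorts the input sequence `s` in at most `T` steps. -/
def SortsWithin {n : ℕ} {α : Type*} [LinearOrder α] (w : ℕ) (p : Prog) (s : Fin n → α)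
    (T : ℕ) : Prop :=
  ∃ t m, Exec w s p (State.init n) t m ∧ t ≤ T ∧ IsSortedOutput s m

end CompRAM

namespace TwinWidth

/-! ### Density of permutations of bounded twin-width -/

/-! Density comes first. Put any set of points of a permutation of twin-width `d` into a grid of
rows and columns, and write `D = d + 1`. Then at most `6 * D` cells are occupied per nonempty row or
column (`card_cells_le`). To see this, follow a merge sequence to the first moment at which some
part meets three rows or three columns, say rows. That part straddles its middle row, so this row
meets at most `D` parts. Each of them arose from at most three parts of the preceding moment, and
those still meet at most two columns each. So the row has at most `6 * D` occupied cells; delete it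
and induct.

There are two consequences. Refining a grid dyadically shows that blocks of `b` consecutive
positions have at most `2 ^ (96 * D * b)` order patterns (`card_keys_le`). And in the grid of blocks
of positions against strips of values, few cells are occupied
(`BlockSorted.sum_card_stripBlocks_le`).

The algorithm takes powers of two `s`, about `log n`, and `r`, about `log (s * s)`. It sorts blocks
of length `r * r`, merges them to sorted blocks of length `s * s`, and merges these to the sorted
sequence.

For the short blocks, with `b = r * r`, the pattern of a block is coded by its `key`, a number with
`b` digits in base `b`. A dictionary holds the keys met so far, each with a representative block. A
binary search that also reads off digits finds the key of a new block with `O(log |S| + b)`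
comparisons, which is `O(D * b)` by the first consequence, and the block is then sorted by copying
its representative. A block with a new key is sorted from scratch and entered in the dictionary.
This takes `b ^ O(b)` time, happens at most `b ^ b` times, and costs `O(n)` in total, because `b` is
tiny (`exists_forall_pow_le`).

To merge the sorted blocks of length `s * s` in a segment of length `μ ≤ 2 ^ s`, take every `s`-th
element as a pivot. Sorting the pivots costs `O(μ)`. Inside a block the strip between pivots changes
only when a new occupied cell begins, so there are `O(D * (μ / s + s))` binary searches of cost
`O(s)`. Finally each strip is sorted by natural merge sort, whose cost is governed by the logarithm
of the number of runs, hence of the blocks which meet the strip. Strips with at most `12 * D` blocks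
cost `O(D)` per element. Density, applied to the remaining strips alone, shows that they have `O(D *
(μ / (s * s) + 1))` cells in all; each cell has at most `s` elements, and the logarithm is at most
`s` (`BlockSorted.sum_cost_le`).

The number `d` occurs only in this analysis, never in the program. Running times and correctness are
derived together in the calculus `wp`, in which a loop carries an invariant and a potential that
pays for its steps (`wp_while`). -/

theorem exists_strictly_between_of_two_lt_card {ι : Type*} {S : Finset ι} {f : ι → ℕ}
    (h : 2 < (S.image f).card) :
    ∃ i ∈ S, ∃ j ∈ S, ∃ k ∈ S, f i < f j ∧ f j < f k := by
  obtain ⟨a, b, c, ha, hb, hc, hab, hac, hbc⟩ := Finset.two_lt_card_iff.1 h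
  obtain ⟨i, hi, rfl⟩ := Finset.mem_image.1 ha
  obtain ⟨j, hj, rfl⟩ := Finset.mem_image.1 hb
  obtain ⟨k, hk, rfl⟩ := Finset.mem_image.1 hc
  rcases lt_or_gt_of_ne hab with h1 | h1 <;> rcases lt_or_gt_of_ne hac with h2 | h2 <;>
    rcases lt_or_gt_of_ne hbc with h3 | h3
  · exact ⟨i, hi, j, hj, k, hk, h1, h3⟩
  · exact ⟨i, hi, k, hk, j, hj, h2, h3⟩
  · omega
  · exact ⟨k, hk, i, hi, j, hj, h2, h1⟩
  · exact ⟨j, hj, i, hi, k, hk, h1, h2⟩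
  · omega
  · exact ⟨j, hj, k, hk, i, hi, h3, h2⟩
  · exact ⟨k, hk, j, hj, i, hi, h3, h1⟩

/-- A sequence of partitions of the points of `S` in a grid: `P t i` is the part of `i` at time `t`.
Parts start as points, end as one part, each part arises from at most three earlier ones, and a row
or column that is straddled by a part meets at most `D` parts. -/
structure IsPartition {ι κ : Type*} [DecidableEq ι] [DecidableEq κ] (S : Finset ι) (col row : ι → ℕ)
    (D N : ℕ) (P : ℕ → ι → κ) : Prop where
  inj : ∀ i ∈ S, ∀ j ∈ S, P 0 i = P 0 j → i = j
  const : ∀ i ∈ S, ∀ j ∈ S, P N i = P N j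
  step : ∀ t < N, ∀ q, ((S.filter fun i => P (t + 1) i = q).image (P t)).card ≤ 3
  rows : ∀ t ≤ N, ∀ i ∈ S, ∀ j ∈ S, ∀ r, P t i = P t j → row i < r → r < row j →
    ((S.filter fun k => row k = r).image (P t)).card ≤ D
  cols : ∀ t ≤ N, ∀ i ∈ S, ∀ j ∈ S, ∀ r, P t i = P t j → col i < r → r < col j →
    ((S.filter fun k => col k = r).image (P t)).card ≤ D

variable {ι κ : Type*} {S : Finset ι} {col row : ι → ℕ} {D N : ℕ} {P : ℕ → ι → κ}

theorem IsPartition.symm [DecidableEq ι] [DecidableEq κ] (h : IsPartition S col row D N P) : IsPartition S row col D N P :=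
  ⟨h.inj, h.const, h.step, h.cols, h.rows⟩

theorem IsPartition.mono [DecidableEq ι] [DecidableEq κ] (h : IsPartition S col row D N P) {S' : Finset ι} (hS : S' ⊆ S) :
    IsPartition S' col row D N P := by
  have key : ∀ (p : ι → Prop) [DecidablePred p] (t : ℕ),
      ((S'.filter p).image (P t)).card ≤ ((S.filter p).image (P t)).card := fun p _ t =>
    Finset.card_le_card (Finset.image_subset_image (Finset.filter_subset_filter _ hS))
  exact ⟨fun i hi j hj => h.inj i (hS hi) j (hS hj), fun i hi j hj => h.const i (hS hi) j (hS hj),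
    fun t ht q => (key _ _).trans (h.step t ht q),
    fun t ht i hi j hj r h1 h2 h3 => (key _ _).trans (h.rows t ht i (hS hi) j (hS hj) r h1 h2 h3),
    fun t ht i hi j hj r h1 h2 h3 => (key _ _).trans (h.cols t ht i (hS hi) j (hS hj) r h1 h2 h3)⟩

/-- If every part of the preceding partition spans at most two columns, a row straddled by a part
has few nonempty cells. -/
theorem IsPartition.card_row_le [DecidableEq ι] [DecidableEq κ] (h : IsPartition S col row D N P) {t : ℕ} (ht : t < N)
    (hcol : ∀ q, ((S.filter fun i => P t i = q).image col).card ≤ 2)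
    {q : κ} (hrow : 2 < ((S.filter fun i => P (t + 1) i = q).image row).card) :
    ∃ r, (∃ i ∈ S, row i = r) ∧ ((S.filter fun k => row k = r).image col).card ≤ 6 * D := by
  obtain ⟨i, hi, j, hj, k, hk, hij, hjk⟩ := exists_strictly_between_of_two_lt_card hrow
  rw [Finset.mem_filter] at hi hj hk
  refine ⟨row j, ⟨j, hj.1, rfl⟩, ?_⟩
  have h1 := h.rows (t + 1) ht i hi.1 k hk.1 (row j) (hi.2.trans hk.2.symm) hij hjk
  set T := S.filter fun k => row k = row j with hT
  -- Split the points of the row by their present part, and then by the part they belonged to one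
  -- moment earlier.
  have h2 : T.image col ⊆ (T.image (P (t + 1))).biUnion fun q =>
      ((S.filter fun i => P (t + 1) i = q).image (P t)).biUnion fun q' =>
        (S.filter fun i => P t i = q').image col := by
    intro x hx
    obtain ⟨l, hl, rfl⟩ := Finset.mem_image.1 hx
    have hlS : l ∈ S := (Finset.mem_filter.1 hl).1
    simp only [Finset.mem_biUnion, Finset.mem_image, Finset.mem_filter]
    exact ⟨_, ⟨l, hl, rfl⟩, _, ⟨l, ⟨hlS, rfl⟩, rfl⟩, l, ⟨hlS, rfl⟩, rfl⟩
  calc (T.image col).card ≤ _ := Finset.card_le_card h2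
    _ ≤ (T.image (P (t + 1))).card * 6 := by
      refine Finset.card_biUnion_le_card_mul _ _ _ fun q _ => ?_
      refine (Finset.card_biUnion_le_card_mul _ _ 2 fun q' _ => hcol q').trans ?_
      have := h.step t ht q
      omega
    _ ≤ 6 * D := by omega

/-- Deleting a row loses at most `B` cells but lowers the number of nonempty rows by one, which pays
for them. -/
theorem card_cells_le_of_row {r : ℕ} {B : ℕ}
    (h : ((S.filter fun k => row k = r).image col).card ≤ B) (hr : ∃ i ∈ S, row i = r)
    (ih : ((S.filter fun k => row k ≠ r).image fun i => (col i, row i)).card ≤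
      B * (((S.filter fun k => row k ≠ r).image col).card +
        ((S.filter fun k => row k ≠ r).image row).card)) :
    (S.image fun i => (col i, row i)).card ≤ B * ((S.image col).card + (S.image row).card) := by
  have h1 : (S.image fun i => (col i, row i)) ⊆
      ((S.filter fun k => row k ≠ r).image fun i => (col i, row i)) ∪
        ((S.filter fun k => row k = r).image col).image fun c => (c, r) := by
    intro x hx
    obtain ⟨i, hi, rfl⟩ := Finset.mem_image.1 hx
    by_cases hir : row i = r
    · refine Finset.mem_union_right _ (Finset.mem_image.2 ⟨col i, ?_, by rw [hir]⟩)
      exact Finset.mem_image_of_mem _ (Finset.mem_filter.2 ⟨hi, hir⟩)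
    · refine Finset.mem_union_left _ (Finset.mem_image.2 ⟨i, ?_, rfl⟩)
      exact Finset.mem_filter.2 ⟨hi, hir⟩
  have h2 : ((S.filter fun k => row k ≠ r).image row).card + 1 ≤ (S.image row).card := by
    have : (S.filter fun k => row k ≠ r).image row ⊆ (S.image row).erase r := by
      intro x hx
      obtain ⟨i, hi, rfl⟩ := Finset.mem_image.1 hx
      rw [Finset.mem_filter] at hi
      exact Finset.mem_erase.2 ⟨hi.2, Finset.mem_image_of_mem _ hi.1⟩
    have h3 := Finset.card_le_card this
    have hmem : r ∈ S.image row := by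
      obtain ⟨i, hi, hir⟩ := hr
      exact Finset.mem_image.2 ⟨i, hi, hir⟩
    rw [Finset.card_erase_of_mem hmem] at h3
    have := Finset.card_pos.2 ⟨r, hmem⟩
    omega
  have h3 : ((S.filter fun k => row k ≠ r).image col).card ≤ (S.image col).card :=
    Finset.card_le_card (Finset.image_subset_image (Finset.filter_subset _ _))
  calc (S.image fun i => (col i, row i)).card ≤ _ := Finset.card_le_card h1
    _ ≤ _ := Finset.card_union_le _ _
    _ ≤ B * (((S.filter fun k => row k ≠ r).image col).card +
        ((S.filter fun k => row k ≠ r).image row).card) + B :=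
      Nat.add_le_add ih (Finset.card_image_le.trans h)
    _ = B * (((S.filter fun k => row k ≠ r).image col).card +
        (((S.filter fun k => row k ≠ r).image row).card + 1)) := by ring
    _ ≤ _ := by gcongr

theorem card_cells_swap : (S.image fun i => (row i, col i)).card =
    (S.image fun i => (col i, row i)).card := by
  have : (S.image fun i => (row i, col i)) = (S.image fun i => (col i, row i)).image Prod.swap := by
    rw [Finset.image_image]; rfl
  rw [this, Finset.card_image_of_injective _ Prod.swap_injective]

/-- Induction on the number of points. The first time at which a part meets three rows or three
columns is positive, since parts start as points, and just before it the hypothesis of `card_row_le`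
holds by minimality. If there is no such time, the final single part is all of `S`; it meets at most
two columns, so there are at most twice as many cells as rows. -/
theorem IsPartition.card_cells_le [DecidableEq ι] [DecidableEq κ] (h : IsPartition S col row D N P) (hD : 1 ≤ D) :
    (S.image fun i => (col i, row i)).card ≤
      6 * D * ((S.image col).card + (S.image row).card) := by
  induction hS : S.card using Nat.strong_induction_on generalizing S with
  | _ c ih =>
  subst hS
  rcases S.eq_empty_or_nonempty with rfl | hne
  · simp
  by_cases hall : ∃ t ≤ N, ∃ q, 2 < ((S.filter fun i => P t i = q).image row).card ∨
      2 < ((S.filter fun i => P t i = q).image col).card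
  · classical
    have hex : ∃ t, t ≤ N ∧ ∃ q, 2 < ((S.filter fun i => P t i = q).image row).card ∨
      2 < ((S.filter fun i => P t i = q).image col).card := hall
    obtain ⟨hle, q, hq⟩ := Nat.find_spec hex
    have hmin := fun t => Nat.find_min (H := hex) (m := t)
    set t := Nat.find hex
    rcases Nat.eq_zero_or_pos t with h0 | hpos
    · exfalso
      rw [h0] at hq
      have : (S.filter fun i => P 0 i = q).card ≤ 1 := by
        refine Finset.card_le_one.2 fun a ha b hb => ?_
        rw [Finset.mem_filter] at ha hb
        exact h.inj a ha.1 b hb.1 (ha.2.trans hb.2.symm)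
      have h1 := Finset.card_image_le (s := S.filter fun i => P 0 i = q) (f := row)
      have h2 := Finset.card_image_le (s := S.filter fun i => P 0 i = q) (f := col)
      omega
    · obtain ⟨u, hu⟩ := Nat.exists_eq_succ_of_ne_zero hpos.ne'
      rw [Nat.succ_eq_add_one] at hu
      have hlast := hmin u (by omega)
      rw [not_and] at hlast
      have hlast := hlast (by omega)
      push Not at hlast
      rw [hu] at hq
      have hrec : ∀ r (f : ι → ℕ), (∃ i ∈ S, f i = r) →
          (S.filter fun k => f k ≠ r).card < S.card := by
        rintro r f ⟨i, hi, hir⟩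
        refine Finset.card_lt_card (Finset.filter_ssubset.2 ⟨i, hi, by simpa using hir⟩)
      rcases hq with hq | hq
      · obtain ⟨r, hr, hle⟩ := h.card_row_le (by omega) (fun q => (hlast q).2) hq
        exact card_cells_le_of_row hle hr
          (ih _ (hrec _ _ hr) (h.mono (Finset.filter_subset _ _)) rfl)
      · obtain ⟨r, hr, hle⟩ := h.symm.card_row_le (by omega) (fun q => (hlast q).1) hq
        rw [← card_cells_swap, add_comm (Finset.card _)]
        refine card_cells_le_of_row hle hr ?_
        rw [card_cells_swap, add_comm (Finset.card _)]
        exact ih _ (hrec _ _ hr) (h.mono (Finset.filter_subset _ _)) rfl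
  · push Not at hall
    obtain ⟨i, hi⟩ := hne
    have hfull : (S.filter fun j => P N j = P N i) = S :=
      Finset.filter_true_of_mem fun j hj => h.const j hj i hi
    have h1 := hall N le_rfl (P N i)
    rw [hfull] at h1
    have hsub : (S.image fun i => (col i, row i)) ⊆ (S.image col) ×ˢ (S.image row) := by
      intro x hx
      obtain ⟨i, hi, rfl⟩ := Finset.mem_image.1 hx
      exact Finset.mem_product.2 ⟨Finset.mem_image_of_mem _ hi, Finset.mem_image_of_mem _ hi⟩
    have h2 := Finset.card_le_card hsub
    rw [Finset.card_product] at h2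
    have h3 : (S.image col).card * (S.image row).card ≤ 2 * (S.image row).card :=
      Nat.mul_le_mul_right _ h1.2
    nlinarith [Nat.zero_le (S.image col).card, Nat.zero_le (S.image row).card]

/-- The rectangle which contains the point `(i, τ i)` in a family obtained by `t` merges, for a
merge sequence with the merged pairs `Q`. -/
def partOf {n : ℕ} (τ : Equiv.Perm (Fin n)) (Q : ℕ → Rect n × Rect n) : ℕ → Fin n → Rect n
  | 0, i => NonemptyInterval.pure (i, τ i)
  | t + 1, i => if partOf τ Q t i = (Q t).1 ∨ partOf τ Q t i = (Q t).2 then (Q t).1 ⊔ (Q t).2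
      else partOf τ Q t i

theorem point_mem_partOf {n : ℕ} (τ : Equiv.Perm (Fin n)) (Q : ℕ → Rect n × Rect n) (t : ℕ)
    (i : Fin n) : (partOf τ Q t i).fst ≤ (i, τ i) ∧ (i, τ i) ≤ (partOf τ Q t i).snd := by
  induction t with
  | zero => simp [partOf]
  | succ t ih =>
    rw [partOf]
    split_ifs with h
    · rw [NonemptyInterval.fst_sup, NonemptyInterval.snd_sup]
      rcases h with h | h <;> rw [h] at ih
      · exact ⟨inf_le_left.trans ih.1, ih.2.trans le_sup_left⟩
      · exact ⟨inf_le_right.trans ih.1, ih.2.trans le_sup_right⟩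
    · exact ih

/-- A part which meets a straddled row has a y-projection that overlaps the straddling part, so the
two are not homogeneous. The bound is `d + 1` because the straddling part itself may meet the row.
Monotonicity of `col` and `row` turns comparisons of grid lines into comparisons of coordinates. -/
theorem exists_isPartition {n d : ℕ} {τ : Equiv.Perm (Fin n)} {R : ℕ → Finset (Rect n)}
    (hR : IsMergeSequence τ d R) (S : Finset (Fin n)) {col row : ℕ → ℕ} (hcol : Monotone col)
    (hrow : Monotone row) :
    ∃ P : ℕ → Fin n → Rect n, IsPartition S (fun i => col i) (fun i => row (τ i)) (d + 1) (n - 1) P := by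
  rcases Nat.eq_zero_or_pos n with rfl | hn
  · exact ⟨fun _ i => i.elim0, fun i => i.elim0, fun i => i.elim0,
      fun t ht => absurd ht (by omega), fun _ _ i => i.elim0, fun _ _ i => i.elim0⟩
  obtain ⟨h0, hstep, hwide⟩ := hR
  have : ∀ t, ∃ Q : Rect n × Rect n, t + 1 < n → Q.1 ∈ R t ∧ Q.2 ∈ R t ∧ Q.1 ≠ Q.2 ∧
      R (t + 1) = insert (Q.1 ⊔ Q.2) (((R t).erase Q.1).erase Q.2) := by
    intro t
    by_cases ht : t + 1 < n
    · obtain ⟨Q₁, h1, Q₂, h2, h3, h4⟩ := hstep t ht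
      exact ⟨(Q₁, Q₂), fun _ => ⟨h1, h2, h3, h4⟩⟩
    · exact ⟨(NonemptyInterval.pure (⟨0, hn⟩, ⟨0, hn⟩), NonemptyInterval.pure (⟨0, hn⟩, ⟨0, hn⟩)),
        fun h => absurd h ht⟩
  choose Q hQ using this
  have hmem : ∀ t, t < n → ∀ i, partOf τ Q t i ∈ R t := by
    intro t
    induction t with
    | zero =>
      intro _ i
      rw [h0]
      exact Finset.mem_image.2 ⟨i, Finset.mem_univ _, rfl⟩
    | succ t ih =>
      intro ht i
      rw [(hQ t ht).2.2.2, partOf]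
      split_ifs with h
      · exact Finset.mem_insert_self _ _
      · rw [not_or] at h
        refine Finset.mem_insert_of_mem (Finset.mem_erase.2 ⟨h.2, Finset.mem_erase.2 ⟨h.1, ?_⟩⟩)
        exact ih (by omega) i
  -- An inequality suffices, so it does not matter whether an enclosing rectangle is already in the
  -- family. At `t = n - 1` at most one rectangle remains.
  have hcard : ∀ t, t < n → (R t).card + t ≤ n := by
    intro t
    induction t with
    | zero =>
      intro _
      rw [h0]
      exact Finset.card_image_le.trans (Finset.card_fin n).le
    | succ t ih =>
      intro ht
      obtain ⟨h1, h2, h3, h4⟩ := hQ t ht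
      have ih := ih (by omega)
      rw [h4]
      have := Finset.card_insert_le ((Q t).1 ⊔ (Q t).2) (((R t).erase (Q t).1).erase (Q t).2)
      rw [Finset.card_erase_of_mem (Finset.mem_erase.2 ⟨h3.symm, h2⟩),
        Finset.card_erase_of_mem h1] at this
      have h5 : 1 < (R t).card := Finset.one_lt_card.2 ⟨_, h1, _, h2, h3⟩
      omega
  have hdeg : ∀ t ≤ n - 1, 0 < n → ∀ i, ∀ T : Finset (Fin n),
      (∀ k ∈ T, ¬ Homogeneous (partOf τ Q t i) (partOf τ Q t k)) →
        (T.image (partOf τ Q t)).card ≤ d + 1 := by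
    intro t ht hn i T hT
    have hw := hwide t (by omega) _ (hmem t (by omega) i)
    have hsub : T.image (partOf τ Q t) ⊆ insert (partOf τ Q t i) ((R t).filter fun Q' =>
        Q' ≠ partOf τ Q t i ∧ ¬ Homogeneous (partOf τ Q t i) Q') := by
      intro x hx
      obtain ⟨k, hk, rfl⟩ := Finset.mem_image.1 hx
      by_cases hki : partOf τ Q t k = partOf τ Q t i
      · rw [hki]; exact Finset.mem_insert_self _ _
      · exact Finset.mem_insert_of_mem (Finset.mem_filter.2
          ⟨hmem t (by omega) k, hki, hT k hk⟩)
    exact (Finset.card_le_card hsub).trans ((Finset.card_insert_le _ _).trans (by omega))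
  refine ⟨partOf τ Q, ?_, ?_, ?_, ?_, ?_⟩
  · intro i _ j _ hij
    have := congrArg (fun q : Rect n => q.fst.1) hij
    exact this
  · intro i _ j _
    have hn : 0 < n := i.pos
    have h1 := hcard (n - 1) (by omega)
    exact Finset.card_le_one.1 (by omega) _ (hmem (n - 1) (by omega) i) _
      (hmem (n - 1) (by omega) j)
  · intro t _ q
    -- A part that is not touched comes from itself. The new part comes from the two merged ones,
    -- and also from `q` in case the enclosing rectangle was already present.
    have hsub : ((S.filter fun i => partOf τ Q (t + 1) i = q).image (partOf τ Q t)) ⊆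
        {q, (Q t).1, (Q t).2} := by
      intro x hx
      obtain ⟨k, hk, rfl⟩ := Finset.mem_image.1 hx
      have hk := (Finset.mem_filter.1 hk).2
      rw [partOf] at hk
      simp only [Finset.mem_insert, Finset.mem_singleton]
      split_ifs at hk with h
      · exact Or.inr h
      · exact Or.inl hk
    exact (Finset.card_le_card hsub).trans Finset.card_le_three
  · intro t ht i _ j _ r hij hir hrj
    refine hdeg t ht i.pos i _ fun k hk hom => ?_
    have hk := (Finset.mem_filter.1 hk).2
    have hi := (point_mem_partOf τ Q t i).1.2
    have hj := (point_mem_partOf τ Q t j).2.2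
    rw [← hij] at hj
    obtain ⟨hk1, hk2⟩ := point_mem_partOf τ Q t k
    have hk1 := hk1.2
    have hk2 := hk2.2
    have h1 : (τ i : ℕ) < τ k := by
      by_contra hlt
      have := hrow (not_lt.1 hlt)
      omega
    have h2 : (τ k : ℕ) < τ j := by
      by_contra hlt
      have := hrow (not_lt.1 hlt)
      omega
    rcases hom.2 with h | h <;> simp only [Fin.lt_def, Fin.le_def] at * <;> omega
  · intro t ht i _ j _ r hij hir hrj
    refine hdeg t ht i.pos i _ fun k hk hom => ?_
    have hk := (Finset.mem_filter.1 hk).2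
    have hi := (point_mem_partOf τ Q t i).1.1
    have hj := (point_mem_partOf τ Q t j).2.1
    rw [← hij] at hj
    obtain ⟨hk1, hk2⟩ := point_mem_partOf τ Q t k
    have hk1 := hk1.1
    have hk2 := hk2.1
    have h1 : (i : ℕ) < k := by
      by_contra hlt
      have := hcol (not_lt.1 hlt)
      omega
    have h2 : (k : ℕ) < j := by
      by_contra hlt
      have := hcol (not_lt.1 hlt)
      omega
    rcases hom.1 with h | h <;> simp only [Fin.lt_def, Fin.le_def] at * <;> omega

/-- A permutation of twin-width `d` occupies few cells of a grid. -/
theorem card_cells_le {n : ℕ} (τ : Equiv.Perm (Fin n)) (S : Finset (Fin n)) {col row : ℕ → ℕ}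
    (hcol : Monotone col) (hrow : Monotone row) :
    (S.image fun i : Fin n => (col i, row (τ i))).card ≤
      6 * (twinWidth τ + 1) * ((S.image fun i : Fin n => col i).card +
        (S.image fun i : Fin n => row (τ i)).card) := by
  obtain ⟨R, hR⟩ : ∃ R, IsMergeSequence τ (twinWidth τ) R :=
    Nat.sInf_mem (s := {d | ∃ R, IsMergeSequence τ d R}) (exists_isMergeSequence τ)
  obtain ⟨P, hP⟩ := exists_isPartition hR S hcol hrow
  exact hP.card_cells_le (by omega)

end TwinWidth

/-! ### Density for sets of natural numbers -/

namespace TwinWidth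

/-- The permutation as a function on all natural numbers, extended by the identity. -/
def val {n : ℕ} (τ : Equiv.Perm (Fin n)) (i : ℕ) : ℕ := if h : i < n then τ ⟨i, h⟩ else i

theorem val_of_lt {n : ℕ} (τ : Equiv.Perm (Fin n)) {i : ℕ} (h : i < n) : val τ i = τ ⟨i, h⟩ :=
  dif_pos h

theorem val_injective {n : ℕ} (τ : Equiv.Perm (Fin n)) : Function.Injective (val τ) := by
  intro i j hij
  unfold val at hij
  split_ifs at hij with h1 h2 h2
  · simpa using τ.injective (Fin.ext hij)
  · have := (τ ⟨i, h1⟩).isLt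
    omega
  · have := (τ ⟨j, h2⟩).isLt
    omega
  · exact hij

theorem card_cells_val_le {n : ℕ} (τ : Equiv.Perm (Fin n)) {S : Finset ℕ} (hS : ∀ i ∈ S, i < n)
    {col row : ℕ → ℕ} (hcol : Monotone col) (hrow : Monotone row) :
    (S.image fun i => (col i, row (val τ i))).card ≤
      6 * (twinWidth τ + 1) * ((S.image col).card + (S.image fun i => row (val τ i)).card) := by
  have h := card_cells_le τ (S.attachFin hS) hcol hrow
  have key : ∀ {β : Type} [DecidableEq β] (f : ℕ → β) (g : Fin n → β), (∀ i : Fin n, f i = g i) →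
      (S.attachFin hS).image g = S.image f := by
    intro β _ f g hfg
    ext x
    simp only [Finset.mem_image, Finset.mem_attachFin]
    constructor
    · rintro ⟨i, hi, rfl⟩
      exact ⟨i, hi, hfg i⟩
    · rintro ⟨i, hi, rfl⟩
      exact ⟨⟨i, hS i hi⟩, hi, (hfg _).symm⟩
  rwa [key (fun i => (col i, row (val τ i))), key col, key fun i => row (val τ i)] at h
  · intro i; rw [val_of_lt τ i.isLt]
  · intro i; rfl
  · intro i; simp only [val_of_lt τ i.isLt]

/-! ### Counting the patterns of blocks -/

/-- A cell of doubled side consists of four cells. So a coarse picture with at most `M` cells has at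
most `2 ^ (4 * M)` refinements. -/
theorem card_image_le_of_halving {α : Type*} (F : Finset α) {G G' : α → Finset (ℕ × ℕ)} {M : ℕ}
    (h : ∀ a ∈ F, G' a = (G a).image fun p => (p.1 / 2, p.2 / 2))
    (hM : ∀ a ∈ F, (G' a).card ≤ M) :
    (F.image G).card ≤ 16 ^ M * (F.image G').card := by
  have himg : F.image G' = (F.image G).image fun H => H.image fun p => (p.1 / 2, p.2 / 2) := by
    rw [Finset.image_image]
    exact Finset.image_congr fun a ha => h a ha
  rw [himg]
  refine Finset.card_le_mul_card_image _ _ fun H hH => ?_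
  have hHM : H.card ≤ M := by
    rw [← himg] at hH
    obtain ⟨a, ha, rfl⟩ := Finset.mem_image.1 hH
    exact hM a ha
  let U : Finset (ℕ × ℕ) := H.biUnion fun p =>
    {(2 * p.1, 2 * p.2), (2 * p.1, 2 * p.2 + 1), (2 * p.1 + 1, 2 * p.2), (2 * p.1 + 1, 2 * p.2 + 1)}
  have hU : U.card ≤ M * 4 :=
    (Finset.card_biUnion_le_card_mul _ _ 4 fun p _ => Finset.card_le_four).trans (by omega)
  have hsub : ((F.image G).filter fun K => (K.image fun p => (p.1 / 2, p.2 / 2)) = H) ⊆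
      U.powerset := by
    intro K hK
    rw [Finset.mem_filter] at hK
    rw [Finset.mem_powerset]
    intro p hp
    refine Finset.mem_biUnion.2 ⟨(p.1 / 2, p.2 / 2), ?_, ?_⟩
    · rw [← hK.2]
      exact Finset.mem_image.2 ⟨p, hp, rfl⟩
    · obtain ⟨x, y⟩ := p
      simp only [Finset.mem_insert, Finset.mem_singleton, Prod.mk.injEq]
      omega
  calc _ ≤ U.powerset.card := Finset.card_le_card hsub
    _ = 2 ^ U.card := Finset.card_powerset U
    _ ≤ 2 ^ (4 * M) := Nat.pow_le_pow_right (by norm_num) (by omega)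
    _ = 16 ^ M := by rw [pow_mul]; norm_num

variable {n : ℕ} (τ : Equiv.Perm (Fin n))

/-- The number of elements less than `y` in the block of length `b` at `a`. -/
def relRank (a b y : ℕ) : ℕ := ((Finset.range b).filter fun x => val τ (a + x) < y).card

/-- The number of earlier elements of the block at `a` which are less than its `j`-th element. -/
def slot (a j : ℕ) : ℕ := ((Finset.range j).filter fun i => val τ (a + i) < val τ (a + j)).card

/-- The number with the digits `slot τ a 0, …, slot τ a (j - 1)` in base `b`. -/
def key (a b : ℕ) : ℕ → ℕ
  | 0 => 0
  | j + 1 => key a b j * b + slot τ a j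

theorem slot_le (a j : ℕ) : slot τ a j ≤ j :=
  (Finset.card_filter_le _ _).trans (Finset.card_range j).le

theorem key_lt (a b j : ℕ) (hj : j ≤ b) : key τ a b j < b ^ j := by
  induction j with
  | zero => simp [key]
  | succ j ih =>
    have h1 := ih (by omega)
    have h2 := slot_le τ a j
    have h3 : (key τ a b j + 1) * b ≤ b ^ j * b := Nat.mul_le_mul_right b h1
    rw [key, pow_succ]
    linarith

theorem relRank_mono (a b : ℕ) : Monotone (relRank τ a b) := fun _ _ hyz =>
  Finset.card_le_card (Finset.monotone_filter_right _ fun _ _ h => h.trans_le hyz)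

theorem relRank_lt {a b x : ℕ} (hx : x < b) : relRank τ a b (val τ (a + x)) < b := by
  have : ((Finset.range b).filter fun y => val τ (a + y) < val τ (a + x)) ⊂ Finset.range b :=
    Finset.filter_ssubset.2 ⟨x, Finset.mem_range.2 hx, lt_irrefl _⟩
  exact (Finset.card_lt_card this).trans_eq (Finset.card_range b)

theorem relRank_lt_relRank_iff {a b x y : ℕ} (hx : x < b) :
    relRank τ a b (val τ (a + x)) < relRank τ a b (val τ (a + y)) ↔
      val τ (a + x) < val τ (a + y) := by
  constructor
  · intro h
    by_contra hle
    exact absurd (relRank_mono τ a b (not_lt.1 hle)) (not_le.2 h)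
  · intro h
    refine Finset.card_lt_card ⟨Finset.monotone_filter_right _ fun _ _ h' => h'.trans h, fun hsub => ?_⟩
    have := hsub (Finset.mem_filter.2 ⟨Finset.mem_range.2 hx, h⟩)
    exact lt_irrefl _ (Finset.mem_filter.1 this).2

/-- The cells of side length `2 ^ i` occupied by the block of length `b` at `a`. -/
def blockCells (b i a : ℕ) : Finset (ℕ × ℕ) :=
  (Finset.range b).image fun x => (x / 2 ^ i, relRank τ a b (val τ (a + x)) / 2 ^ i)

theorem blockCells_succ (b i a : ℕ) :
    blockCells τ b (i + 1) a = (blockCells τ b i a).image fun p => (p.1 / 2, p.2 / 2) := by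
  unfold blockCells
  rw [Finset.image_image]
  refine Finset.image_congr fun x _ => ?_
  simp only [Function.comp, pow_succ, Nat.div_div_eq_div_mul]

/-- Density, with the ranks inside the block as heights. At this scale there are at most `b / 2 ^ i
+ 1` rows and as many columns. -/
theorem card_blockCells_le {b i a : ℕ} (ha : a + b ≤ n) :
    (blockCells τ b i a).card ≤ 12 * (twinWidth τ + 1) * (b / 2 ^ i + 1) := by
  have hcol : Monotone fun x => (x - a) / 2 ^ i := fun x y h =>
    Nat.div_le_div_right (Nat.sub_le_sub_right h a)
  have hrow : Monotone fun y => relRank τ a b y / 2 ^ i := fun x y h =>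
    Nat.div_le_div_right (relRank_mono τ a b h)
  have h := card_cells_val_le τ (S := (Finset.range b).image fun x => a + x) (by
    intro y hy
    obtain ⟨x, hx, rfl⟩ := Finset.mem_image.1 hy
    have := Finset.mem_range.1 hx
    omega) hcol hrow
  simp only [Finset.image_image, Function.comp_def, Nat.add_sub_cancel_left] at h
  have hbd : ∀ f : ℕ → ℕ, (∀ x < b, f x ≤ b) →
      ((Finset.range b).image fun x => f x / 2 ^ i).card ≤ b / 2 ^ i + 1 := by
    intro f hf
    have : ((Finset.range b).image fun x => f x / 2 ^ i) ⊆ Finset.range (b / 2 ^ i + 1) := by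
      intro y hy
      obtain ⟨x, hx, rfl⟩ := Finset.mem_image.1 hy
      have := Nat.div_le_div_right (c := 2 ^ i) (hf x (Finset.mem_range.1 hx))
      exact Finset.mem_range.2 (by omega)
    simpa using Finset.card_le_card this
  have h1 := hbd (fun x => x) fun x hx => hx.le
  have h2 := hbd (fun x => relRank τ a b (val τ (a + x))) fun x hx => (relRank_lt τ hx).le
  refine h.trans ?_
  calc _ ≤ 6 * (twinWidth τ + 1) * ((b / 2 ^ i + 1) + (b / 2 ^ i + 1)) := by gcongr
    _ = _ := by ring

/-- A geometric series with rounding; the additional last term makes the induction go through. -/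
theorem sum_div_pow_le (b I : ℕ) :
    (∑ i ∈ Finset.range I, b / 2 ^ (i + 1)) + b / 2 ^ I ≤ b := by
  induction I with
  | zero => simp
  | succ I ih =>
    rw [Finset.sum_range_succ]
    have : b / 2 ^ (I + 1) = b / 2 ^ I / 2 := by rw [pow_succ, Nat.div_div_eq_div_mul]
    omega

/-- At scale zero the cells form the graph of the rank function. Ranks determine all comparisons
inside the block, and these determine the slots. -/
theorem key_eq_of_blockCells_eq {a a' b : ℕ} (h : blockCells τ b 0 a = blockCells τ b 0 a') :
    key τ a b b = key τ a' b b := by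
  have hrank : ∀ x < b, relRank τ a b (val τ (a + x)) = relRank τ a' b (val τ (a' + x)) := by
    intro x hx
    have h1 : (x / 2 ^ 0, relRank τ a b (val τ (a + x)) / 2 ^ 0) ∈ blockCells τ b 0 a :=
      Finset.mem_image.2 ⟨x, Finset.mem_range.2 hx, rfl⟩
    rw [h] at h1
    obtain ⟨y, _, hxy⟩ := Finset.mem_image.1 h1
    simp only [pow_zero, Nat.div_one, Prod.mk.injEq] at hxy
    obtain ⟨rfl, hy⟩ := hxy
    exact hy.symm
  have hslot : ∀ j < b, slot τ a j = slot τ a' j := by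
    intro j hj
    unfold slot
    congr 1
    refine Finset.filter_congr fun i hi => ?_
    have hi := Finset.mem_range.1 hi
    rw [← relRank_lt_relRank_iff τ (b := b) (by omega), hrank i (by omega), hrank j hj,
      relRank_lt_relRank_iff τ (by omega)]
  have : ∀ j ≤ b, key τ a b j = key τ a' b j := by
    intro j hj
    induction j with
    | zero => rfl
    | succ j ih => rw [key, key, ih (by omega), hslot j hj]
  exact this b le_rfl

/-- Blocks of length `b` have few different patterns. -/
theorem card_keys_le {b : ℕ} (F : Finset ℕ) (hF : ∀ a ∈ F, a + b ≤ n) :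
    (F.image fun a => key τ a b b).card ≤ 2 ^ (96 * (twinWidth τ + 1) * b) := by
  have h0 : (F.image fun a => key τ a b b).card ≤ (F.image (blockCells τ b 0)).card := by
    classical
    -- The key factors through the cells, so any block with the given cells may be chosen to read it
    -- off.
    let f : Finset (ℕ × ℕ) → ℕ := fun H =>
      if h : ∃ a ∈ F, blockCells τ b 0 a = H then key τ h.choose b b else 0
    have : (F.image fun a => key τ a b b) ⊆ (F.image (blockCells τ b 0)).image f := by
      intro x hx
      obtain ⟨a, ha, rfl⟩ := Finset.mem_image.1 hx
      refine Finset.mem_image.2 ⟨_, Finset.mem_image_of_mem _ ha, ?_⟩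
      have h : ∃ a' ∈ F, blockCells τ b 0 a' = blockCells τ b 0 a := ⟨a, ha, rfl⟩
      change dite _ _ _ = _
      rw [dif_pos h]
      exact key_eq_of_blockCells_eq τ h.choose_spec.2
    exact (Finset.card_le_card this).trans Finset.card_image_le
  set D := twinWidth τ + 1
  have hI : ∀ I, (F.image (blockCells τ b 0)).card ≤
      16 ^ (∑ i ∈ Finset.range I, 12 * D * (b / 2 ^ (i + 1) + 1)) *
        (F.image (blockCells τ b I)).card := by
    intro I
    induction I with
    | zero => simp
    | succ I ih =>
      refine ih.trans ?_
      rw [Finset.sum_range_succ, pow_add, mul_assoc]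
      exact Nat.mul_le_mul_left _ (card_image_le_of_halving F
        (fun a _ => blockCells_succ τ b I a) fun a ha => card_blockCells_le τ (hF a ha))
  have hone : (F.image (blockCells τ b b)).card ≤ 1 := by
    refine Finset.card_le_one.2 ?_
    have hz : ∀ a, blockCells τ b b a = (Finset.range b).image fun _ => (0, 0) := by
      intro a
      refine Finset.image_congr fun x hx => ?_
      have hx : x < b := Finset.mem_range.1 hx
      have hb : b < 2 ^ b := Nat.lt_two_pow_self
      have := relRank_lt τ (a := a) hx
      simp only [Prod.mk.injEq]
      exact ⟨Nat.div_eq_of_lt (by omega), Nat.div_eq_of_lt (by omega)⟩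
    intro x hx y hy
    obtain ⟨a, _, rfl⟩ := Finset.mem_image.1 hx
    obtain ⟨a', _, rfl⟩ := Finset.mem_image.1 hy
    rw [hz, hz]
  -- The geometric series contributes one `b`, and the rounding terms `+ 1` of the `b` scales
  -- contribute another.
  have hsum : ∑ i ∈ Finset.range b, 12 * D * (b / 2 ^ (i + 1) + 1) ≤ 24 * D * b := by
    rw [← Finset.mul_sum, Finset.sum_add_distrib]
    have := (Nat.le_add_right _ _).trans (sum_div_pow_le b b)
    simp only [Finset.sum_const, Finset.card_range, smul_eq_mul, mul_one]
    calc _ ≤ 12 * D * (b + b) := Nat.mul_le_mul_left _ (by omega)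
      _ = _ := by ring
  calc _ ≤ _ := h0
    _ ≤ _ := hI b
    _ ≤ 16 ^ (24 * D * b) * 1 := by gcongr; norm_num
    _ = 2 ^ (96 * D * b) := by
      rw [mul_one, show (16 : ℕ) = 2 ^ 4 by norm_num, ← pow_mul]; congr 1; ring

end TwinWidth

/-! ### Weakest preconditions for programs -/

namespace CompRAM

open TwinWidth (val val_injective val_of_lt)

infixr:60 " ;; " => Prog.seq

/-- The registers written by a program. -/
@[simp] def Prog.wr : Prog → List ℕ
  | .skip => []
  | .const r _ | .move r _ | .add r _ _ | .sub r _ _ | .mul r _ _ | .div r _ _ | .load r _ _ => [r]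
  | .store _ _ _ => []
  | .seq p q | .ite _ p q => p.wr ++ q.wr
  | .loop _ p => p.wr

/-- The arrays written by a program. -/
@[simp] def Prog.wa : Prog → List ℕ
  | .store A _ _ => [A]
  | .seq p q | .ite _ p q => p.wa ++ q.wa
  | .loop _ p => p.wa
  | _ => []

/-- The memories `m` and `m'` agree outside of what `p` writes. -/
structure Frame (p : Prog) (m m' : State) : Prop where
  reg : ∀ r, r ∉ p.wr → m'.reg r = m.reg r
  arr : ∀ A, A ∉ p.wa → m'.arr A = m.arr A

theorem Frame.refl (p : Prog) (m : State) : Frame p m m := ⟨fun _ _ => rfl, fun _ _ => rfl⟩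

theorem Frame.trans {p : Prog} {m₁ m₂ m₃ : State} (h : Frame p m₁ m₂) (h' : Frame p m₂ m₃) :
    Frame p m₁ m₃ :=
  ⟨fun r hr => (h'.reg r hr).trans (h.reg r hr), fun A hA => (h'.arr A hA).trans (h.arr A hA)⟩

theorem Frame.mono {p q : Prog} {m m' : State} (h : Frame p m m') (hr : p.wr ⊆ q.wr)
    (ha : p.wa ⊆ q.wa) : Frame q m m' :=
  ⟨fun r h' => h.reg r fun h'' => h' (hr h''), fun A h' => h.arr A fun h'' => h' (ha h'')⟩

/-- All words of the memory have `w` bits. -/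
def State.Bounded (w : ℕ) (m : State) : Prop :=
  (∀ r, m.reg r < 2 ^ w) ∧ ∀ A i, m.arr A i < 2 ^ w

/-- Write the value `v` to register `r`. -/
def State.set (m : State) (r v : ℕ) : State := { m with reg := Function.update m.reg r v }

@[simp] theorem State.reg_set (m : State) (r v r' : ℕ) :
    (m.set r v).reg r' = if r' = r then v else m.reg r' := by
  simp [State.set, Function.update_apply]

@[simp] theorem State.arr_set (m : State) (r v : ℕ) : (m.set r v).arr = m.arr := rfl

@[simp] theorem State.reg_setArr (m : State) (A i v : ℕ) : (m.setArr A i v).reg = m.reg := rfl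

@[simp] theorem State.arr_setArr (m : State) (A i v A' : ℕ) :
    (m.setArr A i v).arr A' = if A' = A then Function.update (m.arr A) i v else m.arr A' := by
  simp only [State.setArr, Function.update_apply]

theorem State.setReg_eq_set {w : ℕ} (m : State) (r : ℕ) {v : ℕ} (hv : v < 2 ^ w) :
    m.setReg w r v = m.set r v := by
  simp [State.setReg, State.set, Nat.mod_eq_of_lt hv]

theorem State.Bounded.set {w : ℕ} {m : State} (h : m.Bounded w) (r : ℕ) {v : ℕ} (hv : v < 2 ^ w) :
    (m.set r v).Bounded w :=
  ⟨fun r' => by rw [State.reg_set]; split_ifs; exacts [hv, h.1 r'], h.2⟩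

theorem State.Bounded.setArr {w : ℕ} {m : State} (h : m.Bounded w) (A i : ℕ) {v : ℕ}
    (hv : v < 2 ^ w) : (m.setArr A i v).Bounded w := by
  refine ⟨h.1, fun A' i' => ?_⟩
  rw [State.arr_setArr]
  split_ifs
  · rw [Function.update_apply]; split_ifs; exacts [hv, h.2 _ _]
  · exact h.2 _ _

variable {n : ℕ} (τ : Equiv.Perm (Fin n)) (w : ℕ)

/-- `Test.Holds` in terms of `val`. -/
@[simp] def holds (m : State) : Test → Prop
  | .lt a b => m.reg a < m.reg b
  | .eq a b => m.reg a = m.reg b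
  | .elemLE a b => m.reg a < n ∧ m.reg b < n ∧ val τ (m.reg a) ≤ val τ (m.reg b)

theorem holds_iff (m : State) (c : Test) : c.Holds τ m ↔ holds τ m c := by
  cases c with
  | lt a b => exact Iff.rfl
  | eq a b => exact Iff.rfl
  | elemLE a b =>
    simp only [Test.Holds, holds]
    constructor
    · rintro ⟨ha, hb, h⟩
      rw [val_of_lt τ ha, val_of_lt τ hb]
      exact ⟨ha, hb, h⟩
    · rintro ⟨ha, hb, h⟩
      rw [val_of_lt τ ha, val_of_lt τ hb] at h
      exact ⟨ha, hb, h⟩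

/-- Started in memory `m`, the program halts after some number `t` of steps in some memory `m'`
with `Q t m'`, and without overflows in additions and multiplications outside of loops. -/
def wp : Prog → State → (ℕ → State → Prop) → Prop
  | .skip, m, Q => Q 1 m
  | .const r k, m, Q => k < 2 ^ w ∧ Q 1 (m.set r k)
  | .move r a, m, Q => Q 1 (m.set r (m.reg a))
  | .add r a b, m, Q => m.reg a + m.reg b < 2 ^ w ∧ Q 1 (m.set r (m.reg a + m.reg b))
  | .sub r a b, m, Q => Q 1 (m.set r (m.reg a - m.reg b))
  | .mul r a b, m, Q => m.reg a * m.reg b < 2 ^ w ∧ Q 1 (m.set r (m.reg a * m.reg b))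
  | .div r a b, m, Q => Q 1 (m.set r (m.reg a / m.reg b))
  | .load r A i, m, Q => Q 1 (m.set r (m.arr A (m.reg i)))
  | .store A i r, m, Q => Q 1 (m.setArr A (m.reg i) (m.reg r))
  | .seq p q, m, Q => wp p m fun t m' => wp q m' fun t' m'' => Q (t + t') m''
  | .ite c p q, m, Q => (holds τ m c → wp p m fun t m' => Q (1 + t) m') ∧
      (¬ holds τ m c → wp q m fun t m' => Q (1 + t) m')
  | .loop c p, m, Q => m.Bounded w → ∃ t m', Exec w τ (.loop c p) m t m' ∧ m'.Bounded w ∧ Q t m'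

variable {τ w}

/-- Reduction modulo `2 ^ w` never acts. Sums, products and constants are required to fit into a
word, and the other instructions cannot exceed the words that are already in memory. This is why
boundedness of the memory is carried along. -/
theorem wp_sound {p : Prog} {m : State} {Q : ℕ → State → Prop} (h : wp τ w p m Q)
    (hm : m.Bounded w) : ∃ t m', Exec w τ p m t m' ∧ m'.Bounded w ∧ Q t m' := by
  induction p generalizing m Q with
  | skip => exact ⟨1, m, .skip m, hm, h⟩
  | const r k =>
    exact ⟨1, _, .const m r k, by rw [m.setReg_eq_set r h.1]; exact ⟨hm.set r h.1, h.2⟩⟩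
  | move r a =>
    exact ⟨1, _, .move m r a, by rw [m.setReg_eq_set r (hm.1 a)]; exact ⟨hm.set r (hm.1 a), h⟩⟩
  | add r a b =>
    exact ⟨1, _, .add m r a b, by rw [m.setReg_eq_set r h.1]; exact ⟨hm.set r h.1, h.2⟩⟩
  | sub r a b =>
    have hv : m.reg a - m.reg b < 2 ^ w := (Nat.sub_le _ _).trans_lt (hm.1 a)
    exact ⟨1, _, .sub m r a b, by rw [m.setReg_eq_set r hv]; exact ⟨hm.set r hv, h⟩⟩
  | mul r a b =>
    exact ⟨1, _, .mul m r a b, by rw [m.setReg_eq_set r h.1]; exact ⟨hm.set r h.1, h.2⟩⟩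
  | div r a b =>
    have hv : m.reg a / m.reg b < 2 ^ w := (Nat.div_le_self _ _).trans_lt (hm.1 a)
    exact ⟨1, _, .div m r a b, by rw [m.setReg_eq_set r hv]; exact ⟨hm.set r hv, h⟩⟩
  | load r A i =>
    have hv : m.arr A (m.reg i) < 2 ^ w := hm.2 _ _
    exact ⟨1, _, .load m r A i, by rw [m.setReg_eq_set r hv]; exact ⟨hm.set r hv, h⟩⟩
  | store A i r => exact ⟨1, _, .store m A i r, hm.setArr _ _ (hm.1 r), h⟩
  | seq p q ihp ihq =>
    obtain ⟨t₁, m₁, he₁, hb₁, h₁⟩ := ihp h hm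
    obtain ⟨t₂, m₂, he₂, hb₂, h₂⟩ := ihq h₁ hb₁
    exact ⟨_, _, .seq he₁ he₂, hb₂, h₂⟩
  | ite c p q ihp ihq =>
    by_cases hc : holds τ m c
    · obtain ⟨t₁, m₁, he₁, hb₁, h₁⟩ := ihp (h.1 hc) hm
      exact ⟨_, _, .ite_true ((holds_iff τ m c).2 hc) he₁, hb₁, h₁⟩
    · obtain ⟨t₁, m₁, he₁, hb₁, h₁⟩ := ihq (h.2 hc) hm
      exact ⟨_, _, .ite_false (fun h' => hc ((holds_iff τ m c).1 h')) he₁, hb₁, h₁⟩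
  | loop c p _ => exact h hm

theorem wp_mono {p : Prog} {m : State} {Q Q' : ℕ → State → Prop} (h : wp τ w p m Q)
    (hQ : ∀ t m', Q t m' → Q' t m') : wp τ w p m Q' := by
  induction p generalizing m Q Q' with
  | skip | move | sub | div | load | store => exact hQ _ _ h
  | const | add | mul => exact ⟨h.1, hQ _ _ h.2⟩
  | seq p q ihp ihq => exact ihp h fun t m' h' => ihq h' fun t' m'' h'' => hQ _ _ h''
  | ite c p q ihp ihq =>
    exact ⟨fun hc => ihp (h.1 hc) fun t m' h' => hQ _ _ h',
      fun hc => ihq (h.2 hc) fun t m' h' => hQ _ _ h'⟩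
  | loop c p _ =>
    intro hm
    obtain ⟨t, m', he, hb, hq⟩ := h hm
    exact ⟨t, m', he, hb, hQ _ _ hq⟩

theorem Exec.frame {α : Type*} [LinearOrder α] {s : Fin n → α} {p : Prog} {m m' : State} {t : ℕ}
    (h : Exec w s p m t m') : Frame p m m' := by
  have hset : ∀ (m : State) (r v : ℕ) (r' : ℕ), r' ∉ [r] → (m.setReg w r v).reg r' = m.reg r' :=
    fun m r v r' hr => Function.update_of_ne (by simpa using hr) _ _
  induction h with
  | skip m => exact .refl _ m
  | const | move | add | sub | mul | div | load => exact ⟨hset _ _ _, fun _ _ => rfl⟩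
  | store m A i r => exact ⟨fun _ _ => rfl, fun A' hA => Function.update_of_ne (by simpa [Prog.wa] using hA) _ _⟩
  | seq _ _ ih₁ ih₂ =>
    exact (ih₁.mono (List.subset_append_left _ _) (List.subset_append_left _ _)).trans
      (ih₂.mono (List.subset_append_right _ _) (List.subset_append_right _ _))
  | ite_true _ _ ih => exact ih.mono (List.subset_append_left _ _) (List.subset_append_left _ _)
  | ite_false _ _ ih => exact ih.mono (List.subset_append_right _ _) (List.subset_append_right _ _)
  | @loop_true c p _ _ _ _ _ _ _ _ ih₁ ih₂ =>
    exact (ih₁.mono (q := .loop c p) (List.Subset.refl _) (List.Subset.refl _)).trans ih₂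
  | loop_false => exact .refl _ _

theorem wp_frame {p : Prog} {m : State} {Q : ℕ → State → Prop} (h : wp τ w p m Q) :
    wp τ w p m fun t m' => Q t m' ∧ Frame p m m' := by
  have hset : ∀ (m : State) (r v : ℕ) (r' : ℕ), r' ∉ [r] → (m.set r v).reg r' = m.reg r' :=
    fun m r v r' hr => Function.update_of_ne (by simpa using hr) _ _
  induction p generalizing m Q with
  | skip => exact ⟨h, .refl _ m⟩
  | const | add | mul => exact ⟨h.1, h.2, hset _ _ _, fun _ _ => rfl⟩
  | move | sub | div | load => exact ⟨h, hset _ _ _, fun _ _ => rfl⟩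
  | store => exact ⟨h, fun _ _ => rfl,
      fun A' hA => Function.update_of_ne (by simpa [Prog.wa] using hA) _ _⟩
  | seq p q ihp ihq =>
    change wp τ w p m fun t m' => wp τ w q m' fun t' m'' => _
    refine wp_mono (ihp h) fun t m' h' => wp_mono (ihq h'.1) fun t' m'' h'' => ⟨h''.1, ?_⟩
    exact (h'.2.mono (List.subset_append_left _ _) (List.subset_append_left _ _)).trans
      (h''.2.mono (List.subset_append_right _ _) (List.subset_append_right _ _))
  | ite c p q ihp ihq =>
    exact ⟨fun hc => wp_mono (ihp (h.1 hc)) fun t m' h' =>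
        ⟨h'.1, h'.2.mono (List.subset_append_left _ _) (List.subset_append_left _ _)⟩,
      fun hc => wp_mono (ihq (h.2 hc)) fun t m' h' =>
        ⟨h'.1, h'.2.mono (List.subset_append_right _ _) (List.subset_append_right _ _)⟩⟩
  | loop c p _ =>
    intro hm
    obtain ⟨t, m', he, hb, hq⟩ := h hm
    exact ⟨t, m', he, hb, hq, he.frame⟩

/-- The form in which a verified subprogram is used: the frame recovers all registers and arrays
which it does not write. -/
theorem wp_call {p : Prog} {m : State} {Q Q' : ℕ → State → Prop} (h : wp τ w p m Q)
    (hQ : ∀ t m', Q t m' → Frame p m m' → Q' t m') : wp τ w p m Q' :=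
  wp_mono (wp_frame h) fun t m' h' => hQ t m' h'.1 h'.2

theorem wp_loop {c : Test} {p : Prog} {m : State} {Q : ℕ → State → Prop}
    (h : holds τ m c → wp τ w p m fun t m' => wp τ w (.loop c p) m' fun t' m'' => Q (1 + t + t') m'')
    (h' : ¬ holds τ m c → Q 1 m) : wp τ w (.loop c p) m Q := by
  intro hm
  by_cases hc : holds τ m c
  · obtain ⟨t, m', he, hb, hq⟩ := wp_sound (h hc) hm
    obtain ⟨t', m'', he', hb', hq'⟩ := hq hb
    exact ⟨_, _, .loop_true ((holds_iff τ m c).2 hc) he he', hb', hq'⟩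
  · exact ⟨1, m, .loop_false fun h => hc ((holds_iff τ m c).1 h), hm, h' hc⟩

/-- Loops with an invariant `Inv`, and a potential `Φ` which pays for the steps. -/
theorem wp_while {c : Test} {p : Prog} {m : State} (Inv : State → Prop) (Φ : State → ℕ)
    (h0 : Inv m)
    (h : ∀ m', Frame p m m' → Inv m' → holds τ m' c →
      wp τ w p m' fun t m'' => Inv m'' ∧ t + 1 + Φ m'' ≤ Φ m') :
    wp τ w (.loop c p) m fun t m' => Inv m' ∧ ¬ holds τ m' c ∧ t + Φ m' ≤ Φ m + 1 := by
  have key : ∀ N m', Φ m' ≤ N → Frame p m m' → Inv m' → wp τ w (.loop c p) m'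
      fun t m'' => Inv m'' ∧ ¬ holds τ m'' c ∧ t + Φ m'' ≤ Φ m' + 1 := by
    intro N
    induction N with
    | zero =>
      intro m' hN hf hI
      refine wp_loop (fun hc => ?_) fun hc => ⟨hI, hc, by omega⟩
      refine wp_mono (h m' hf hI hc) fun t m'' h' => ?_
      exact absurd h'.2 (by omega)
    | succ N ih =>
      intro m' hN hf hI
      refine wp_loop (fun hc => ?_) fun hc => ⟨hI, hc, by omega⟩
      refine wp_call (h m' hf hI hc) fun t m'' h' hf' => ?_
      refine wp_mono (ih m'' (by omega) (hf.trans hf') h'.1) fun t' m₃ h'' => ?_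
      exact ⟨h''.1, h''.2.1, by omega⟩
  exact key _ m le_rfl (.refl _ _) h0

/-- Loops with a counter `i`, up to the value of register `e`. -/
theorem wp_for {i e : ℕ} {p : Prog} {m : State} (N : ℕ) (I : ℕ → State → Prop) (cost : ℕ → ℕ)
    (hie : i ≠ e) (hi1 : i ≠ 1) (hi : i ∉ p.wr) (he : e ∉ p.wr) (h1 : 1 ∉ p.wr)
    (hm1 : m.reg 1 = 1) (hme : m.reg e = N) (hmi : m.reg i ≤ N) (hN : N < 2 ^ w)
    (h0 : I (m.reg i) m)
    (h : ∀ k m', Frame (p ;; .add i i 1) m m' → m.reg i ≤ k → k < N → m'.reg i = k → I k m' →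
      wp τ w p m' fun t m'' => t ≤ cost k ∧ I (k + 1) (m''.set i (k + 1))) :
    wp τ w (.loop (.lt i e) (p ;; .add i i 1)) m fun t m' =>
      t ≤ (∑ k ∈ Finset.Ico (m.reg i) N, (cost k + 2)) + 1 ∧ m'.reg i = N ∧ I N m' := by
  have hfe : e ∉ (p ;; Prog.add i i 1).wr := by
    simp only [Prog.wr, List.mem_append, List.mem_singleton, not_or]
    exact ⟨he, hie.symm⟩
  have hf1 : 1 ∉ (p ;; Prog.add i i 1).wr := by
    simp only [Prog.wr, List.mem_append, List.mem_singleton, not_or]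
    exact ⟨h1, hi1.symm⟩
  refine wp_call (wp_while (fun m' => m.reg i ≤ m'.reg i ∧ m'.reg i ≤ N ∧ I (m'.reg i) m')
    (fun m' => ∑ k ∈ Finset.Ico (m'.reg i) N, (cost k + 2)) ⟨le_rfl, hmi, h0⟩ ?_) ?_
  · rintro m' hf ⟨hle, _, hI⟩ hc
    simp only [holds, hf.reg e hfe, hme] at hc
    simp only [wp]
    refine wp_call (h _ m' hf hle hc rfl hI) fun t m'' h' hf' => ?_
    rw [hf'.reg i hi, hf'.reg 1 h1, hf.reg 1 hf1, hm1]
    refine ⟨by omega, ⟨?_, ?_, ?_⟩, ?_⟩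
    · rw [State.reg_set, if_pos rfl]; omega
    · rw [State.reg_set, if_pos rfl]; omega
    · rw [State.reg_set, if_pos rfl]; exact h'.2
    · rw [State.reg_set, if_pos rfl, Finset.sum_eq_sum_Ico_succ_bot hc (fun k => cost k + 2)]
      have := h'.1
      omega
  · rintro t m' ⟨⟨_, hle, hI⟩, hc, ht⟩ hf
    simp only [holds, hf.reg e hfe, hme] at hc
    have heq : m'.reg i = N := by omega
    rw [heq] at hI ht
    exact ⟨by simpa using ht, heq, hI⟩

end CompRAM

/-! ### Natural merge sort -/

namespace CompRAM

open TwinWidth (val val_injective val_of_lt)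

/-- From the position in register 19, find the end of the maximal ascending run in array `X` before
the position in register 11, and put it into register 20. -/
def findRun (X : ℕ) : Prog :=
  .move 20 19 ;; .const 22 1 ;;
  .loop (.eq 22 1) (
    .const 22 0 ;;
    .ite (.lt 20 11)
      (.ite (.eq 20 19) (.add 20 20 1 ;; .const 22 1)
        (.sub 23 20 1 ;; .load 24 X 23 ;; .load 25 X 20 ;;
          .ite (.elemLE 24 25) (.add 20 20 1 ;; .const 22 1) .skip))
      .skip)

variable {n : ℕ} {τ : Equiv.Perm (Fin n)} {w : ℕ}

theorem wp_findRun {m : State} {X st hi : ℕ} (h1 : m.reg 1 = 1) (h19 : m.reg 19 = st)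
    (h11 : m.reg 11 = hi) (hst : st ≤ hi) (hw : hi + 1 < 2 ^ w)
    (hpos : ∀ p, st ≤ p → p < hi → m.arr X p < n) :
    wp τ w (findRun X) m fun t m' => st ≤ m'.reg 20 ∧ m'.reg 20 ≤ hi ∧
      (st < hi → st < m'.reg 20) ∧
      (∀ p, st < p → p < m'.reg 20 → val τ (m.arr X (p - 1)) ≤ val τ (m.arr X p)) ∧
      (m'.reg 20 < hi → val τ (m.arr X (m'.reg 20)) < val τ (m.arr X (m'.reg 20 - 1))) ∧
      t + 10 * st ≤ 10 * m'.reg 20 + 13 := by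
  have hw1 : 1 < 2 ^ w := by omega
  simp only [findRun, wp]
  refine ⟨hw1, ?_⟩
  refine wp_call (wp_while (fun m' => st ≤ m'.reg 20 ∧ m'.reg 20 ≤ hi ∧
      (∀ p, st < p → p < m'.reg 20 → val τ (m.arr X (p - 1)) ≤ val τ (m.arr X p)) ∧
      (m'.reg 22 = 1 ∨ m'.reg 22 = 0 ∧ (st < hi → st < m'.reg 20) ∧
        (m'.reg 20 < hi → val τ (m.arr X (m'.reg 20)) < val τ (m.arr X (m'.reg 20 - 1)))))
      -- The flag in register 22 holds the budget of the final iteration, which clears it without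
      -- advancing.
      (fun m' => 10 * (hi - m'.reg 20) + 10 * m'.reg 22) ?_ ?_) ?_
  · simp [h19, hst]
    intro p hp hp'
    omega
  · rintro m' hf ⟨hle, hhi, hasc, hflag⟩ hc
    have e1 : m'.reg 1 = 1 := (hf.reg 1 (by simp)).trans (by simp [h1])
    have e11 : m'.reg 11 = hi := (hf.reg 11 (by simp)).trans (by simp [h11])
    have e19 : m'.reg 19 = st := (hf.reg 19 (by simp)).trans (by simp [h19])
    have eX : m'.arr = m.arr := funext fun A => hf.arr A (by simp)
    simp only [holds, e1] at hc
    have hw0 : w ≠ 0 := by rintro rfl; simp at hw1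
    simp [wp, e1, e11, e19, eX, hw0]
    generalize m'.reg 20 = e at *
    refine ⟨fun h => ⟨fun he => ⟨by omega, ⟨by omega, h, fun p hp hp' => by omega⟩, by omega⟩,
      fun hne => ⟨fun _ _ hv => ⟨by omega, ⟨by omega, h, fun p hp hp' => ?_⟩, by omega⟩,
        fun hv => ⟨⟨hle, hhi, hasc, fun _ => by omega, fun _ =>
          hv (hpos _ (by omega) (by omega)) (hpos _ hle h)⟩, by omega⟩⟩⟩,
      fun h => ⟨⟨hle, hhi, hasc, by omega, by omega⟩, by omega⟩⟩
    rcases hp'.eq_or_lt with rfl | hlt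
    · exact hv
    · exact hasc p hp hlt
  · rintro t m' ⟨⟨hle, hhi, hasc, hflag⟩, hc, ht⟩ hf
    have e1 : m'.reg 1 = 1 := (hf.reg 1 (by simp)).trans (by simp [h1])
    simp only [holds, e1] at hc
    simp [h19] at ht
    rcases hflag with hflag | ⟨hflag, h2, h3⟩
    · exact absurd hflag hc
    · exact ⟨hle, hhi, h2, hasc, h3, by omega⟩

/-- Merge the runs of array `X` from register 12 to register 13 and from there to register 14 into
array 1. -/
def mergeRuns (X : ℕ) : Prog :=
  .move 15 12 ;; .move 16 13 ;; .move 17 12 ;;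
  .loop (.lt 17 14) (
    (.const 22 0 ;;
      .ite (.lt 15 13)
        (.load 24 X 15 ;;
          .ite (.lt 16 14)
            (.load 25 X 16 ;; .ite (.elemLE 24 25) (.const 22 1) .skip)
            (.const 22 1))
        .skip ;;
      .ite (.eq 22 1)
        (.store 1 17 24 ;; .add 15 15 1)
        (.load 25 X 16 ;; .store 1 17 25 ;; .add 16 16 1)) ;;
    .add 17 17 1)

/-- The contents of an array between two positions. -/
def seg (f : ℕ → ℕ) (a b : ℕ) : Multiset ℕ := (Finset.Ico a b).val.map f

theorem seg_self (f : ℕ → ℕ) (a : ℕ) : seg f a a = 0 := by simp [seg]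

theorem seg_succ (f : ℕ → ℕ) {a b : ℕ} (h : a ≤ b) : seg f a (b + 1) = f b ::ₘ seg f a b := by
  rw [seg, ← Finset.insert_Ico_right_eq_Ico_add_one h, Finset.insert_val_of_notMem (by simp),
    Multiset.map_cons, seg]

theorem seg_congr {f g : ℕ → ℕ} {a b : ℕ} (h : ∀ i, a ≤ i → i < b → f i = g i) :
    seg f a b = seg g a b :=
  Multiset.map_congr rfl fun i hi => by
    rw [Finset.mem_val, Finset.mem_Ico] at hi
    exact h i hi.1 hi.2

theorem seg_append (f : ℕ → ℕ) {a b c : ℕ} (hab : a ≤ b) (hbc : b ≤ c) :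
    seg f a b + seg f b c = seg f a c := by
  induction c, hbc using Nat.le_induction with
  | base => rw [seg_self, add_zero]
  | succ c hbc ih => rw [seg_succ f hbc, seg_succ f (hab.trans hbc), ← ih, Multiset.add_cons]

theorem mem_seg {f : ℕ → ℕ} {a b x : ℕ} : x ∈ seg f a b ↔ ∃ i, a ≤ i ∧ i < b ∧ f i = x := by
  simp [seg, and_assoc]

theorem seg_update_of_le {f : ℕ → ℕ} {a b k v : ℕ} (h : b ≤ k) :
    seg (Function.update f k v) a b = seg f a b :=
  seg_congr fun i _ hi => Function.update_of_ne (by omega) _ _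

/-- The first `k` cells of the merge `T` of two runs of `a` which start at `i` and `e` and end at `e`
and `f` contain the elements of the runs before `x` and `y`. -/
structure MergeInv (τ : Equiv.Perm (Fin n)) (a : ℕ → ℕ) (i e f : ℕ) (T₀ T : ℕ → ℕ) (x y k : ℕ) :
    Prop where
  ix : i ≤ x
  xe : x ≤ e
  ey : e ≤ y
  yf : y ≤ f
  hk : k + e = x + y
  seg_eq : seg T i k = seg a i x + seg a e y
  sorted : ∀ p q, i ≤ p → p ≤ q → q < k → val τ (T p) ≤ val τ (T q)
  le_left : ∀ p q, i ≤ p → p < k → x ≤ q → q < e → val τ (T p) ≤ val τ (a q)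
  le_right : ∀ p q, i ≤ p → p < k → y ≤ q → q < f → val τ (T p) ≤ val τ (a q)
  outside : ∀ p, p < i ∨ f ≤ p → T p = T₀ p

/-- What makes the written prefix stay sorted is that it lies below everything still unread in both
runs. The new element is at most the rest of its own run by `hasc`, and at most the rest of the
other one by `hy`. -/
theorem MergeInv.left {a T₀ T : ℕ → ℕ} {i e f x y k : ℕ} (h : MergeInv τ a i e f T₀ T x y k)
    (hx : x < e) (hasc : ∀ p q, i ≤ p → p ≤ q → q < e → val τ (a p) ≤ val τ (a q))
    (hy : ∀ q, y ≤ q → q < f → val τ (a x) ≤ val τ (a q)) :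
    MergeInv τ a i e f T₀ (Function.update T k (a x)) (x + 1) y (k + 1) := by
  obtain ⟨k1, k2, k3, k4, k5, k6, k7, k8, k9, k10⟩ := h
  refine ⟨by omega, by omega, k3, k4, by omega, ?_, ?_, ?_, ?_, ?_⟩
  · rw [seg_succ _ (by omega), seg_succ _ k1, seg_update_of_le le_rfl, k6, Function.update_self,
      Multiset.cons_add]
  · intro p q hp hpq hq
    rcases Nat.lt_succ_iff_lt_or_eq.1 hq with hq | rfl
    · rw [Function.update_of_ne (by omega), Function.update_of_ne (by omega)]
      exact k7 p q hp hpq hq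
    · rw [Function.update_self]
      rcases hpq.lt_or_eq with hpq | rfl
      · rw [Function.update_of_ne (by omega)]
        exact k8 p x hp hpq le_rfl hx
      · rw [Function.update_self]
  · intro p q hp hpk hq hqe
    rcases Nat.lt_succ_iff_lt_or_eq.1 hpk with hpk | rfl
    · rw [Function.update_of_ne (by omega)]
      exact k8 p q hp hpk (by omega) hqe
    · rw [Function.update_self]
      exact hasc x q k1 (by omega) hqe
  · intro p q hp hpk hq hqe
    rcases Nat.lt_succ_iff_lt_or_eq.1 hpk with hpk | rfl
    · rw [Function.update_of_ne (by omega)]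
      exact k9 p q hp hpk (by omega) hqe
    · rw [Function.update_self]
      exact hy q hq hqe
  · intro p hp
    rw [Function.update_of_ne (by omega)]
    exact k10 p hp

theorem MergeInv.right {a T₀ T : ℕ → ℕ} {i e f x y k : ℕ} (h : MergeInv τ a i e f T₀ T x y k)
    (hy : y < f) (hasc : ∀ p q, e ≤ p → p ≤ q → q < f → val τ (a p) ≤ val τ (a q))
    (hx : ∀ q, x ≤ q → q < e → val τ (a y) ≤ val τ (a q)) :
    MergeInv τ a i e f T₀ (Function.update T k (a y)) x (y + 1) (k + 1) := by
  obtain ⟨k1, k2, k3, k4, k5, k6, k7, k8, k9, k10⟩ := h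
  refine ⟨k1, k2, by omega, by omega, by omega, ?_, ?_, ?_, ?_, ?_⟩
  · rw [seg_succ _ (by omega), seg_succ _ k3, seg_update_of_le le_rfl, k6, Function.update_self,
      Multiset.add_cons]
  · intro p q hp hpq hq
    rcases Nat.lt_succ_iff_lt_or_eq.1 hq with hq | rfl
    · rw [Function.update_of_ne (by omega), Function.update_of_ne (by omega)]
      exact k7 p q hp hpq hq
    · rw [Function.update_self]
      rcases hpq.lt_or_eq with hpq | rfl
      · rw [Function.update_of_ne (by omega)]
        exact k9 p y hp hpq le_rfl hy
      · rw [Function.update_self]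
  · intro p q hp hpk hq hqe
    rcases Nat.lt_succ_iff_lt_or_eq.1 hpk with hpk | rfl
    · rw [Function.update_of_ne (by omega)]
      exact k8 p q hp hpk (by omega) hqe
    · rw [Function.update_self]
      exact hx q hq hqe
  · intro p q hp hpk hq hqe
    rcases Nat.lt_succ_iff_lt_or_eq.1 hpk with hpk | rfl
    · rw [Function.update_of_ne (by omega)]
      exact k9 p q hp hpk (by omega) hqe
    · rw [Function.update_self]
      exact hasc y q k3 (by omega) hqe
  · intro p hp
    rw [Function.update_of_ne (by omega)]
    exact k10 p hp

theorem wp_mergeRuns {m : State} {X i e f : ℕ} (hX : X ≠ 1) (h1 : m.reg 1 = 1)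
    (h12 : m.reg 12 = i) (h13 : m.reg 13 = e) (h14 : m.reg 14 = f) (hie : i ≤ e) (hef : e ≤ f)
    (hw : f + 1 < 2 ^ w) (hpos : ∀ p, i ≤ p → p < f → m.arr X p < n)
    (hasc₁ : ∀ p q, i ≤ p → p ≤ q → q < e → val τ (m.arr X p) ≤ val τ (m.arr X q))
    (hasc₂ : ∀ p q, e ≤ p → p ≤ q → q < f → val τ (m.arr X p) ≤ val τ (m.arr X q)) :
    wp τ w (mergeRuns X) m fun t m' => t ≤ 20 * (f - i) + 4 ∧
      seg (m'.arr 1) i f = seg (m.arr X) i f ∧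
      (∀ p q, i ≤ p → p ≤ q → q < f → val τ (m'.arr 1 p) ≤ val τ (m'.arr 1 q)) ∧
      ∀ p, p < i ∨ f ≤ p → m'.arr 1 p = m.arr 1 p := by
  have hw1 : 1 < 2 ^ w := by omega
  have hw0 : w ≠ 0 := by rintro rfl; simp at hw1
  simp only [mergeRuns, wp]
  refine wp_call (wp_while (fun m' => MergeInv τ (m.arr X) i e f (m.arr 1) (m'.arr 1) (m'.reg 15)
      (m'.reg 16) (m'.reg 17)) (fun m' => 20 * (f - m'.reg 17)) ?_ ?_) ?_
  · simp [h12, h13]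
    exact ⟨le_rfl, hie, le_rfl, hef, by omega, by simp [seg_self], fun p q _ _ _ => by omega,
      fun p q _ _ => by omega, fun p q _ _ => by omega, fun _ _ => rfl⟩
  · intro m' hf hI hc
    have e1 : m'.reg 1 = 1 := (hf.reg 1 (by simp)).trans (by simp [h1])
    have e13 : m'.reg 13 = e := (hf.reg 13 (by simp)).trans (by simp [h13])
    have e14 : m'.reg 14 = f := (hf.reg 14 (by simp)).trans (by simp [h14])
    have eX : m'.arr X = m.arr X := hf.arr X (by simp [hX])
    simp only [holds, e14] at hc
    simp [wp, e1, e13, e14, eX, hw0]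
    obtain ⟨k1, k2, k3, k4, k5⟩ := id hI
    have hx : ∀ (h : m'.reg 15 < e), m.arr X (m'.reg 15) < n := fun h => hpos _ k1 (by omega)
    have hy : ∀ (h : m'.reg 16 < f), m.arr X (m'.reg 16) < n := fun h => hpos _ (by omega) h
    refine ⟨fun h1 => ⟨fun h2 => ⟨fun _ _ hv => ⟨by omega, by omega, hI.left h1 hasc₁ ?_, by omega⟩,
      fun hv => ⟨by omega, by omega, hI.right h2 hasc₂ ?_, by omega⟩⟩,
      fun h2 => ⟨by omega, by omega, hI.left h1 hasc₁ fun q _ _ => by omega, by omega⟩⟩,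
      fun h1 => ⟨by omega, by omega, hI.right (by omega) hasc₂ fun q _ _ => by omega, by omega⟩⟩
    · exact fun q hq hqf => hv.trans (hasc₂ _ q k3 hq hqf)
    · exact fun q hq hqf => (hv (hx h1) (hy h2)).le.trans (hasc₁ _ q k1 hq hqf)
  · rintro t m' ⟨hI, hc, ht⟩ hf
    have e14 : m'.reg 14 = f := (hf.reg 14 (by simp)).trans (by simp [h14])
    simp only [holds, e14] at hc
    simp [h12] at ht
    obtain ⟨k1, k2, k3, k4, k5, k6, k7, k8, k9, k10⟩ := hI
    have hy : m'.reg 16 = f := by omega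
    have hx : m'.reg 15 = e := by omega
    have hk : m'.reg 17 = f := by omega
    rw [hx, hy, hk, seg_append _ hie hef] at k6
    rw [hk] at k7
    exact ⟨by omega, k6, k7, k10⟩

end CompRAM

/-! ### Natural merge sort: each pass halves the number of descents -/

namespace CompRAM

open TwinWidth (val val_injective val_of_lt)

/-- Merge the ascending runs of array `X` between the positions in registers 10 and 11 pairwise, and
count the pairs in register 18. -/
def mergePass (X : ℕ) : Prog :=
  .move 12 10 ;; .const 18 0 ;;
  .loop (.lt 12 11) (
    .move 19 12 ;; findRun X ;; .move 13 20 ;; .move 19 13 ;; findRun X ;; .move 14 20 ;;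
    mergeRuns X ;; .move 12 14 ;; .add 18 18 1) ;;
  .move 12 10 ;;
  .loop (.lt 12 11) ((.load 24 1 12 ;; .store X 12 24) ;; .add 12 12 1)

/-- Sort array `X` between the positions in registers 10 and 11. -/
def mergeSort (X : ℕ) : Prog :=
  .const 18 2 ;; .loop (.lt 1 18) (mergePass X)

variable {n : ℕ} {τ : Equiv.Perm (Fin n)} {w : ℕ}

/-- The number of descents of the sequence of elements listed by `f` between two positions. -/
def desc (τ : Equiv.Perm (Fin n)) (f : ℕ → ℕ) (a b : ℕ) : ℕ :=
  ((Finset.Ico (a + 1) b).filter fun p => val τ (f p) < val τ (f (p - 1))).card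

/-- The elements listed by `f` are ascending between two positions. -/
def Asc (τ : Equiv.Perm (Fin n)) (f : ℕ → ℕ) (a b : ℕ) : Prop :=
  ∀ p q, a ≤ p → p ≤ q → q < b → val τ (f p) ≤ val τ (f q)

theorem asc_of_forall_pred {f : ℕ → ℕ} {a b : ℕ}
    (h : ∀ p, a < p → p < b → val τ (f (p - 1)) ≤ val τ (f p)) : Asc τ f a b := by
  intro p q hp hpq hq
  induction q, hpq using Nat.le_induction with
  | base => exact le_rfl
  | succ q hpq ih => exact (ih (by omega)).trans (h (q + 1) (by omega) hq)

theorem asc_of_desc_eq_zero {f : ℕ → ℕ} {a b : ℕ} (h : desc τ f a b = 0) : Asc τ f a b := by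
  refine asc_of_forall_pred fun p hp hpb => ?_
  by_contra hlt
  have : p ∈ (Finset.Ico (a + 1) b).filter fun p => val τ (f p) < val τ (f (p - 1)) :=
    Finset.mem_filter.2 ⟨Finset.mem_Ico.2 ⟨hp, hpb⟩, not_le.1 hlt⟩
  rw [Finset.card_eq_zero.1 h] at this
  simp at this

theorem desc_mono {f : ℕ → ℕ} {a b c : ℕ} (h : b ≤ c) : desc τ f a b ≤ desc τ f a c :=
  Finset.card_le_card (Finset.filter_subset_filter _ (Finset.Ico_subset_Ico_right h))

theorem desc_congr {f g : ℕ → ℕ} {a b : ℕ} (h : ∀ p, a ≤ p → p < b → f p = g p) :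
    desc τ f a b = desc τ g a b := by
  unfold desc
  congr 1
  refine Finset.filter_congr fun p hp => ?_
  rw [Finset.mem_Ico] at hp
  rw [h p (by omega) hp.2, h (p - 1) (by omega) (by omega)]

/-- Before `b` nothing changes and after `b` nothing descends, so the only new descent can be at the
seam. -/
theorem desc_le_succ_of_asc {f g : ℕ → ℕ} {a b c : ℕ} (hg : ∀ p, p < b → g p = f p)
    (hasc : Asc τ g b c) : desc τ g a c ≤ desc τ f a b + 1 := by
  have : ((Finset.Ico (a + 1) c).filter fun p => val τ (g p) < val τ (g (p - 1))) ⊆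
      insert b ((Finset.Ico (a + 1) b).filter fun p => val τ (f p) < val τ (f (p - 1))) := by
    intro p hp
    rw [Finset.mem_filter, Finset.mem_Ico] at hp
    rw [Finset.mem_insert, Finset.mem_filter, Finset.mem_Ico]
    rcases lt_trichotomy p b with h | h | h
    · rw [hg p h, hg (p - 1) (by omega)] at hp
      exact Or.inr ⟨⟨hp.1.1, h⟩, hp.2⟩
    · exact Or.inl h
    · exact absurd (hasc (p - 1) p (by omega) (by omega) hp.1.2) (not_le.2 hp.2)
  exact (Finset.card_le_card this).trans (Finset.card_insert_le _ _)

theorem desc_eq_zero_of_asc {f : ℕ → ℕ} {a b : ℕ} (h : Asc τ f a b) : desc τ f a b = 0 := by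
  rw [desc, Finset.card_eq_zero, Finset.filter_eq_empty_iff]
  intro p hp
  rw [Finset.mem_Ico] at hp
  exact not_lt.2 (h _ _ (by omega) (by omega) hp.2)

theorem desc_add_two_le {f : ℕ → ℕ} {a b c d : ℕ} (hab : a ≤ b) (hbc : b < c) (hcd : c < d)
    (h1 : val τ (f c) < val τ (f (c - 1))) (h2 : val τ (f d) < val τ (f (d - 1))) :
    desc τ f a (b + 1) + 2 ≤ desc τ f a (d + 1) := by
  have : insert c (insert d ((Finset.Ico (a + 1) (b + 1)).filter
      fun p => val τ (f p) < val τ (f (p - 1)))) ⊆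
      (Finset.Ico (a + 1) (d + 1)).filter fun p => val τ (f p) < val τ (f (p - 1)) := by
    intro p hp
    simp only [Finset.mem_insert, Finset.mem_filter, Finset.mem_Ico] at hp ⊢
    rcases hp with rfl | rfl | hp
    · exact ⟨by omega, h1⟩
    · exact ⟨by omega, h2⟩
    · exact ⟨by omega, hp.2⟩
  have h := Finset.card_le_card this
  rw [Finset.card_insert_of_notMem, Finset.card_insert_of_notMem] at h
  · exact h
  · simp only [Finset.mem_filter, Finset.mem_Ico]; omega
  · simp only [Finset.mem_insert, Finset.mem_filter, Finset.mem_Ico]; omega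

/-- After `k` merges of adjacent runs of `a`, up to position `i`. -/
structure PassInv (τ : Equiv.Perm (Fin n)) (a : ℕ → ℕ) (lo hi : ℕ) (T : ℕ → ℕ)
    (i k : ℕ) : Prop where
  lo_le : lo ≤ i
  le_hi : i ≤ hi
  seg_eq : seg T lo i = seg a lo i
  eq_lo : k = 0 → i = lo
  desc_le : desc τ T lo i ≤ k - 1
  le_desc : i < hi → 2 * k ≤ desc τ a lo (i + 1)
  le_desc_add : 2 * k ≤ desc τ a lo hi + 2

/-- Merging two runs uses up the descents of `a` at `e` and `f`, unless the end has been reached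
there, and creates at most one descent, at the seam `i`. The first merge has no seam, which gives `k
- 1` rather than `k`. -/
theorem PassInv.step {a T T' : ℕ → ℕ} {lo hi i k e f : ℕ} (h : PassInv τ a lo hi T i k)
    (hie : i < e) (hef : e ≤ f) (hf : f ≤ hi) (hef' : e < hi → e < f)
    (h1 : e < hi → val τ (a e) < val τ (a (e - 1))) (h2 : f < hi → val τ (a f) < val τ (a (f - 1)))
    (hseg : seg T' i f = seg a i f) (hasc : Asc τ T' i f) (hT : ∀ p, p < i ∨ f ≤ p → T' p = T p) :
    PassInv τ a lo hi T' f (k + 1) := by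
  obtain ⟨g1, g2, g3, g4, g5, g6, g7⟩ := h
  refine ⟨by omega, hf, ?_, by omega, ?_, ?_, ?_⟩
  · rw [← seg_append _ g1 (by omega : i ≤ f), ← seg_append a g1 (by omega : i ≤ f), hseg, ← g3]
    congr 1
    exact seg_congr fun p _ hp => hT p (Or.inl hp)
  · rcases Nat.eq_zero_or_pos k with rfl | hk
    · rw [g4 rfl] at hasc
      rw [desc_eq_zero_of_asc hasc]
    · have := desc_le_succ_of_asc (a := lo) (fun p hp => hT p (Or.inl hp)) hasc
      omega
  · intro hfhi
    have := desc_add_two_le g1 hie (hef' (by omega)) (h1 (by omega)) (h2 hfhi)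
    have := g6 (by omega)
    omega
  · have := g6 (by omega)
    have := desc_mono (τ := τ) (f := a) (a := lo) (show i + 1 ≤ hi by omega)
    omega

theorem wp_mergePass {m : State} {X lo hi : ℕ} (hX : X ≠ 1) (h1 : m.reg 1 = 1)
    (h10 : m.reg 10 = lo) (h11 : m.reg 11 = hi) (hlo : lo ≤ hi) (hw : 2 * hi + 3 < 2 ^ w)
    (hpos : ∀ p, lo ≤ p → p < hi → m.arr X p < n) :
    wp τ w (mergePass X) m fun t m' => t ≤ 80 * (hi - lo) + 10 ∧
      seg (m'.arr X) lo hi = seg (m.arr X) lo hi ∧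
      desc τ (m'.arr X) lo hi ≤ m'.reg 18 - 1 ∧ 2 * m'.reg 18 ≤ desc τ (m.arr X) lo hi + 2 ∧
      ∀ p, p < lo ∨ hi ≤ p → m'.arr X p = m.arr X p := by
  have hw1 : 1 < 2 ^ w := by omega
  have hw0 : w ≠ 0 := by rintro rfl; simp at hw1
  -- Through `le_desc_add` this bounds the counter in register 18, so that it cannot overflow.
  have hdesc : ∀ j, desc τ (m.arr X) lo j ≤ j := fun j =>
    (Finset.card_filter_le _ _).trans (by rw [Nat.card_Ico]; omega)
  simp only [mergePass, wp]
  refine ⟨by simp, ?_⟩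
  refine wp_call (wp_while (fun m' => m'.arr X = m.arr X ∧
    PassInv τ (m.arr X) lo hi (m'.arr 1) (m'.reg 12) (m'.reg 18))
    (fun m' => 70 * (hi - m'.reg 12)) ?_ ?_) ?_
  · simp [h10]
    refine ⟨le_rfl, hlo, by simp [seg_self], fun _ => rfl, by simp [desc], by omega, by omega⟩
  · rintro m' hf ⟨eX, hI⟩ hc
    have e1 : m'.reg 1 = 1 := (hf.reg 1 (by simp [findRun, mergeRuns])).trans (by simp [h1])
    have e11 : m'.reg 11 = hi := (hf.reg 11 (by simp [findRun, mergeRuns])).trans (by simp [h11])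
    simp only [holds, e11] at hc
    have hlo' := hI.lo_le
    simp only [wp]
    refine wp_call (wp_findRun (X := X) (st := m'.reg 12) (hi := hi) (by simp [e1]) (by simp)
      (by simp [e11]) hc.le (by omega) (by simp [eX]; exact fun p hp => hpos p (by omega))) ?_
    rintro t₁ m₁ ⟨a1, a2, a3, a4, a5, a6⟩ f₁
    simp only [State.arr_set, eX] at a4 a5
    have e1' : m₁.reg 1 = 1 := (f₁.reg 1 (by simp [findRun])).trans (by simp [e1])
    have e11' : m₁.reg 11 = hi := (f₁.reg 11 (by simp [findRun])).trans (by simp [e11])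
    have e12' : m₁.reg 12 = m'.reg 12 := (f₁.reg 12 (by simp [findRun])).trans (by simp)
    have e18' : m₁.reg 18 = m'.reg 18 := (f₁.reg 18 (by simp [findRun])).trans (by simp)
    have eA' : m₁.arr = m'.arr := funext fun A => f₁.arr A (by simp [findRun])
    refine wp_call (wp_findRun (X := X) (st := m₁.reg 20) (hi := hi) (by simp [e1']) (by simp)
      (by simp [e11']) a2 (by omega) (by simp [eA', eX]; exact fun p hp => hpos p (by omega))) ?_
    rintro t₂ m₂ ⟨b1, b2, b3, b4, b5, b6⟩ f₂
    simp only [State.arr_set, eA', eX] at b4 b5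
    have e1'' : m₂.reg 1 = 1 := (f₂.reg 1 (by simp [findRun])).trans (by simp [e1'])
    have e12'' : m₂.reg 12 = m'.reg 12 := (f₂.reg 12 (by simp [findRun])).trans (by simp [e12'])
    have e18'' : m₂.reg 18 = m'.reg 18 := (f₂.reg 18 (by simp [findRun])).trans (by simp [e18'])
    have e13'' : m₂.reg 13 = m₁.reg 20 := (f₂.reg 13 (by simp [findRun])).trans (by simp)
    have eA'' : m₂.arr = m'.arr := (funext fun A => f₂.arr A (by simp [findRun])).trans eA'
    refine wp_call (wp_mergeRuns (τ := τ) (X := X) (i := m'.reg 12) (e := m₁.reg 20)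
      (f := m₂.reg 20) hX (by simp [e1'']) (by simp [e12'']) (by simp [e13'']) (by simp) a1 b1
      (by omega) (by simp [eA'', eX]; exact fun p hp hp' => hpos p (by omega) (by omega))
      (by simp only [State.arr_set, eA'', eX]; exact asc_of_forall_pred a4)
      (by simp only [State.arr_set, eA'', eX]; exact asc_of_forall_pred b4)) ?_
    rintro t₃ m₃ ⟨c1, c2, c3, c4⟩ f₃
    have e1₃ : m₃.reg 1 = 1 := (f₃.reg 1 (by simp [mergeRuns])).trans (by simp [e1''])
    have e14₃ : m₃.reg 14 = m₂.reg 20 := (f₃.reg 14 (by simp [mergeRuns])).trans (by simp)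
    have e18₃ : m₃.reg 18 = m'.reg 18 := (f₃.reg 18 (by simp [mergeRuns])).trans (by simp [e18''])
    have eX₃ : m₃.arr X = m.arr X :=
      (f₃.arr X (by simp [mergeRuns, hX])).trans (by simp [eA'', eX])
    simp only [State.arr_set, eA'', eX] at c2 c4
    have hI' := hI.step (a3 hc) b1 b2 b3 a5 b5 c2 c3 c4
    have hk := hI'.le_desc_add
    have := hdesc hi
    simp [e1₃, e14₃, e18₃, eX₃, hI']
    omega
  · rintro t m' ⟨⟨eX, hI⟩, hc, ht⟩ hf
    have e1 : m'.reg 1 = 1 := (hf.reg 1 (by simp [findRun, mergeRuns])).trans (by simp [h1])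
    have e10 : m'.reg 10 = lo := (hf.reg 10 (by simp [findRun, mergeRuns])).trans (by simp [h10])
    have e11 : m'.reg 11 = hi := (hf.reg 11 (by simp [findRun, mergeRuns])).trans (by simp [h11])
    simp only [holds, e11] at hc
    have hi12 : m'.reg 12 = hi := le_antisymm hI.le_hi (not_lt.1 hc)
    rw [hi12] at hI
    simp [h10] at ht
    refine wp_call (wp_for (i := 12) (e := 11) hi (fun k m'' =>
      (∀ p, lo ≤ p → p < k → m''.arr X p = m'.arr 1 p) ∧
      (∀ p, p < lo ∨ k ≤ p → m''.arr X p = m.arr X p)) (fun _ => 2) (by decide) (by decide)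
      (by simp) (by simp) (by simp) (by simp [e1]) (by simp [e11]) (by simp [e10, hlo])
      (by omega) ?_ ?_) ?_
    · simp [e10, eX]
      intro p hp hp'; omega
    · rintro k m'' hf' hk hkhi h12 ⟨g1, g2⟩
      have e1' : m''.arr 1 = m'.arr 1 := (hf'.arr 1 (by simp [hX.symm])).trans (by simp)
      simp [wp, h12, e1']
      constructor
      · intro p hp hpk
        rcases hpk.eq_or_lt with rfl | hpk
        · rw [Function.update_self]
        · rw [Function.update_of_ne (by omega)]
          exact g1 p hp (by omega)
      · intro p hp
        simp [e10] at hk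
        rw [Function.update_of_ne (by omega)]
        exact g2 p (by omega)
    · rintro t' m'' ⟨ht', -, g1, g2⟩ hf'
      have e18 : m''.reg 18 = m'.reg 18 := (hf'.reg 18 (by simp)).trans (by simp)
      simp [e10] at ht'
      refine ⟨by omega, ?_, ?_, ?_, g2⟩
      · rw [seg_congr g1, hI.seg_eq]
      · rw [desc_congr g1, e18]; exact hI.desc_le
      · rw [e18]; exact hI.le_desc_add

/-- If a pass merges `k` pairs, then at most `k - 1` descents remain, and `k - 1` is at most half of
the earlier number. So the bound `D` is halved by each pass. A pass with at most one pair leaves a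
sorted array and is the last one. -/
theorem wp_mergeSort_loop {X lo hi : ℕ} {a : ℕ → ℕ} (hX : X ≠ 1) (hlo : lo ≤ hi)
    (hw : 2 * hi + 3 < 2 ^ w) (hpos : ∀ p, lo ≤ p → p < hi → a p < n) (D : ℕ) {m : State}
    (h1 : m.reg 1 = 1) (h10 : m.reg 10 = lo) (h11 : m.reg 11 = hi)
    (hseg : seg (m.arr X) lo hi = seg a lo hi)
    (hout : ∀ p, p < lo ∨ hi ≤ p → m.arr X p = a p)
    (hD : desc τ (m.arr X) lo hi ≤ D) (h18 : 1 < m.reg 18) :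
    wp τ w (.loop (.lt 1 18) (mergePass X)) m fun t m' =>
      t ≤ (80 * (hi - lo) + 11) * (Nat.log 2 D + 1) + 1 ∧
      seg (m'.arr X) lo hi = seg a lo hi ∧ Asc τ (m'.arr X) lo hi ∧
      ∀ p, p < lo ∨ hi ≤ p → m'.arr X p = a p := by
  induction D using Nat.strong_induction_on generalizing m with
  | _ D ih =>
  refine wp_loop (fun _ => ?_) fun hc => absurd h18 (by simpa [h1] using hc)
  have hpos' : ∀ p, lo ≤ p → p < hi → m.arr X p < n := by
    intro p hp hp'
    have : m.arr X p ∈ seg a lo hi := hseg ▸ mem_seg.2 ⟨p, hp, hp', rfl⟩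
    obtain ⟨q, hq, hq', hqp⟩ := mem_seg.1 this
    rw [← hqp]; exact hpos q hq hq'
  refine wp_call (wp_mergePass hX h1 h10 h11 hlo hw hpos') ?_
  rintro t m' ⟨c1, c2, c3, c4, c5⟩ hf
  have e1 : m'.reg 1 = 1 := (hf.reg 1 (by simp [mergePass, findRun, mergeRuns])).trans h1
  have e10 : m'.reg 10 = lo := (hf.reg 10 (by simp [mergePass, findRun, mergeRuns])).trans h10
  have e11 : m'.reg 11 = hi := (hf.reg 11 (by simp [mergePass, findRun, mergeRuns])).trans h11
  by_cases h18' : 1 < m'.reg 18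
  · have hD2 : 2 ≤ D := by omega
    have hlog : Nat.log 2 D = Nat.log 2 (D / 2) + 1 := Nat.log_of_one_lt_of_le (by omega) hD2
    refine wp_mono (ih (D / 2) (by omega) e1 e10 e11 (c2.trans hseg)
      (fun p hp => (c5 p hp).trans (hout p hp)) (by omega) h18') ?_
    rintro t' m'' ⟨d1, d2⟩
    refine ⟨?_, d2⟩
    rw [hlog]
    linarith
  · refine wp_loop (fun hc => absurd (by simpa [e1] using hc) h18') fun _ => ?_
    refine ⟨?_, c2.trans hseg, asc_of_desc_eq_zero (by omega),
      fun p hp => (c5 p hp).trans (hout p hp)⟩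
    have : 80 * (hi - lo) + 11 ≤ (80 * (hi - lo) + 11) * (Nat.log 2 D + 1) :=
      Nat.le_mul_of_pos_right _ (by omega)
    omega

theorem wp_mergeSort {m : State} {X lo hi : ℕ} (hX : X ≠ 1) (h1 : m.reg 1 = 1)
    (h10 : m.reg 10 = lo) (h11 : m.reg 11 = hi) (hlo : lo ≤ hi) (hw : 2 * hi + 3 < 2 ^ w)
    (hpos : ∀ p, lo ≤ p → p < hi → m.arr X p < n) :
    wp τ w (mergeSort X) m fun t m' =>
      t ≤ (80 * (hi - lo) + 13) * (Nat.log 2 (desc τ (m.arr X) lo hi) + 1) ∧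
      seg (m'.arr X) lo hi = seg (m.arr X) lo hi ∧ Asc τ (m'.arr X) lo hi ∧
      ∀ p, p < lo ∨ hi ≤ p → m'.arr X p = m.arr X p := by
  simp only [mergeSort, wp]
  refine ⟨by omega, ?_⟩
  refine wp_mono (wp_mergeSort_loop (m := m.set 18 2) (a := m.arr X) hX hlo hw hpos _ (by simp [h1]) (by simp [h10])
    (by simp [h11]) rfl (fun _ _ => rfl) le_rfl (by simp)) ?_
  rintro t m' ⟨c1, c2⟩
  refine ⟨?_, c2⟩
  simp only [State.arr_set] at c1
  linarith

theorem log_desc_le (f : ℕ → ℕ) (a b : ℕ) : Nat.log 2 (desc τ f a b) ≤ Nat.log 2 (b - a) :=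
  Nat.log_mono_right ((Finset.card_filter_le _ _).trans (by simp; omega))

theorem mergeSort_wr (X : ℕ) : ∀ r ∈ (mergeSort X).wr, 12 ≤ r ∧ r ≤ 25 := by
  simp [mergeSort, mergePass, findRun, mergeRuns]

theorem mergeSort_wa (X : ℕ) : ∀ A ∈ (mergeSort X).wa, A = 1 ∨ A = X := by
  simp [mergeSort, mergePass, findRun, mergeRuns]

end CompRAM

/-! ### Distribution of sorted blocks to strips -/

namespace CompRAM

open TwinWidth (val val_injective val_of_lt twinWidth card_cells_val_le)

variable {n : ℕ} {τ : Equiv.Perm (Fin n)}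

/-- The index of the strip of `y` between the elements listed by the first `N` cells of `P`. -/
def strip (τ : Equiv.Perm (Fin n)) (P : ℕ → ℕ) (N y : ℕ) : ℕ :=
  ((Finset.range N).filter fun p => val τ (P p) < y).card

theorem strip_le (P : ℕ → ℕ) (N y : ℕ) : strip τ P N y ≤ N :=
  (Finset.card_filter_le _ _).trans (Finset.card_range N).le

theorem strip_mono (P : ℕ → ℕ) (N : ℕ) : Monotone (strip τ P N) := fun _ _ h =>
  Finset.card_le_card (Finset.monotone_filter_right _ fun _ _ h' => h'.trans_le h)

theorem strip_lt_strip {P : ℕ → ℕ} {N p y z : ℕ} (hp : p < N) (hy : y ≤ val τ (P p))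
    (hz : val τ (P p) < z) : strip τ P N y < strip τ P N z := by
  refine Finset.card_lt_card ⟨Finset.monotone_filter_right _ fun _ _ h => h.trans (hy.trans_lt hz),
    fun hsub => ?_⟩
  have := hsub (Finset.mem_filter.2 ⟨Finset.mem_range.2 hp, hz⟩)
  exact absurd hy (not_le.2 (Finset.mem_filter.1 this).2)

theorem strip_eq_of_forall {P : ℕ → ℕ} {N r y : ℕ} (hr : r ≤ N) (h1 : ∀ p < r, val τ (P p) < y)
    (h2 : ∀ p, r ≤ p → p < N → y ≤ val τ (P p)) : strip τ P N y = r := by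
  have : ((Finset.range N).filter fun p => val τ (P p) < y) = Finset.range r := by
    ext p
    simp only [Finset.mem_filter, Finset.mem_range]
    constructor
    · rintro ⟨hp, hlt⟩
      by_contra hle
      exact absurd (h2 p (not_lt.1 hle) hp) (not_le.2 hlt)
    · exact fun hp => ⟨by omega, h1 p hp⟩
  rw [strip, this, Finset.card_range]

/-- Since the pivots ascend, those below `y` are exactly the first `strip τ P N y` of them. This
lemma and the next are the two halves of that. -/
theorem lt_strip {P : ℕ → ℕ} {N p y : ℕ} (hP : Asc τ P 0 N) (hp : p < strip τ P N y) :
    val τ (P p) < y := by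
  by_contra hle
  have hN := strip_le (τ := τ) P N y
  have : ((Finset.range N).filter fun q => val τ (P q) < y) ⊆ Finset.range p := by
    intro q hq
    rw [Finset.mem_filter, Finset.mem_range] at hq
    rw [Finset.mem_range]
    by_contra hpq
    exact absurd (hP p q (Nat.zero_le _) (not_lt.1 hpq) hq.1) (by omega)
  have := Finset.card_le_card this
  rw [Finset.card_range] at this
  exact absurd hp (not_lt.2 this)

theorem le_of_strip_le {P : ℕ → ℕ} {N p y : ℕ} (hP : Asc τ P 0 N) (hp : strip τ P N y ≤ p)
    (hpN : p < N) : y ≤ val τ (P p) := by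
  by_contra hlt
  have : Finset.range (p + 1) ⊆ (Finset.range N).filter fun q => val τ (P q) < y := by
    intro q hq
    rw [Finset.mem_range] at hq
    rw [Finset.mem_filter, Finset.mem_range]
    exact ⟨by omega, (hP q p (Nat.zero_le _) (by omega) hpN).trans_lt (not_le.1 hlt)⟩
  have := Finset.card_le_card this
  rw [Finset.card_range] at this
  exact absurd hp (not_le.2 this)

/-- The final position of index `j` in the stable sort by `st` of the indices from `a` to `e`. -/
def posn (st : ℕ → ℕ) (a e j : ℕ) : ℕ :=
  a + ((Finset.Ico a e).filter fun i => st i < st j ∨ st i = st j ∧ i < j).card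

/-- The position at which strip `r` starts in the stable sort by `st`. -/
def bound (st : ℕ → ℕ) (a e r : ℕ) : ℕ := a + ((Finset.Ico a e).filter fun i => st i < r).card

section posn

variable {st : ℕ → ℕ} {a e : ℕ}

theorem posn_lt_posn {j j' : ℕ} (hj : a ≤ j) (hje : j < e)
    (h : st j < st j' ∨ st j = st j' ∧ j < j') : posn st a e j < posn st a e j' := by
  refine Nat.add_lt_add_left (Finset.card_lt_card ⟨?_, fun hsub => ?_⟩) _
  · exact Finset.monotone_filter_right _ fun i _ hi => by omega
  · have := hsub (Finset.mem_filter.2 ⟨Finset.mem_Ico.2 ⟨hj, hje⟩, h⟩)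
    have := (Finset.mem_filter.1 this).2
    omega

theorem posn_injOn : Set.InjOn (posn st a e) (Finset.Ico a e : Set ℕ) := by
  intro i hi j hj hij
  simp only [Finset.coe_Ico, Set.mem_Ico] at hi hj
  by_contra hne
  rcases lt_trichotomy (st i) (st j) with h | h | h
  · exact absurd hij (posn_lt_posn hi.1 hi.2 (Or.inl h)).ne
  · rcases lt_or_gt_of_ne hne with h' | h'
    · exact absurd hij (posn_lt_posn hi.1 hi.2 (Or.inr ⟨h, h'⟩)).ne
    · exact absurd hij (posn_lt_posn hj.1 hj.2 (Or.inr ⟨h.symm, h'⟩)).ne'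
  · exact absurd hij (posn_lt_posn hj.1 hj.2 (Or.inl h)).ne'

theorem bound_mono : Monotone (bound st a e) := fun _ _ h =>
  Nat.add_le_add_left (Finset.card_le_card
    (Finset.monotone_filter_right _ fun _ _ h' => h'.trans_le h)) _

theorem bound_zero : bound st a e 0 = a := by simp [bound]

theorem bound_eq_of_forall {r : ℕ} (hae : a ≤ e) (h : ∀ j, a ≤ j → j < e → st j < r) :
    bound st a e r = e := by
  rw [bound, Finset.filter_true_of_mem, Nat.card_Ico]
  · omega
  · intro j hj
    rw [Finset.mem_Ico] at hj
    exact h j hj.1 hj.2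

theorem le_bound {r : ℕ} : a ≤ bound st a e r := Nat.le_add_right _ _

theorem bound_le {r : ℕ} (hae : a ≤ e) : bound st a e r ≤ e := by
  have := (Finset.card_filter_le (Finset.Ico a e) fun i => st i < r).trans_eq (Nat.card_Ico _ _)
  unfold bound
  omega

theorem bound_succ {r : ℕ} : bound st a e (r + 1) =
    bound st a e r + ((Finset.Ico a e).filter fun i => st i = r).card := by
  unfold bound
  rw [add_assoc, ← Finset.card_union_of_disjoint]
  · congr 2
    ext i
    simp only [Finset.mem_filter, Finset.mem_union, Finset.mem_Ico]
    omega
  · refine Finset.disjoint_left.2 fun i h1 h2 => ?_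
    rw [Finset.mem_filter] at h1 h2
    omega

/-- The form in which counting sort computes positions: the start of the strip, plus the number of
elements of the strip that were placed before. -/
theorem posn_eq {j : ℕ} (hj : j ≤ e) : posn st a e j =
    bound st a e (st j) + ((Finset.Ico a j).filter fun i => st i = st j).card := by
  unfold posn bound
  rw [add_assoc, ← Finset.card_union_of_disjoint]
  · congr 2
    ext i
    simp only [Finset.mem_filter, Finset.mem_union, Finset.mem_Ico]
    omega
  · refine Finset.disjoint_left.2 fun i h1 h2 => ?_
    rw [Finset.mem_filter] at h1 h2
    omega

theorem bound_le_posn {j : ℕ} (hj : j ≤ e) : bound st a e (st j) ≤ posn st a e j := by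
  rw [posn_eq hj]; exact Nat.le_add_right _ _

theorem posn_lt_bound {j : ℕ} (hj : a ≤ j) (hje : j < e) :
    posn st a e j < bound st a e (st j + 1) := by
  refine Nat.add_lt_add_left (Finset.card_lt_card ⟨?_, fun hsub => ?_⟩) _
  · exact Finset.monotone_filter_right _ fun i _ hi => by omega
  · have := hsub (Finset.mem_filter.2 ⟨Finset.mem_Ico.2 ⟨hj, hje⟩, by omega⟩)
    have := (Finset.mem_filter.1 this).2
    omega

theorem st_eq_iff {j r : ℕ} (hj : a ≤ j) (hje : j < e) :
    st j = r ↔ bound st a e r ≤ posn st a e j ∧ posn st a e j < bound st a e (r + 1) := by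
  have h1 := bound_le_posn (st := st) (a := a) hje.le
  have h2 := posn_lt_bound (st := st) hj hje
  constructor
  · rintro rfl
    exact ⟨h1, h2⟩
  · rintro ⟨h3, h4⟩
    rcases lt_trichotomy (st j) r with h | h | h
    · have := bound_mono (st := st) (a := a) (e := e) (show st j + 1 ≤ r from h)
      omega
    · exact h
    · have := bound_mono (st := st) (a := a) (e := e) (show r + 1 ≤ st j from h)
      omega

/-- An injection of a finite interval into itself is onto. -/
theorem image_posn : (Finset.Ico a e).image (posn st a e) = Finset.Ico a e := by
  refine Finset.eq_of_subset_of_card_le ?_ ?_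
  · intro p hp
    obtain ⟨j, hj, rfl⟩ := Finset.mem_image.1 hp
    rw [Finset.mem_Ico] at hj
    have h1 := posn_lt_bound (st := st) hj.1 hj.2
    have h2 := bound_le (st := st) (r := st j + 1) (show a ≤ e by omega)
    exact Finset.mem_Ico.2 ⟨Nat.le_add_right _ _, by omega⟩
  · rw [Finset.card_image_of_injOn posn_injOn]

theorem exists_posn_eq {p : ℕ} (hp : a ≤ p) (hpe : p < e) :
    ∃ j, a ≤ j ∧ j < e ∧ posn st a e j = p := by
  have : p ∈ (Finset.Ico a e).image (posn st a e) := by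
    rw [image_posn]; exact Finset.mem_Ico.2 ⟨hp, hpe⟩
  obtain ⟨j, hj, rfl⟩ := Finset.mem_image.1 this
  rw [Finset.mem_Ico] at hj
  exact ⟨j, hj.1, hj.2, rfl⟩

theorem seg_eq_of_posn {A T : ℕ → ℕ} (h : ∀ j, a ≤ j → j < e → T (posn st a e j) = A j) :
    seg T a e = seg A a e := by
  rw [seg]
  conv_lhs => rw [← image_posn (st := st)]
  rw [Finset.image_val_of_injOn posn_injOn, Multiset.map_map]
  refine Multiset.map_congr rfl fun j hj => ?_
  rw [Finset.mem_val, Finset.mem_Ico] at hj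
  exact h j hj.1 hj.2

end posn

/-- `A` lists the positions from `a` to `e`, sorted within blocks of length `B`. -/
structure BlockSorted (τ : Equiv.Perm (Fin n)) (A : ℕ → ℕ) (a e B : ℕ) : Prop where
  lt : ∀ j, a ≤ j → j < e → A j < n
  div_eq : ∀ j, a ≤ j → j < e → A j / B = j / B
  inj : ∀ i j, a ≤ i → i < e → a ≤ j → j < e → A i = A j → i = j
  asc : ∀ i j, a ≤ i → i ≤ j → j < e → i / B = j / B → val τ (A i) ≤ val τ (A j)

section BlockSorted

variable {A P : ℕ → ℕ} {a e B N s : ℕ}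

/-- The blocks which meet strip `r`. -/
def stripBlocks (st : ℕ → ℕ) (a e B r : ℕ) : Finset ℕ :=
  ((Finset.Ico a e).filter fun j => st j = r).image fun j => j / B

theorem div_between {i j k : ℕ} (h1 : i ≤ j) (h2 : j ≤ k) (h : i / B = k / B) :
    j / B = k / B :=
  le_antisymm (Nat.div_le_div_right h2) (h ▸ Nat.div_le_div_right h1)

/-- The index `j` starts a block, or is in another strip than its predecessor. -/
def StartsCell (st : ℕ → ℕ) (B j : ℕ) : Prop := j % B = 0 ∨ st (j - 1) ≠ st j

instance (st : ℕ → ℕ) (B j : ℕ) : Decidable (StartsCell st B j) := by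
  unfold StartsCell; infer_instance

/-- Inside a block the strip is monotone in the index, so each occupied cell is a contiguous stretch
of indices and begins only once. -/
theorem BlockSorted.card_startsCell_le (h : BlockSorted τ A a e B) {st : ℕ → ℕ}
    (hst : ∀ j, st j = strip τ P N (val τ (A j))) :
    ((Finset.Ico a e).filter fun j => StartsCell st B j).card ≤
      ((Finset.Ico a e).image fun j => (j / B, st j)).card := by
  refine Finset.card_le_card_of_injOn (fun j => (j / B, st j)) ?_ ?_
  · intro j hj
    exact Finset.mem_coe.2 (Finset.mem_image_of_mem _ (Finset.mem_filter.1 hj).1)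
  · have key : ∀ i j, a ≤ i → i < j → j < e → StartsCell st B j → i / B = j / B → st i ≠ st j := by
      intro i j hi hij hj hs hB' hst'
      have hd := div_between (B := B) (show i ≤ j - 1 by omega) (Nat.sub_le j 1) hB'
      rcases hs with hs | hs
      · have h1 := Nat.div_add_mod j B
        have h2 := Nat.div_mul_le_self (j - 1) B
        rw [hd, mul_comm] at h2
        omega
      · refine hs (le_antisymm ?_ ?_)
        · rw [hst, hst]
          exact strip_mono P N (h.asc _ _ (by omega) (by omega) hj hd)
        · rw [← hst', hst, hst]
          exact strip_mono P N (h.asc _ _ hi (by omega) (by omega) (hB'.trans hd.symm))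
    intro i hi j hj hij
    simp only [Finset.coe_filter, Set.mem_ofPred_eq, Finset.mem_Ico] at hi hj
    simp only [Prod.mk.injEq] at hij
    rcases lt_trichotomy i j with hlt | heq | hlt
    · exact absurd hij.2 (key i j hi.1.1 hlt hj.1.2 hj.2 hij.1)
    · exact heq
    · exact absurd hij.2.symm (key j i hj.1.1 hlt hi.1.2 hi.2 hij.1.symm)

/-- If every `s`-th element separates strips, a strip has few elements of each block. -/
theorem BlockSorted.card_cell_le (h : BlockSorted τ A a e B) {st : ℕ → ℕ}
    (hst : ∀ j, st j = strip τ P N (val τ (A j))) (hs : 0 < s)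
    (hP : ∀ p, a + p * s + (s - 1) < e → ∃ q < N, P q = A (a + p * s + (s - 1))) (r b : ℕ) :
    ((Finset.Ico a e).filter fun j => st j = r ∧ j / B = b).card ≤ s := by
  set J := (Finset.Ico a e).filter fun j => st j = r ∧ j / B = b with hJ
  rcases J.eq_empty_or_nonempty with h0 | hne
  · rw [h0]; simp
  set i := J.min' hne
  have hi : i ∈ J := J.min'_mem hne
  rw [hJ, Finset.mem_filter, Finset.mem_Ico] at hi
  have hsub : J ⊆ Finset.Ico i (i + s) := by
    intro j hj
    have hij : i ≤ j := J.min'_le j hj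
    rw [hJ, Finset.mem_filter, Finset.mem_Ico] at hj
    refine Finset.mem_Ico.2 ⟨hij, ?_⟩
    by_contra hlt
    rw [not_lt] at hlt
    -- The first sampled index from `i` on. If the cell extended to `i + s`, this index would lie
    -- before `j`, and its pivot would separate `j` from `i`.
    set k := a + (i - a) / s * s + (s - 1) with hk
    have h1 := Nat.div_mul_le_self (i - a) s
    have h2 := Nat.lt_div_mul_add (a := i - a) hs
    have hik : i ≤ k := by omega
    have hkj : k < j := by omega
    obtain ⟨q, hq, hPq⟩ := hP ((i - a) / s) (by omega)
    rw [← hk] at hPq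
    have hkB : k / B = j / B := div_between hik hkj.le (hi.2.2.trans hj.2.2.symm)
    have hlt' : val τ (A k) < val τ (A j) := by
      refine lt_of_le_of_ne (h.asc k j (by omega) hkj.le hj.1.2 hkB) fun heq => ?_
      have := h.inj k j (by omega) (by omega) (by omega) (by omega) (val_injective τ heq)
      omega
    have h3 := strip_lt_strip (τ := τ) (P := P) (y := val τ (A k)) (z := val τ (A j)) hq (by rw [hPq])
      (by rw [hPq]; exact hlt')
    have h4 := strip_mono (τ := τ) P N
      (h.asc i k (by omega) hik (by omega) (hi.2.2.trans (hkB.trans hj.2.2).symm))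
    rw [← hst, ← hst] at h3
    rw [← hst, ← hst] at h4
    omega
  simpa using Finset.card_le_card hsub

theorem BlockSorted.card_strip_le (h : BlockSorted τ A a e B) {st : ℕ → ℕ}
    (hst : ∀ j, st j = strip τ P N (val τ (A j))) (hs : 0 < s)
    (hP : ∀ p, a + p * s + (s - 1) < e → ∃ q < N, P q = A (a + p * s + (s - 1))) (r : ℕ) :
    ((Finset.Ico a e).filter fun j => st j = r).card ≤ s * (stripBlocks st a e B r).card := by
  refine Finset.card_le_mul_card_image _ _ fun b _ => ?_
  rw [Finset.filter_filter]
  exact h.card_cell_le hst hs hP r b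

/-- Within a strip, the stable sort has at most one descent per block. -/
theorem BlockSorted.desc_le (h : BlockSorted τ A a e B) {st T : ℕ → ℕ}
    (hT : ∀ j, a ≤ j → j < e → T (posn st a e j) = A j) (hae : a ≤ e) (r : ℕ) :
    desc τ T (bound st a e r) (bound st a e (r + 1)) ≤ (stripBlocks st a e B r).card := by
  have hb1 := le_bound (st := st) (a := a) (e := e) (r := r)
  have hb2 := bound_le (st := st) (r := r + 1) hae
  have : ∀ p, ∃ j, bound st a e r ≤ p → p < bound st a e (r + 1) →
      a ≤ j ∧ j < e ∧ posn st a e j = p ∧ st j = r := by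
    intro p
    by_cases hp : bound st a e r ≤ p ∧ p < bound st a e (r + 1)
    · obtain ⟨j, h1, h2, h3⟩ := exists_posn_eq (st := st) (a := a) (e := e) (p := p)
        (by omega) (by omega)
      exact ⟨j, fun _ _ => ⟨h1, h2, h3, (st_eq_iff h1 h2).2 (h3 ▸ hp)⟩⟩
    · exact ⟨0, fun h1 h2 => absurd ⟨h1, h2⟩ hp⟩
  choose f hf using this
  refine Finset.card_le_card_of_injOn (fun p => f p / B) ?_ ?_
  · intro p hp
    rw [Finset.mem_coe, Finset.mem_filter, Finset.mem_Ico] at hp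
    obtain ⟨h1, h2, h3, h4⟩ := hf p (by omega) (by omega)
    exact Finset.mem_coe.2 (Finset.mem_image.2
      ⟨f p, Finset.mem_filter.2 ⟨Finset.mem_Ico.2 ⟨h1, h2⟩, h4⟩, rfl⟩)
  -- If two descents `p < q` of the strip came from one block, then the entry before `q` would come
  -- from that block too, because the stable sort keeps the order of indices inside a strip. But
  -- then `q` is no descent.
  · have key : ∀ p q, bound st a e r ≤ p → p < q → q < bound st a e (r + 1) →
        val τ (T q) < val τ (T (q - 1)) → f p / B ≠ f q / B := by
      intro p q hp hpq hq hd hB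
      obtain ⟨h1, h2, h3, h4⟩ := hf p hp (by omega)
      obtain ⟨g1, g2, g3, g4⟩ := hf (q - 1) (by omega) (by omega)
      obtain ⟨k1, k2, k3, k4⟩ := hf q (by omega) hq
      have hle : f p ≤ f (q - 1) := by
        by_contra hlt
        have := posn_lt_posn (st := st) g1 g2 (Or.inr ⟨g4.trans h4.symm, not_le.1 hlt⟩)
        omega
      have hle' : f (q - 1) ≤ f q := by
        by_contra hlt
        have := posn_lt_posn (st := st) k1 k2 (Or.inr ⟨k4.trans g4.symm, not_le.1 hlt⟩)
        omega
      have := h.asc _ _ g1 hle' k2 (div_between hle hle' hB)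
      rw [← hT _ g1 g2, ← hT _ k1 k2, g3, k3] at this
      omega
    intro p hp q hq hpq
    simp only [Finset.coe_filter, Set.mem_ofPred_eq, Finset.mem_Ico] at hp hq
    rcases lt_trichotomy p q with hlt | heq | hlt
    · exact absurd hpq (key p q (by omega) hlt hq.1.2 hq.2)
    · exact heq
    · exact absurd hpq.symm (key q p (by omega) hlt hp.1.2 hp.2)

theorem card_cells_eq_sum (st : ℕ → ℕ) (R : Finset ℕ) :
    (((Finset.Ico a e).filter fun j => st j ∈ R).image fun j => (j / B, st j)).card =
      ∑ r ∈ R, (stripBlocks st a e B r).card := by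
  have : (((Finset.Ico a e).filter fun j => st j ∈ R).image fun j => (j / B, st j)) =
      R.biUnion fun r => (stripBlocks st a e B r).image fun b => (b, r) := by
    ext ⟨b, r⟩
    simp only [Finset.mem_image, Finset.mem_filter, Finset.mem_biUnion, stripBlocks, Prod.mk.injEq]
    constructor
    · rintro ⟨j, ⟨hj, hr⟩, rfl, rfl⟩
      exact ⟨_, hr, _, ⟨j, ⟨hj, rfl⟩, rfl⟩, rfl, rfl⟩
    · rintro ⟨r', hr', b', ⟨j, ⟨hj, rfl⟩, rfl⟩, rfl, rfl⟩
      exact ⟨j, ⟨hj, hr'⟩, rfl, rfl⟩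
  rw [this, Finset.card_biUnion]
  · refine Finset.sum_congr rfl fun r _ => Finset.card_image_of_injective _ fun b b' h => ?_
    exact (Prod.mk.inj h).1
  · intro r _ r' _ hne
    refine Finset.disjoint_left.2 fun x hx hx' => ?_
    obtain ⟨b, _, rfl⟩ := Finset.mem_image.1 hx
    obtain ⟨b', _, h⟩ := Finset.mem_image.1 hx'
    exact hne (Prod.mk.inj h).2.symm

/-- The strips in `R` have few nonempty cells. -/
theorem BlockSorted.sum_card_stripBlocks_le (h : BlockSorted τ A a e B) {st : ℕ → ℕ}
    (hst : ∀ j, st j = strip τ P N (val τ (A j))) (hB : 0 < B) (hBa : B ∣ a) (R : Finset ℕ) :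
    ∑ r ∈ R, (stripBlocks st a e B r).card ≤
      6 * (twinWidth τ + 1) * (((e - a) / B + 1) + R.card) := by
  set J := (Finset.Ico a e).filter fun j => st j ∈ R with hJ
  have hJ' : ∀ j ∈ J, a ≤ j ∧ j < e ∧ st j ∈ R := by
    intro j hj
    rw [hJ, Finset.mem_filter, Finset.mem_Ico] at hj
    exact ⟨hj.1.1, hj.1.2, hj.2⟩
  have hd := card_cells_val_le τ (S := J.image A) (by
    intro x hx
    obtain ⟨j, hj, rfl⟩ := Finset.mem_image.1 hx
    obtain ⟨h1, h2, _⟩ := hJ' j hj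
    exact h.lt j h1 h2) (col := fun x => x / B) (row := strip τ P N)
    (fun _ _ h => Nat.div_le_div_right h) (strip_mono P N)
  simp only [Finset.image_image, Function.comp_def] at hd
  have h1 : (J.image fun j => (A j / B, strip τ P N (val τ (A j)))) =
      J.image fun j => (j / B, st j) :=
    Finset.image_congr fun j hj => by
      obtain ⟨h1, h2, _⟩ := hJ' j hj
      simp only [h.div_eq j h1 h2, hst]
  have h2 : (J.image fun j => A j / B).card ≤ (e - a) / B + 1 := by
    have : (J.image fun j => A j / B) ⊆ Finset.Ico (a / B) (a / B + ((e - a) / B + 1)) := by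
      intro x hx
      obtain ⟨j, hj, rfl⟩ := Finset.mem_image.1 hx
      obtain ⟨h1, h2, _⟩ := hJ' j hj
      rw [h.div_eq j h1 h2, Finset.mem_Ico]
      refine ⟨Nat.div_le_div_right h1, ?_⟩
      obtain ⟨c, rfl⟩ := hBa
      have h3 : j / B = (j - B * c) / B + c := by
        rw [← Nat.add_mul_div_left _ _ hB]; congr 1; omega
      have h4 : (j - B * c) / B ≤ (e - B * c) / B := Nat.div_le_div_right (by omega)
      rw [Nat.mul_div_cancel_left _ hB]
      omega
    simpa using Finset.card_le_card this
  have h3 : (J.image fun j => strip τ P N (val τ (A j))).card ≤ R.card := by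
    refine Finset.card_le_card fun x hx => ?_
    obtain ⟨j, hj, rfl⟩ := Finset.mem_image.1 hx
    rw [← hst]
    exact (hJ' j hj).2.2
  rw [← card_cells_eq_sum, ← hJ, ← h1]
  exact hd.trans (Nat.mul_le_mul_left _ (by omega))

end BlockSorted

end CompRAM

/-! ### The cost of sorting the strips: strips with few and with many blocks -/

namespace CompRAM

open TwinWidth (val val_injective val_of_lt twinWidth)

variable {n : ℕ} {τ : Equiv.Perm (Fin n)} {w : ℕ}

/-- The factor per element for a strip which meets at most `12 * D` blocks: even the logarithm of
that number is within `O(D)`. -/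
theorem log_mul_succ_le (D : ℕ) (hD : 0 < D) : Nat.log 2 (12 * D) + 1 ≤ 6 * D := by
  have h1 : 12 * D < 2 ^ (4 + D) := by
    have : D < 2 ^ D := Nat.lt_two_pow_self
    rw [pow_add]; omega
  have h2 := Nat.log_lt_of_lt_pow (b := 2) (by omega) h1
  omega

/-- Strips which meet at most `12 * D` blocks cost `O(D)` per element. Let `H` be the set of the
others and `k` the bound on the number of blocks. Density gives `12 * D * |H| ≤ 6 * D * (k + |H|)`,
hence `|H| ≤ k`, and so the strips of `H` have at most `12 * D * k` cells. Each cell has at most `s`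
elements and the logarithm is at most `s`, so each cell costs `O(s * s)`, and `s * s * k` is at most
`μ + s * s`. -/
theorem BlockSorted.sum_cost_le {A P st : ℕ → ℕ} {a e N s : ℕ}
    (h : BlockSorted τ A a e (s * s)) (hst : ∀ j, st j = strip τ P N (val τ (A j))) (hs : 0 < s)
    (hBa : s * s ∣ a) (hlen : e - a ≤ 2 ^ s) (hN : N ≤ e - a)
    (hP : ∀ p, a + p * s + (s - 1) < e → ∃ q < N, P q = A (a + p * s + (s - 1))) :
    ∑ r ∈ Finset.range (N + 1), (80 * ((Finset.Ico a e).filter fun j => st j = r).card + 13) *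
      (Nat.log 2 (stripBlocks st a e (s * s) r).card + 1) ≤
      3000 * (twinWidth τ + 1) * (e - a + s * s) := by
  set D := twinWidth τ + 1 with hD
  set μ := e - a with hμ
  let σ : ℕ → ℕ := fun r => ((Finset.Ico a e).filter fun j => st j = r).card
  let q : ℕ → ℕ := fun r => (stripBlocks st a e (s * s) r).card
  change ∑ r ∈ Finset.range (N + 1), (80 * σ r + 13) * (Nat.log 2 (q r) + 1) ≤ _
  have hB : 0 < s * s := Nat.mul_pos hs hs
  have hσq : ∀ r, σ r ≤ s * q r := fun r => h.card_strip_le hst hs hP r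
  have hqσ : ∀ r, q r ≤ σ r := fun r => Finset.card_image_le
  have hσμ : ∀ r, σ r ≤ μ := fun r => (Finset.card_filter_le _ _).trans (Nat.card_Ico _ _).le
  have hσsum : ∑ r ∈ Finset.range (N + 1), σ r = μ := by
    rw [hμ, ← Nat.card_Ico]
    refine (Finset.card_eq_sum_card_fiberwise fun j _ => ?_).symm
    rw [Finset.mem_coe, Finset.mem_range, hst]
    have := strip_le (τ := τ) P N (val τ (A j))
    omega
  set H := (Finset.range (N + 1)).filter fun r => 12 * D < q r with hH
  have hHsum := h.sum_card_stripBlocks_le hst hB hBa H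
  set k := μ / (s * s) + 1 with hk
  change ∑ r ∈ H, q r ≤ 6 * D * (k + H.card) at hHsum
  have hHcard : H.card ≤ k := by
    have h1 : H.card * (12 * D) ≤ ∑ r ∈ H, q r := by
      rw [← smul_eq_mul]
      exact Finset.card_nsmul_le_sum _ _ _ fun r hr => (Finset.mem_filter.1 hr).2.le
    have h2 : 6 * D * H.card ≤ 6 * D * k := by nlinarith
    exact Nat.le_of_mul_le_mul_left h2 (by omega)
  have hHsum' : ∑ r ∈ H, q r ≤ 12 * D * k := by
    refine hHsum.trans ?_
    calc 6 * D * (k + H.card) ≤ 6 * D * (k + k) := by gcongr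
      _ = _ := by ring
  have hterm : ∀ r ∈ Finset.range (N + 1), (80 * σ r + 13) * (Nat.log 2 (q r) + 1) ≤
      6 * D * (80 * σ r + 13) + (if 12 * D < q r then 186 * (s * s) * q r else 0) := by
    intro r _
    -- For a strip with many blocks, `93 = 80 + 13` absorbs the additive constant and `s + 1 ≤ 2 *
    -- s`, whence `186`.
    split_ifs with hr
    · have h1 : Nat.log 2 (q r) ≤ s := by
        have := Nat.log_mono_right (b := 2) ((hqσ r).trans ((hσμ r).trans hlen))
        rwa [Nat.log_pow (by norm_num)] at this
      have h2 : 80 * σ r + 13 ≤ 93 * (s * q r) := by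
        have := hσq r
        have : 1 ≤ s * q r := Nat.mul_pos hs (by omega)
        omega
      calc _ ≤ 93 * (s * q r) * (2 * s) := Nat.mul_le_mul h2 (by omega)
        _ = 186 * (s * s) * q r := by ring
        _ ≤ _ := Nat.le_add_left _ _
    · rw [add_zero, mul_comm (6 * D)]
      refine Nat.mul_le_mul_left _ (le_trans ?_ (log_mul_succ_le D (by omega)))
      exact Nat.add_le_add_right (Nat.log_mono_right (not_lt.1 hr)) 1
  have hkB : s * s * k ≤ μ + s * s := by
    rw [hk, mul_add, mul_one]
    exact Nat.add_le_add_right (Nat.mul_div_le _ _) _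
  calc _ ≤ ∑ r ∈ Finset.range (N + 1), (6 * D * (80 * σ r + 13) +
        (if 12 * D < q r then 186 * (s * s) * q r else 0)) := Finset.sum_le_sum hterm
    _ = 6 * D * (80 * μ + 13 * (N + 1)) + 186 * (s * s) * ∑ r ∈ H, q r := by
      rw [Finset.sum_add_distrib, ← Finset.mul_sum, Finset.sum_add_distrib, ← Finset.mul_sum,
        hσsum, Finset.sum_const, Finset.card_range, smul_eq_mul, ← Finset.sum_filter,
        ← Finset.mul_sum, mul_comm (N + 1)]
    _ ≤ 6 * D * (80 * μ + 13 * (μ + s * s)) + 186 * (s * s) * (12 * D * k) := by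
      gcongr
      exact hB
    _ = 6 * D * (80 * μ + 13 * (μ + s * s)) + 2232 * D * (s * s * k) := by ring
    _ ≤ 6 * D * (80 * μ + 13 * (μ + s * s)) + 2232 * D * (μ + s * s) := by gcongr
    _ ≤ _ := by nlinarith [Nat.zero_le (D * μ), Nat.zero_le (D * (s * s))]

/-! ### Merging the sorted blocks of a segment

The segment starts at the position in register 30 and ends at the position in register 31. Register
32 holds the distance `s` of the samples, and register 33 the length of the blocks. -/

/-- Copy every `s`-th element of the segment to array 2, and count these samples in register 35. -/
def takeSamples : Prog :=
  .const 35 0 ;; .add 36 30 32 ;; .sub 36 36 1 ;;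
  .loop (.lt 36 31) (.load 37 0 36 ;; .store 2 35 37 ;; .add 35 35 1 ;; .add 36 36 32)

theorem wp_takeSamples {m : State} {a e s : ℕ} (h1 : m.reg 1 = 1) (h30 : m.reg 30 = a)
    (h31 : m.reg 31 = e) (h32 : m.reg 32 = s) (hs : 0 < s) (hae : a ≤ e)
    (hw : e + s + 1 < 2 ^ w) :
    wp τ w takeSamples m fun t m' => t ≤ 5 * (e - a) + 4 ∧ m'.reg 35 * s ≤ e - a ∧
      e - a < m'.reg 35 * s + s ∧
      ∀ p < m'.reg 35, m'.arr 2 p = m.arr 0 (a + p * s + (s - 1)) := by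
  simp only [takeSamples, wp]
  refine ⟨by omega, by simp [h30, h32]; omega, ?_⟩
  refine wp_call (wp_while (fun m' => m'.reg 36 = a + m'.reg 35 * s + (s - 1) ∧
    m'.reg 35 * s ≤ e - a ∧ ∀ p < m'.reg 35, m'.arr 2 p = m.arr 0 (a + p * s + (s - 1)))
    (fun m' => 5 * (e - m'.reg 36)) ?_ ?_) ?_
  · simp [h30, h32, h1]; omega
  · rintro m' hf ⟨g1, g2, g3⟩ hc
    have e1 : m'.reg 1 = 1 := (hf.reg 1 (by simp)).trans (by simp [h1])
    have e31 : m'.reg 31 = e := (hf.reg 31 (by simp)).trans (by simp [h31])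
    have e32 : m'.reg 32 = s := (hf.reg 32 (by simp)).trans (by simp [h32])
    have e0 : m'.arr 0 = m.arr 0 := (hf.arr 0 (by simp)).trans (by simp)
    simp only [holds, e31] at hc
    simp [wp, e1, e32, e0]
    have hle : m'.reg 35 ≤ m'.reg 35 * s := Nat.le_mul_of_pos_right _ hs
    refine ⟨by omega, by omega, ⟨?_, ?_, ?_⟩, by omega⟩
    · rw [add_mul, one_mul]; omega
    · rw [add_mul, one_mul]; omega
    · intro p hp
      rcases hp.lt_or_eq with hp | rfl
      · rw [Function.update_of_ne (by omega)]
        exact g3 p hp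
      · rw [Function.update_self, g1]
  · rintro t m' ⟨⟨g1, g2, g3⟩, hc, ht⟩ hf
    have e31 : m'.reg 31 = e := (hf.reg 31 (by simp)).trans (by simp [h31])
    simp only [holds, e31] at hc
    simp [h30, h32, h1] at ht
    exact ⟨by omega, g2, by omega, g3⟩

/-- The strip of the element at the position in register 37 with respect to the pivots in array 2,
whose number is in register 35. -/
def findStrip : Prog :=
  .const 38 0 ;; .move 45 35 ;; .const 47 2 ;;
  .loop (.lt 38 45) (
    .add 46 38 45 ;; .div 46 46 47 ;; .load 41 2 46 ;;
    .ite (.elemLE 37 41) (.move 45 46) (.add 38 46 1))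

/-- Doubling the argument lets the last step of a binary search, from one candidate to none, lower
the logarithm as well. -/
theorem log_two_mul_succ_le {k k' : ℕ} (hk : 0 < k) (hk' : k' ≤ k / 2) :
    Nat.log 2 (2 * k') + 1 ≤ Nat.log 2 (2 * k) := by
  rw [mul_comm 2 k, Nat.log_mul_base (by norm_num) (by omega)]
  exact Nat.add_le_add_right (Nat.log_mono_right (by omega)) 1

theorem wp_findStrip {m : State} {N x : ℕ} {P : ℕ → ℕ} (h1 : m.reg 1 = 1) (h35 : m.reg 35 = N)
    (h37 : m.reg 37 = x) (hx : x < n) (hP2 : m.arr 2 = P) (hP : ∀ p < N, P p < n)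
    (hasc : Asc τ P 0 N) (hw : 2 * N + 2 < 2 ^ w) :
    wp τ w findStrip m fun t m' => t ≤ 7 * Nat.log 2 (2 * N) + 4 ∧
      m'.reg 38 = strip τ P N (val τ x) := by
  have hw0 : w ≠ 0 := by rintro rfl; simp at hw
  simp only [findStrip, wp]
  refine ⟨by omega, by omega, ?_⟩
  refine wp_call (wp_while (fun m' => m'.reg 38 ≤ m'.reg 45 ∧ m'.reg 45 ≤ N ∧
    (∀ p < m'.reg 38, val τ (P p) < val τ x) ∧
    (∀ p, m'.reg 45 ≤ p → p < N → val τ x ≤ val τ (P p)))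
    (fun m' => 7 * Nat.log 2 (2 * (m'.reg 45 - m'.reg 38))) ?_ ?_) ?_
  · simp [h35]; omega
  · rintro m' hf ⟨g1, g2, g3, g4⟩ hc
    have e1 : m'.reg 1 = 1 := (hf.reg 1 (by simp)).trans (by simp [h1])
    have e37 : m'.reg 37 = x := (hf.reg 37 (by simp)).trans (by simp [h37])
    have e47 : m'.reg 47 = 2 := (hf.reg 47 (by simp)).trans (by simp)
    have e2 : m'.arr 2 = P := (hf.arr 2 (by simp)).trans (by simp [hP2])
    simp only [holds] at hc
    simp [wp, e1, e37, e47, e2]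
    generalize m'.reg 38 = l at *
    generalize m'.reg 45 = u at *
    have hmid1 : l ≤ (l + u) / 2 := by omega
    have hmid2 : (l + u) / 2 < u := by omega
    have hlog1 := log_two_mul_succ_le (k := u - l) (k' := (l + u) / 2 - l) (by omega) (by omega)
    have hlog2 := log_two_mul_succ_le (k := u - l) (k' := u - ((l + u) / 2 + 1)) (by omega)
      (by omega)
    refine ⟨by omega, fun _ _ hv => ⟨⟨hmid1, by omega, g3, ?_⟩, by omega⟩,
      fun hv => ⟨by omega, ⟨by omega, g2, ?_, g4⟩, by omega⟩⟩
    · intro p hp hpN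
      exact hv.trans (hasc _ p (Nat.zero_le _) hp hpN)
    · intro p hp
      exact (hasc p _ (Nat.zero_le _) hp (by omega)).trans_lt (hv hx (hP _ (by omega)))
  · rintro t m' ⟨⟨g1, g2, g3, g4⟩, hc, ht⟩ hf
    simp only [holds] at hc
    simp [h35] at ht
    have heq : m'.reg 38 = m'.reg 45 := by omega
    exact ⟨by omega, (strip_eq_of_forall (by omega) g3 (by rw [heq]; exact g4)).symm⟩

/-- Load the element at the position in register 36 to register 37, and clear register 39 if the
element clearly is in the strip in register 38. -/
def cellFlag : Prog :=
  .load 37 0 36 ;; .const 39 1 ;; .div 40 36 33 ;; .mul 40 40 33 ;;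
  .ite (.eq 40 36) .skip
    (.ite (.lt 38 35) (.load 41 2 38 ;; .ite (.elemLE 37 41) (.const 39 0) .skip)
      (.const 39 0))

/-- Inside a block the strips only increase. So an element stays in the strip of its predecessor
unless it exceeds the pivot that closes this strip, and the last strip has no such pivot. One
comparison therefore decides whether a search is needed, and a block start always triggers one. -/
theorem wp_cellFlag {m : State} {a e B N i : ℕ} {A P st : ℕ → ℕ} (h33 : m.reg 33 = B)
    (h35 : m.reg 35 = N) (h36 : m.reg 36 = i) (hA : m.arr 0 = A) (hP2 : m.arr 2 = P) (hB : 0 < B)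
    (hBa : B ∣ a) (hai : a ≤ i) (hie : i < e) (hw : e < 2 ^ w) (hw1 : 1 < 2 ^ w)
    (h : BlockSorted τ A a e B)
    (hP : ∀ p < N, P p < n) (hasc : Asc τ P 0 N) (hst : ∀ j, st j = strip τ P N (val τ (A j)))
    (hcur : a < i → m.reg 38 = st (i - 1)) :
    wp τ w cellFlag m fun t m' => t ≤ 9 ∧ m'.reg 37 = A i ∧
      (m'.reg 39 = 1 ∧ StartsCell st B i ∨ m'.reg 39 = 0 ∧ m.reg 38 = st i) := by
  have hw0 : w ≠ 0 := by rintro rfl; simp at hw1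
  have hstN : ∀ j, st j ≤ N := fun j => hst j ▸ strip_le _ _ _
  have hmul : i / B * B ≤ i := Nat.div_mul_le_self i B
  have hdm := Nat.div_add_mod i B
  rw [mul_comm] at hdm
  have hAi := h.lt i hai hie
  simp [cellFlag, wp, h33, h35, h36, hA, hP2, hw0]
  refine ⟨by omega, fun h0 => Or.inl (by omega), fun h0 => ?_⟩
  have hai' : a < i := by
    refine lt_of_le_of_ne hai fun hai => h0 ?_
    rw [← hai]; exact Nat.div_mul_cancel hBa
  have hcur := hcur hai'
  have hdiv : (i - 1) / B = i / B := by
    refine le_antisymm (Nat.div_le_div_right (Nat.sub_le _ _)) ?_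
    rw [Nat.le_div_iff_mul_le hB]
    omega
  have hle := h.asc (i - 1) i (by omega) (by omega) hie hdiv
  have hst' : st (i - 1) ≤ st i := by
    rw [hst, hst]; exact strip_mono P N hle
  refine ⟨fun hlt => ⟨fun _ _ hv => ?_, fun hv => Or.inr ?_⟩, fun hge => ?_⟩
  · refine le_antisymm (hcur ▸ hst') ?_
    by_contra hlt'
    rw [hst i] at hlt'
    exact absurd hv (not_le.2 (lt_strip hasc (not_le.1 hlt')))
  · rw [← hcur]
    intro heq
    have h1 := strip_lt_strip (τ := τ) (P := P) (N := N) (y := val τ (A (i - 1)))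
      (z := val τ (A i)) hlt ?_ (hv hAi (hP _ hlt))
    · rw [← hst, ← hst, ← hcur] at h1
      omega
    · exact le_of_strip_le hasc (by rw [← hst, hcur]) hlt
  · have := hstN i
    omega

/-- Put the strips of the elements of the segment into array 3, and the sizes of the strips into
array 4. -/
def assignStrips : Prog :=
  .add 43 35 1 ;; .const 36 0 ;; .loop (.lt 36 43) (.store 4 36 2 ;; .add 36 36 1) ;;
  .move 36 30 ;;
  .loop (.lt 36 31) (
    (cellFlag ;; .ite (.eq 39 1) findStrip .skip ;;
      .store 3 36 38 ;; .load 41 4 38 ;; .add 41 41 1 ;; .store 4 38 41) ;;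
    .add 36 36 1)

/-- The state of `assignStrips` at position `i`. -/
structure AssignInv (st : ℕ → ℕ) (a N i : ℕ) (F G : ℕ → ℕ) (c : ℕ) : Prop where
  strips : ∀ j, a ≤ j → j < i → F j = st j
  counts : ∀ r ≤ N, G r = ((Finset.Ico a i).filter fun j => st j = r).card
  cur : a < i → c = st (i - 1)

theorem AssignInv.step {st : ℕ → ℕ} {a N i c : ℕ} {F G : ℕ → ℕ} (h : AssignInv st a N i F G c)
    (hi : a ≤ i) : AssignInv st a N (i + 1) (Function.update F i (st i))
      (Function.update G (st i) (G (st i) + 1)) (st i) := by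
  refine ⟨fun j hj hji => ?_, fun r hr => ?_, fun _ => rfl⟩
  · rcases Nat.lt_succ_iff_lt_or_eq.1 hji with hji | rfl
    · rw [Function.update_of_ne (by omega)]; exact h.strips j hj hji
    · rw [Function.update_self]
  · rw [← Finset.insert_Ico_right_eq_Ico_add_one hi, Finset.filter_insert]
    by_cases hir : st i = r
    · subst hir
      rw [Function.update_self, if_pos rfl, Finset.card_insert_of_notMem (by simp), h.counts _ hr]
    · rw [Function.update_of_ne (Ne.symm hir), if_neg hir, h.counts _ hr]

/-- A binary search is made only where a new cell begins; every other element costs a constant. The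
number of cells, not of elements, is therefore multiplied by the logarithm. -/
theorem wp_assignStrips {m : State} {a e B N : ℕ} {A P st : ℕ → ℕ} (h1 : m.reg 1 = 1)
    (h2 : m.reg 2 = 0) (h30 : m.reg 30 = a) (h31 : m.reg 31 = e) (h33 : m.reg 33 = B)
    (h35 : m.reg 35 = N) (hA : m.arr 0 = A) (hP2 : m.arr 2 = P) (hB : 0 < B) (hBa : B ∣ a)
    (hae : a ≤ e) (hN : N ≤ e) (hw : 2 * e + 3 < 2 ^ w) (h : BlockSorted τ A a e B)
    (hP : ∀ p < N, P p < n) (hasc : Asc τ P 0 N)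
    (hst : ∀ j, st j = strip τ P N (val τ (A j))) :
    wp τ w assignStrips m fun t m' =>
      t ≤ 4 * N + 25 * (e - a) + 8 +
        ((Finset.Ico a e).filter fun j => StartsCell st B j).card * (7 * Nat.log 2 (2 * N) + 4) ∧
      m'.reg 43 = N + 1 ∧ (∀ j, a ≤ j → j < e → m'.arr 3 j = st j) ∧
      ∀ r ≤ N, m'.arr 4 r = ((Finset.Ico a e).filter fun j => st j = r).card := by
  have hw0 : w ≠ 0 := by rintro rfl; simp at hw
  have hstN : ∀ j, st j ≤ N := fun j => hst j ▸ strip_le _ _ _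
  simp only [assignStrips, wp]
  refine ⟨by omega, by omega, ?_⟩
  refine wp_call (wp_for (i := 36) (e := 43) (N + 1) (fun k m' => ∀ r < k, m'.arr 4 r = 0)
    (fun _ => 1) (by decide) (by decide) (by simp) (by simp) (by simp) (by simp [h1])
    (by simp [h1, h35]) (by simp) (by omega) (by simp) ?_) ?_
  · rintro k m' hf _ hk h36 hI
    have e2 : m'.reg 2 = 0 := (hf.reg 2 (by simp)).trans (by simp [h2])
    simp [wp, h36, e2]
    intro r hr
    rcases hr.eq_or_lt with rfl | hr
    · rw [Function.update_self]
    · rw [Function.update_of_ne (by omega)]; exact hI r hr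
  rintro t₁ m₁ ⟨ht₁, -, hz⟩ f₁
  simp at ht₁
  have e1 : m₁.reg 1 = 1 := (f₁.reg 1 (by simp)).trans (by simp [h1])
  have e30 : m₁.reg 30 = a := (f₁.reg 30 (by simp)).trans (by simp [h30])
  have e31 : m₁.reg 31 = e := (f₁.reg 31 (by simp)).trans (by simp [h31])
  have e33 : m₁.reg 33 = B := (f₁.reg 33 (by simp)).trans (by simp [h33])
  have e35 : m₁.reg 35 = N := (f₁.reg 35 (by simp)).trans (by simp [h35])
  have e43 : m₁.reg 43 = N + 1 := (f₁.reg 43 (by simp)).trans (by simp [h35, h1])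
  have eA : m₁.arr 0 = A := (f₁.arr 0 (by simp)).trans (by simp [hA])
  have eP : m₁.arr 2 = P := (f₁.arr 2 (by simp)).trans (by simp [hP2])
  refine wp_call (wp_for (i := 36) (e := 31) e (fun i m' => AssignInv st a N i (m'.arr 3)
    (m'.arr 4) (m'.reg 38)) (fun i => 18 + if StartsCell st B i then 7 * Nat.log 2 (2 * N) + 4 else 0)
    (by decide) (by decide) (by simp [findStrip, cellFlag])
    (by simp [findStrip, cellFlag]) (by simp [findStrip, cellFlag]) (by simp [e1]) (by simp [e31]) (by simp [e30, hae]) (by omega) ?_ ?_) ?_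
  · simp [e30]
    exact ⟨fun j hj hja => by omega, fun r hr => by simp [hz r (by omega)], fun h => by omega⟩
  · intro i m' hf hi hie h36 hI
    simp [e30] at hi
    have e1' : m'.reg 1 = 1 := (hf.reg 1 (by simp [findStrip, cellFlag])).trans (by simp [e1])
    have e33' : m'.reg 33 = B := (hf.reg 33 (by simp [findStrip, cellFlag])).trans (by simp [e33])
    have e35' : m'.reg 35 = N := (hf.reg 35 (by simp [findStrip, cellFlag])).trans (by simp [e35])
    have eA' : m'.arr 0 = A := (hf.arr 0 (by simp [findStrip, cellFlag])).trans (by simp [eA])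
    have eP' : m'.arr 2 = P := (hf.arr 2 (by simp [findStrip, cellFlag])).trans (by simp [eP])
    have hAi := h.lt i hi hie
    have hGle : m'.arr 4 (st i) ≤ e := by
      rw [hI.counts _ (hstN i)]
      exact (Finset.card_filter_le _ _).trans (by rw [Nat.card_Ico]; omega)
    have hmul : i / B * B ≤ i := Nat.div_mul_le_self i B
    simp only [wp]
    refine wp_call (wp_cellFlag e33' e35' h36 eA' eP' hB hBa hi hie (by omega) (by omega) h hP hasc
      hst hI.cur) ?_
    rintro t₂ m₂ ⟨ht₂, g37, g39⟩ f₂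
    have e1₂ : m₂.reg 1 = 1 := (f₂.reg 1 (by simp [cellFlag])).trans e1'
    have e35₂ : m₂.reg 35 = N := (f₂.reg 35 (by simp [cellFlag])).trans e35'
    have e36₂ : m₂.reg 36 = i := (f₂.reg 36 (by simp [cellFlag])).trans h36
    have e38₂ : m₂.reg 38 = m'.reg 38 := f₂.reg 38 (by simp [cellFlag])
    have e₂ : m₂.arr = m'.arr := funext fun A => f₂.arr A (by simp [cellFlag])
    have hstep := hI.step hi
    refine ⟨fun hc => ?_, fun hc => ?_⟩
    · simp only [holds, e1₂] at hc
      have hcell : StartsCell st B i := by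
        rcases g39 with g | g
        · exact g.2
        · omega
      refine wp_call (wp_findStrip e1₂ e35₂ g37 hAi (by rw [e₂, eP']) hP hasc (by omega)) ?_
      rintro t₃ m₃ ⟨ht₃, g38⟩ f₃
      rw [← hst] at g38
      have e1₃ : m₃.reg 1 = 1 := (f₃.reg 1 (by simp [findStrip])).trans e1₂
      have e36₃ : m₃.reg 36 = i := (f₃.reg 36 (by simp [findStrip])).trans e36₂
      have e₃ : m₃.arr = m'.arr := (funext fun A => f₃.arr A (by simp [findStrip])).trans e₂
      simp [e1₃, e36₃, e₃, g38, hcell, hstep]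
      omega
    · simp only [holds, e1₂] at hc
      have g38 : m₂.reg 38 = st i := by
        rcases g39 with g | g
        · omega
        · rw [e38₂, g.2]
      simp [e1₂, e36₂, e₂, g38, hstep]
      omega
  · rintro t₂ m₂ ⟨ht₂, -, hI⟩ f₂
    have e43' : m₂.reg 43 = N + 1 := (f₂.reg 43 (by simp [findStrip, cellFlag])).trans (by simp [e43])
    refine ⟨?_, e43', hI.strips, hI.counts⟩
    simp [e30, Finset.sum_add_distrib, ← Finset.sum_filter] at ht₂
    omega

end CompRAM

/-! ### Counting sort by strips, and sorting inside the strips -/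

namespace CompRAM

open TwinWidth (val val_injective val_of_lt twinWidth)

variable {n : ℕ} {τ : Equiv.Perm (Fin n)} {w : ℕ}

/-- Replace the sizes of the strips in array 4 by their start positions. -/
def prefixSums : Prog :=
  .move 42 30 ;; .const 36 0 ;;
  .loop (.lt 36 43) ((.load 41 4 36 ;; .store 4 36 42 ;; .add 42 42 41) ;; .add 36 36 1)

theorem wp_prefixSums {m : State} {a e N : ℕ} {st : ℕ → ℕ} (h1 : m.reg 1 = 1)
    (h30 : m.reg 30 = a) (h43 : m.reg 43 = N + 1) (hae : a ≤ e) (hN : N ≤ e)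
    (hw : 2 * e + 3 < 2 ^ w)
    (h4 : ∀ r ≤ N, m.arr 4 r = ((Finset.Ico a e).filter fun j => st j = r).card) :
    wp τ w prefixSums m fun t m' => t ≤ 5 * N + 8 ∧ ∀ r ≤ N, m'.arr 4 r = bound st a e r := by
  simp only [prefixSums, wp]
  refine ⟨by omega, ?_⟩
  refine wp_call (wp_for (i := 36) (e := 43) (N + 1) (fun k m' => m'.reg 42 = bound st a e k ∧
    (∀ r < k, m'.arr 4 r = bound st a e r) ∧ ∀ r, k ≤ r → m'.arr 4 r = m.arr 4 r)
    (fun _ => 3) (by decide) (by decide) (by simp) (by simp) (by simp) (by simp [h1])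
    (by simp [h43]) (by simp) (by omega) ?_ ?_) ?_
  · simp [h30, bound_zero]
  · rintro k m' hf _ hk h36 ⟨g1, g2, g3⟩
    have e4 : m'.arr 4 k = ((Finset.Ico a e).filter fun j => st j = k).card :=
      (g3 k le_rfl).trans (h4 k (by omega))
    have hb := bound_le (st := st) (r := k + 1) hae
    have hbs := bound_succ (st := st) (a := a) (e := e) (r := k)
    simp [wp, h36, g1, e4, ← hbs]
    refine ⟨by omega, ?_, ?_⟩
    · intro r hr
      rcases hr.lt_or_eq with hr | rfl
      · rw [Function.update_of_ne (by omega)]; exact g2 r hr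
      · rw [Function.update_self]
    · intro r hr
      rw [Function.update_of_ne (by omega)]; exact g3 r (by omega)
  · rintro t m' ⟨ht, -, -, g2, -⟩ hf
    simp at ht
    exact ⟨by omega, fun r hr => g2 r (by omega)⟩

/-- Move the elements of the segment to array 1, in the order of their strips, and back. -/
def moveToStrips : Prog :=
  .move 36 30 ;;
  .loop (.lt 36 31) ((.load 38 3 36 ;; .load 41 4 38 ;; .load 37 0 36 ;; .store 1 41 37 ;;
    .add 41 41 1 ;; .store 4 38 41) ;; .add 36 36 1) ;;
  .move 36 30 ;;
  .loop (.lt 36 31) ((.load 37 1 36 ;; .store 0 36 37) ;; .add 36 36 1)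

/-- The cell of array 4 that belongs to a strip is its next free position. When all elements have
been moved it has advanced from the start of the strip to its end, which is the form that
`sortStrips` needs. -/
theorem wp_moveToStrips {m : State} {a e N : ℕ} {st A : ℕ → ℕ} (h1 : m.reg 1 = 1)
    (h30 : m.reg 30 = a) (h31 : m.reg 31 = e) (hA : m.arr 0 = A) (hae : a ≤ e)
    (hw : 2 * e + 3 < 2 ^ w) (hst : ∀ j, st j ≤ N)
    (h3 : ∀ j, a ≤ j → j < e → m.arr 3 j = st j) (h4 : ∀ r ≤ N, m.arr 4 r = bound st a e r) :
    wp τ w moveToStrips m fun t m' => t ≤ 12 * (e - a) + 4 ∧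
      (∀ r ≤ N, m'.arr 4 r = bound st a e (r + 1)) ∧
      (∀ j, a ≤ j → j < e → m'.arr 0 (posn st a e j) = A j) ∧
      ∀ p, p < a ∨ e ≤ p → m'.arr 0 p = A p := by
  simp only [moveToStrips, wp]
  refine wp_call (wp_for (i := 36) (e := 31) e (fun i m' =>
    (∀ r ≤ N, m'.arr 4 r = bound st a e r + ((Finset.Ico a i).filter fun j => st j = r).card) ∧
    ∀ j, a ≤ j → j < i → m'.arr 1 (posn st a e j) = A j)
    (fun _ => 6) (by decide) (by decide) (by simp) (by simp) (by simp) (by simp [h1])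
    (by simp [h31]) (by simp [h30, hae]) (by omega) ?_ ?_) ?_
  · simp [h30]
    exact ⟨h4, fun j hj hja => by omega⟩
  · rintro i m' hf hi hie h36 ⟨g1, g2⟩
    simp [h30] at hi
    have e1 : m'.reg 1 = 1 := (hf.reg 1 (by simp)).trans (by simp [h1])
    have e3 : m'.arr 3 i = st i := by rw [hf.arr 3 (by simp)]; simp [h3 i hi hie]
    have eA : m'.arr 0 = A := (hf.arr 0 (by simp)).trans (by simp [hA])
    have e4 : m'.arr 4 (st i) = posn st a e i := (g1 _ (hst i)).trans (posn_eq hie.le).symm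
    have hlt := posn_lt_bound (st := st) hi hie
    have hb := bound_le (st := st) (r := st i + 1) hae
    simp [wp, e1, h36, e3, eA, e4]
    refine ⟨by omega, ?_, ?_⟩
    · intro r hr
      rw [← Finset.insert_Ico_right_eq_Ico_add_one hi, Finset.filter_insert]
      by_cases hir : st i = r
      · subst hir
        rw [Function.update_self, if_pos rfl, Finset.card_insert_of_notMem (by simp),
          posn_eq hie.le, add_assoc]
      · rw [Function.update_of_ne (Ne.symm hir), if_neg hir, g1 r hr]
    · intro j hj hji
      rcases hji.lt_or_eq with hji | rfl
      · rw [Function.update_of_ne]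
        · exact g2 j hj hji
        · intro heq
          have := posn_injOn (Finset.mem_coe.2 (Finset.mem_Ico.2 ⟨hj, by omega⟩))
            (Finset.mem_coe.2 (Finset.mem_Ico.2 ⟨hi, hie⟩)) heq
          omega
      · rw [Function.update_self]
  rintro t₁ m₁ ⟨ht₁, -, g1, g2⟩ f₁
  simp [h30] at ht₁
  have e1 : m₁.reg 1 = 1 := (f₁.reg 1 (by simp)).trans (by simp [h1])
  have e30 : m₁.reg 30 = a := (f₁.reg 30 (by simp)).trans (by simp [h30])
  have e31 : m₁.reg 31 = e := (f₁.reg 31 (by simp)).trans (by simp [h31])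
  have eA : m₁.arr 0 = A := (f₁.arr 0 (by simp)).trans (by simp [hA])
  refine wp_call (wp_for (i := 36) (e := 31) e (fun i m' =>
    (∀ p, a ≤ p → p < i → m'.arr 0 p = m₁.arr 1 p) ∧ ∀ p, p < a ∨ e ≤ p → m'.arr 0 p = A p)
    (fun _ => 2) (by decide) (by decide) (by simp) (by simp) (by simp) (by simp [e1])
    (by simp [e31]) (by simp [e30, hae]) (by omega) ?_ ?_) ?_
  · simp [e30, eA]
    intro p hp hp'; omega
  · rintro i m' hf hi hie h36 ⟨k1, k2⟩
    simp [e30] at hi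
    have e1' : m'.arr 1 = m₁.arr 1 := (hf.arr 1 (by simp)).trans (by simp)
    simp [wp, h36, e1']
    refine ⟨?_, ?_⟩
    · intro p hp hpi
      rcases hpi.lt_or_eq with hpi | rfl
      · rw [Function.update_of_ne (by omega)]; exact k1 p hp hpi
      · rw [Function.update_self]
    · intro p hp
      rw [Function.update_of_ne (by omega)]; exact k2 p hp
  · rintro t₂ m₂ ⟨ht₂, -, k1, k2⟩ f₂
    have e4 : m₂.arr 4 = m₁.arr 4 := (f₂.arr 4 (by simp)).trans (by simp)
    simp [e30] at ht₂
    refine ⟨by omega, fun r hr => ?_, fun j hj hje => ?_, k2⟩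
    · rw [e4, g1 r hr, bound_succ]
    · have h1 := bound_le_posn (st := st) (a := a) hje.le
      have h2 := posn_lt_bound (st := st) hj hje
      have h3 := bound_le (st := st) (r := st j + 1) hae
      have h4 := le_bound (st := st) (a := a) (e := e) (r := st j)
      rw [k1 _ (by omega) (by omega), g2 j hj hje]

/-- Sort each strip. -/
def sortStrips : Prog :=
  .move 10 30 ;; .const 36 0 ;;
  .loop (.lt 36 43) ((.load 11 4 36 ;; mergeSort 0 ;; .move 10 11) ;; .add 36 36 1)

/-- Sorting inside the strips suffices, because `strip` is monotone in the value: an inversion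
between two strips would place a larger element into an earlier strip. The sizes of the strips are
those of the intervals between consecutive values of `bound`. -/
theorem wp_sortStrips {m : State} {a e N : ℕ} {st A P : ℕ → ℕ} (h1 : m.reg 1 = 1)
    (h30 : m.reg 30 = a) (h43 : m.reg 43 = N + 1) (hae : a ≤ e) (hN : N ≤ e)
    (hw : 2 * e + 3 < 2 ^ w) (hA : ∀ j, a ≤ j → j < e → A j < n)
    (hst : ∀ j, st j = strip τ P N (val τ (A j)))
    (h4 : ∀ r ≤ N, m.arr 4 r = bound st a e (r + 1))
    (h0 : ∀ j, a ≤ j → j < e → m.arr 0 (posn st a e j) = A j) :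
    wp τ w sortStrips m fun t m' =>
      t ≤ (∑ r ∈ Finset.range (N + 1),
        (80 * ((Finset.Ico a e).filter fun j => st j = r).card + 13) *
          (Nat.log 2 (desc τ (m.arr 0) (bound st a e r) (bound st a e (r + 1))) + 1)) +
            4 * N + 8 ∧
      seg (m'.arr 0) a e = seg A a e ∧ Asc τ (m'.arr 0) a e ∧
      ∀ p, p < a ∨ e ≤ p → m'.arr 0 p = m.arr 0 p := by
  have hT : ∀ p, a ≤ p → p < e → ∃ j, a ≤ j ∧ j < e ∧ posn st a e j = p ∧ m.arr 0 p = A j := by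
    intro p hp hpe
    obtain ⟨j, hj, hje, rfl⟩ := exists_posn_eq (st := st) hp hpe
    exact ⟨j, hj, hje, rfl, h0 j hj hje⟩
  have hend : bound st a e (N + 1) = e :=
    bound_eq_of_forall hae fun j _ _ => by
      rw [hst]; exact Nat.lt_succ_of_le (strip_le P N _)
  -- elements before the start of strip `r` are in earlier strips
  have hstrip_lt : ∀ (r : ℕ) (f : ℕ → ℕ) p, a ≤ p → p < bound st a e r →
      seg f a (bound st a e r) = seg (m.arr 0) a (bound st a e r) →
      strip τ P N (val τ (f p)) < r := by
    intro r f p hp hpr hseg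
    have : f p ∈ seg (m.arr 0) a (bound st a e r) := hseg ▸ mem_seg.2 ⟨p, hp, hpr, rfl⟩
    obtain ⟨q, hq, hqr, hqp⟩ := mem_seg.1 this
    obtain ⟨j, hj, hje, hjq, hAj⟩ := hT q hq (by have := bound_le (st := st) (r := r) hae; omega)
    rw [← hqp, hAj, ← hst]
    by_contra hle
    have h1 := bound_mono (st := st) (a := a) (e := e) (not_lt.1 hle)
    have h2 := bound_le_posn (st := st) (a := a) hje.le
    omega
  have hstrip_le : ∀ (r : ℕ) (f : ℕ → ℕ) p, bound st a e r ≤ p → p < bound st a e (r + 1) →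
      seg f (bound st a e r) (bound st a e (r + 1)) =
        seg (m.arr 0) (bound st a e r) (bound st a e (r + 1)) →
      r ≤ strip τ P N (val τ (f p)) := by
    intro r f p hp hpr hseg
    have : f p ∈ seg (m.arr 0) (bound st a e r) (bound st a e (r + 1)) :=
      hseg ▸ mem_seg.2 ⟨p, hp, hpr, rfl⟩
    obtain ⟨q, hq, hqr, hqp⟩ := mem_seg.1 this
    have hb := le_bound (st := st) (a := a) (e := e) (r := r)
    obtain ⟨j, hj, hje, hjq, hAj⟩ := hT q (by omega)
      (by have := bound_le (st := st) (r := r + 1) hae; omega)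
    rw [← hqp, hAj, ← hst]
    exact ((st_eq_iff hj hje).2 ⟨by omega, by omega⟩).ge
  simp only [sortStrips, wp]
  refine ⟨by omega, ?_⟩
  refine wp_call (wp_for (i := 36) (e := 43) (N + 1) (fun r m' => m'.reg 10 = bound st a e r ∧
    seg (m'.arr 0) a (bound st a e r) = seg (m.arr 0) a (bound st a e r) ∧
    Asc τ (m'.arr 0) a (bound st a e r) ∧
    ∀ p, p < a ∨ bound st a e r ≤ p → m'.arr 0 p = m.arr 0 p)
    (fun r => (80 * ((Finset.Ico a e).filter fun j => st j = r).card + 13) *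
          (Nat.log 2 (desc τ (m.arr 0) (bound st a e r) (bound st a e (r + 1))) + 1) + 2)
    (by decide) (by decide) (by simp [mergeSort, mergePass, findRun, mergeRuns])
    (by simp [mergeSort, mergePass, findRun, mergeRuns])
    (by simp [mergeSort, mergePass, findRun, mergeRuns]) (by simp [h1])
    (by simp [h43]) (by simp) (by omega) ?_ ?_) ?_
  · simp [h30, bound_zero, seg_self]
    intro p q hp hpq hq; omega
  · rintro r m' hf _ hr h36 ⟨g1, g2, g3, g4⟩
    have e1 : m'.reg 1 = 1 := by
      rw [hf.reg 1 (by simp [mergeSort, mergePass, findRun, mergeRuns])]; simp [h1]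
    have e4 : m'.arr 4 r = bound st a e (r + 1) := by
      rw [hf.arr 4 (by simp [mergeSort, mergePass, findRun, mergeRuns])]
      simp [h4 r (by omega)]
    have hb1 : bound st a e r ≤ bound st a e (r + 1) := bound_mono (Nat.le_succ r)
    have hb2 := bound_le (st := st) (r := r + 1) hae
    have hb3 := le_bound (st := st) (a := a) (e := e) (r := r)
    simp only [wp]
    refine wp_call (wp_mergeSort (τ := τ) (X := 0) (lo := bound st a e r)
      (hi := bound st a e (r + 1)) (by decide) (by simp [e1]) (by simp [g1])
      (by simp [h36, e4]) hb1 (by omega) ?_) ?_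
    · intro p hp hpr
      obtain ⟨j, hj, hje, _, hAj⟩ := hT p (by omega) (by omega)
      rw [State.arr_set, g4 p (Or.inr hp), hAj]
      exact hA j hj hje
    · rintro t₁ m₁ ⟨k1, k2, k3, k4⟩ f₁
      have e11 : m₁.reg 11 = bound st a e (r + 1) :=
        (f₁.reg 11 (by simp [mergeSort, mergePass, findRun, mergeRuns])).trans (by simp [h36, e4])
      simp only [State.arr_set] at k1 k2 k4
      have hsame : ∀ p, bound st a e r ≤ p → p < bound st a e (r + 1) →
          m'.arr 0 p = m.arr 0 p := fun p hp _ => g4 p (Or.inr hp)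
      rw [desc_congr hsame] at k1
      rw [seg_congr hsame] at k2
      have k2' : seg (m₁.arr 0) a (bound st a e r) = seg (m.arr 0) a (bound st a e r) := by
        rw [← g2]
        exact seg_congr fun p _ hp => k4 p (Or.inl hp)
      simp [e11]
      refine ⟨?_, ?_, ?_, ?_⟩
      · have := bound_succ (st := st) (a := a) (e := e) (r := r)
        rw [this, Nat.add_sub_cancel_left, ← this] at k1
        omega
      · rw [← seg_append _ hb3 hb1, ← seg_append (m.arr 0) hb3 hb1, k2, k2']
      · intro p q hp hpq hq
        rcases lt_or_ge q (bound st a e r) with hqr | hqr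
        · rw [k4 p (Or.inl (by omega)), k4 q (Or.inl hqr)]
          exact g3 p q hp hpq hqr
        · rcases lt_or_ge p (bound st a e r) with hpr | hpr
          · by_contra hlt
            have h1 := hstrip_lt r _ p hp hpr k2'
            have h2 := hstrip_le r _ q hqr hq k2
            have h3 := strip_mono (τ := τ) P N (not_le.1 hlt).le
            omega
          · exact k3 p q hpr hpq hq
      · intro p hp
        rw [k4 p (by omega), g4 p (by omega)]
  · rintro t m' ⟨ht, -, -, g2, g3, g4⟩ hf
    rw [hend] at g2 g3 g4
    simp [Finset.sum_add_distrib] at ht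
    refine ⟨by omega, ?_, g3, g4⟩
    rw [g2, seg_eq_of_posn h0]

end CompRAM

/-! ### Merging one segment, and one level of segments -/

namespace CompRAM

open TwinWidth (val val_injective val_of_lt twinWidth)

variable {n : ℕ} {τ : Equiv.Perm (Fin n)} {w : ℕ}

/-- Sort the segment by distributing its elements to the strips between sorted samples. -/
def mergeSegment : Prog :=
  takeSamples ;; .const 10 0 ;; .move 11 35 ;; mergeSort 2 ;; assignStrips ;; prefixSums ;;
  moveToStrips ;; sortStrips

theorem BlockSorted.card_startsCell_le' {A P : ℕ → ℕ} {a e B N : ℕ} (h : BlockSorted τ A a e B)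
    {st : ℕ → ℕ} (hst : ∀ j, st j = strip τ P N (val τ (A j))) (hB : 0 < B) (hBa : B ∣ a) :
    ((Finset.Ico a e).filter fun j => StartsCell st B j).card ≤
      6 * (twinWidth τ + 1) * (((e - a) / B + 1) + (N + 1)) := by
  refine (h.card_startsCell_le hst).trans ?_
  have h1 := h.sum_card_stripBlocks_le hst hB hBa (Finset.range (N + 1))
  rw [Finset.card_range, ← card_cells_eq_sum, Finset.filter_true_of_mem] at h1
  · exact h1
  · intro j _
    rw [hst, Finset.mem_range]
    exact Nat.lt_succ_of_le (strip_le P N _)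

/-- All logarithms are at most `s + 1`, and there are at most `μ / s` samples, so sorting the
samples is linear. A search costs `O(s)` at each of `O(D * (μ / (s * s) + N + 2))` cells, and
multiplying this count by `s` gives `O(D * (μ + s * s))`. The rest is linear, or is bounded by `S`.
-/
theorem mergeSegment_time_le {D N s μ c t₁ t₂ t₃ t₄ S : ℕ} (hD : 0 < D) (hs : 0 < s)
    (hN : N * s ≤ μ) (hμ : μ ≤ 2 ^ s) (h1 : t₁ ≤ 5 * μ + 4)
    (h2 : t₂ ≤ (80 * N + 13) * (Nat.log 2 N + 1))
    (h3 : t₃ ≤ 4 * N + 25 * μ + 8 + c * (7 * Nat.log 2 (2 * N) + 4))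
    (hc : c ≤ 6 * D * ((μ / (s * s) + 1) + (N + 1)))
    (h4 : t₄ ≤ 12 * μ + 9 * N + 22 + S) (hS : S ≤ 3000 * D * (μ + s * s)) :
    t₁ + t₂ + t₃ + t₄ + 2 ≤ 4000 * D * (μ + s * s) := by
  have hNμ : N ≤ μ := (Nat.le_mul_of_pos_right _ hs).trans hN
  have hlog : Nat.log 2 N ≤ s := by
    refine (Nat.log_mono_right (hNμ.trans hμ)).trans ?_
    rw [Nat.log_pow (by norm_num)]
  have hlog2 : Nat.log 2 (2 * N) ≤ s + 1 := by
    refine (Nat.log_mono_right (Nat.mul_le_mul_left 2 (hNμ.trans hμ))).trans ?_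
    rw [← pow_succ', Nat.log_pow (by norm_num)]
  have hss : s ≤ s * s := Nat.le_mul_of_pos_right _ hs
  have h2' : t₂ ≤ 160 * μ + 26 * (s * s) := by
    calc t₂ ≤ (80 * N + 13) * (2 * s) := h2.trans (Nat.mul_le_mul_left _ (by omega))
      _ = 160 * (N * s) + 26 * s := by ring
      _ ≤ _ := by omega
  have hdiv : μ / (s * s) * s ≤ μ :=
    (Nat.mul_le_mul_left _ hss).trans (Nat.div_mul_le_self _ _)
  have h3' : c * (7 * Nat.log 2 (2 * N) + 4) ≤ 216 * (D * μ) + 216 * (D * (s * s)) := by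
    calc _ ≤ 6 * D * ((μ / (s * s) + 1) + (N + 1)) * (18 * s) :=
          Nat.mul_le_mul hc (by omega)
      _ = 108 * (D * (μ / (s * s) * s + N * s + 2 * s)) := by ring
      _ ≤ 108 * (D * (μ + μ + 2 * (s * s))) := by gcongr
      _ = _ := by ring
  have e1 : 4000 * D * (μ + s * s) = 4000 * (D * μ) + 4000 * (D * (s * s)) := by ring
  have e2 : 3000 * D * (μ + s * s) = 3000 * (D * μ) + 3000 * (D * (s * s)) := by ring
  have e3 : μ ≤ D * μ := Nat.le_mul_of_pos_left _ hD
  have e4 : s * s ≤ D * (s * s) := Nat.le_mul_of_pos_left _ hD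
  have e5 : 1 ≤ s * s := Nat.mul_pos hs hs
  omega

theorem wp_mergeSegment {m : State} {a e s : ℕ} {A : ℕ → ℕ} (h1 : m.reg 1 = 1)
    (h2 : m.reg 2 = 0) (h30 : m.reg 30 = a) (h31 : m.reg 31 = e) (h32 : m.reg 32 = s)
    (h33 : m.reg 33 = s * s) (hA : m.arr 0 = A) (hs : 0 < s) (hBa : s * s ∣ a) (hae : a ≤ e)
    (hlen : e - a ≤ 2 ^ s) (hw : 2 * e + s + 3 < 2 ^ w) (h : BlockSorted τ A a e (s * s)) :
    wp τ w mergeSegment m fun t m' => t ≤ 4000 * (twinWidth τ + 1) * (e - a + s * s) ∧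
      seg (m'.arr 0) a e = seg A a e ∧ Asc τ (m'.arr 0) a e ∧
      ∀ p, p < a ∨ e ≤ p → m'.arr 0 p = A p := by
  have hB : 0 < s * s := Nat.mul_pos hs hs
  simp only [mergeSegment, wp]
  refine wp_call (wp_takeSamples h1 h30 h31 h32 hs hae (by omega)) ?_
  rintro t₁ m₁ ⟨ht₁, g1, g2, g3⟩ f₁
  obtain ⟨N, hN⟩ : ∃ N, m₁.reg 35 = N := ⟨_, rfl⟩
  rw [hN] at g1 g2 g3
  rw [hA] at g3
  have hNe : N ≤ e - a := (Nat.le_mul_of_pos_right _ hs).trans g1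
  have hsample : ∀ p < N, a + p * s + (s - 1) < e := by
    intro p hp
    have : (p + 1) * s ≤ N * s := Nat.mul_le_mul_right _ hp
    rw [add_mul, one_mul] at this
    omega
  have e1 : m₁.reg 1 = 1 := (f₁.reg 1 (by simp [takeSamples])).trans h1
  have e2 : m₁.reg 2 = 0 := (f₁.reg 2 (by simp [takeSamples])).trans h2
  have e30 : m₁.reg 30 = a := (f₁.reg 30 (by simp [takeSamples])).trans h30
  have e31 : m₁.reg 31 = e := (f₁.reg 31 (by simp [takeSamples])).trans h31
  have e33 : m₁.reg 33 = s * s := (f₁.reg 33 (by simp [takeSamples])).trans h33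
  have eA : m₁.arr 0 = A := (f₁.arr 0 (by simp [takeSamples])).trans hA
  refine ⟨by omega, ?_⟩
  refine wp_call (wp_mergeSort (τ := τ) (X := 2) (lo := 0) (hi := N) (by decide) (by simp [e1])
    (by simp) (by simp [hN]) (Nat.zero_le _) (by omega) ?_) ?_
  · intro p _ hp
    simp only [State.arr_set]
    rw [g3 p hp]
    exact h.lt _ (by omega) (hsample p hp)
  rintro t₂ m₂ ⟨ht₂, k1, hasc, -⟩ f₂
  simp only [State.arr_set] at ht₂ k1
  have f₂reg : ∀ r, 25 < r → m₂.reg r = m₁.reg r := by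
    intro r hr
    rw [f₂.reg r fun h' => by have := mergeSort_wr 2 r h'; omega]
    simp [show r ≠ 10 by omega, show r ≠ 11 by omega]
  have hP : ∀ p < N, m₂.arr 2 p < n := by
    intro p hp
    have : m₂.arr 2 p ∈ seg (m₁.arr 2) 0 N := k1 ▸ mem_seg.2 ⟨p, Nat.zero_le _, hp, rfl⟩
    obtain ⟨q, -, hq, hqp⟩ := mem_seg.1 this
    rw [← hqp, g3 q hq]
    exact h.lt _ (by omega) (hsample q hq)
  -- Sorting only rearranges the samples, so each sampled element is still one of the pivots.
  have hP' : ∀ p, a + p * s + (s - 1) < e → ∃ q < N, m₂.arr 2 q = A (a + p * s + (s - 1)) := by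
    intro p hp
    have hpN : p < N := by
      by_contra hle
      have := Nat.mul_le_mul_right s (not_lt.1 hle)
      omega
    have : A (a + p * s + (s - 1)) ∈ seg (m₂.arr 2) 0 N :=
      k1 ▸ mem_seg.2 ⟨p, Nat.zero_le _, hpN, g3 p hpN⟩
    obtain ⟨q, -, hq, hqp⟩ := mem_seg.1 this
    exact ⟨q, hq, hqp⟩
  obtain ⟨P, hP2⟩ : ∃ P, m₂.arr 2 = P := ⟨_, rfl⟩
  rw [hP2] at hP hP' hasc
  obtain ⟨st, hst⟩ : ∃ st : ℕ → ℕ, ∀ j, st j = strip τ P N (val τ (A j)) := ⟨_, fun _ => rfl⟩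
  have hstN : ∀ j, st j ≤ N := fun j => hst j ▸ strip_le _ _ _
  have e1₂ : m₂.reg 1 = 1 := by
    rw [f₂.reg 1 fun h' => by have := mergeSort_wr 2 1 h'; omega]; simp [e1]
  have e2₂ : m₂.reg 2 = 0 := by
    rw [f₂.reg 2 fun h' => by have := mergeSort_wr 2 2 h'; omega]; simp [e2]
  have eA₂ : m₂.arr 0 = A := by
    rw [f₂.arr 0 fun h' => by have := mergeSort_wa 2 0 h'; omega]; simp [eA]
  refine wp_call (wp_assignStrips e1₂ e2₂ ((f₂reg 30 (by omega)).trans e30)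
    ((f₂reg 31 (by omega)).trans e31) ((f₂reg 33 (by omega)).trans e33)
    ((f₂reg 35 (by omega)).trans hN) eA₂ hP2 hB hBa hae (by omega) (by omega) h hP hasc hst) ?_
  rintro t₃ m₃ ⟨ht₃, g43, hF, hG⟩ f₃
  have e1₃ : m₃.reg 1 = 1 := (f₃.reg 1 (by simp [assignStrips, cellFlag, findStrip])).trans e1₂
  have e30₃ : m₃.reg 30 = a := (f₃.reg 30 (by simp [assignStrips, cellFlag, findStrip])).trans
    ((f₂reg 30 (by omega)).trans e30)
  have e31₃ : m₃.reg 31 = e := (f₃.reg 31 (by simp [assignStrips, cellFlag, findStrip])).trans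
    ((f₂reg 31 (by omega)).trans e31)
  have eA₃ : m₃.arr 0 = A := (f₃.arr 0 (by simp [assignStrips, cellFlag, findStrip])).trans eA₂
  refine wp_call (wp_prefixSums e1₃ e30₃ g43 hae (by omega) (by omega) hG) ?_
  rintro t₄ m₄ ⟨ht₄, hG₄⟩ f₄
  have e1₄ : m₄.reg 1 = 1 := (f₄.reg 1 (by simp [prefixSums])).trans e1₃
  have e30₄ : m₄.reg 30 = a := (f₄.reg 30 (by simp [prefixSums])).trans e30₃
  have e31₄ : m₄.reg 31 = e := (f₄.reg 31 (by simp [prefixSums])).trans e31₃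
  have e43₄ : m₄.reg 43 = N + 1 := (f₄.reg 43 (by simp [prefixSums])).trans g43
  have eA₄ : m₄.arr 0 = A := (f₄.arr 0 (by simp [prefixSums])).trans eA₃
  have e3₄ : m₄.arr 3 = m₃.arr 3 := f₄.arr 3 (by simp [prefixSums])
  refine wp_call (wp_moveToStrips e1₄ e30₄ e31₄ eA₄ hae (by omega) hstN
    (fun j hj hje => by rw [e3₄, hF j hj hje]) hG₄) ?_
  rintro t₅ m₅ ⟨ht₅, hG₅, hT, hout⟩ f₅
  have e1₅ : m₅.reg 1 = 1 := (f₅.reg 1 (by simp [moveToStrips])).trans e1₄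
  have e30₅ : m₅.reg 30 = a := (f₅.reg 30 (by simp [moveToStrips])).trans e30₄
  have e43₅ : m₅.reg 43 = N + 1 := (f₅.reg 43 (by simp [moveToStrips])).trans e43₄
  refine wp_call (wp_sortStrips e1₅ e30₅ e43₅ hae (by omega) (by omega) h.lt hst hG₅ hT) ?_
  rintro t₆ m₆ ⟨ht₆, r1, r2, r3⟩ -
  refine ⟨?_, r1, r2, fun p hp => (r3 p hp).trans (hout p hp)⟩
  have hS := h.sum_cost_le hst hs hBa hlen hNe hP'
  have hS' : ∑ r ∈ Finset.range (N + 1),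
        (80 * ((Finset.Ico a e).filter fun j => st j = r).card + 13) *
          (Nat.log 2 (desc τ (m₅.arr 0) (bound st a e r) (bound st a e (r + 1))) + 1) ≤
      3000 * (twinWidth τ + 1) * (e - a + s * s) :=
    (Finset.sum_le_sum fun r _ => Nat.mul_le_mul_left _ (Nat.add_le_add_right
      (Nat.log_mono_right (h.desc_le hT hae r)) 1)).trans hS
  have hlog := log_desc_le (τ := τ) (m₁.arr 2) 0 N
  have := mergeSegment_time_le (D := twinWidth τ + 1) (t₄ := t₄ + t₅ + t₆) (Nat.succ_pos _) hs g1
    hlen ht₁ (t₂ := t₂) (ht₂.trans (Nat.mul_le_mul_left _ (Nat.add_le_add_right hlog 1))) ht₃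
    (h.card_startsCell_le' hst hB hBa) (by omega) hS'
  omega

/-- Every block of `B` positions is sorted. -/
def SortedBlocks (τ : Equiv.Perm (Fin n)) (A : ℕ → ℕ) (B : ℕ) : Prop :=
  ∀ a, B ∣ a → a ≤ n → seg A a (min (a + B) n) = seg id a (min (a + B) n) ∧
    Asc τ A a (min (a + B) n)

theorem SortedBlocks.seg_eq {A : ℕ → ℕ} {B a : ℕ} (h : SortedBlocks τ A B) (hB : B ∣ a)
    (ha : a ≤ n) (k : ℕ) : seg A a (min (a + k * B) n) = seg id a (min (a + k * B) n) := by
  induction k with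
  | zero => simp [ha, seg_self]
  | succ k ih =>
    rcases le_or_gt (a + k * B) n with hk | hk
    · have := (h (a + k * B) (hB.add (Dvd.intro_left _ rfl)) hk).1
      rw [min_eq_left hk] at ih
      rw [show a + (k + 1) * B = a + k * B + B by ring,
        ← seg_append A (b := a + k * B) (by omega) (by omega),
        ← seg_append id (b := a + k * B) (by omega) (by omega), this, ih]
    · rw [min_eq_right hk.le] at ih
      rwa [min_eq_right (hk.le.trans (by gcongr; omega))]

/-- Each block is a rearrangement of its own positions. Equal entries therefore lie in the same
block, where the list has no duplicates. -/
theorem SortedBlocks.blockSorted {A : ℕ → ℕ} {B e : ℕ} (h : SortedBlocks τ A B) (hB : 0 < B)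
    (a : ℕ) (he : e ≤ n) : BlockSorted τ A a e B := by
  have hblock : ∀ j, j < e → ∃ c, c = j / B * B ∧ c ≤ j ∧ j < min (c + B) n ∧
      seg A c (min (c + B) n) = seg id c (min (c + B) n) ∧ Asc τ A c (min (c + B) n) := by
    intro j hj
    have h1 := Nat.div_add_mod j B
    have h2 := Nat.mod_lt j hB
    rw [mul_comm] at h1
    have := h (j / B * B) (Dvd.intro_left _ rfl) (by omega)
    exact ⟨_, rfl, by omega, by omega, this⟩
  have hmem : ∀ j, j < e → A j < n ∧ A j / B = j / B := by
    intro j hj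
    obtain ⟨c, hc, h1, h2, h3, -⟩ := hblock j hj
    have : A j ∈ seg id c (min (c + B) n) := h3 ▸ mem_seg.2 ⟨j, h1, h2, rfl⟩
    obtain ⟨i, hi, hin, hij⟩ := mem_seg.1 this
    simp only [id] at hij
    refine ⟨by omega, ?_⟩
    refine Nat.div_eq_of_lt_le (by omega) ?_
    rw [add_mul, one_mul]
    omega
  refine ⟨fun j _ hj => (hmem j hj).1, fun j _ hj => (hmem j hj).2, fun i j _ hi _ hj hij => ?_,
    fun i j _ hij hj hd => ?_⟩
  · obtain ⟨c, hc, h1, h2, h3, -⟩ := hblock j hj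
    have hd : i / B = j / B := by rw [← (hmem i hi).2, ← (hmem j hj).2, hij]
    obtain ⟨c', hc', h1', h2', -⟩ := hblock i hi
    have hcc : c' = c := by rw [hc, hc', hd]
    have hnd : (seg A c (min (c + B) n)).Nodup := by
      rw [h3, seg, Multiset.map_id]; exact Finset.nodup _
    refine Multiset.inj_on_of_nodup_map hnd i ?_ j ?_ hij
    · rw [Finset.mem_val, Finset.mem_Ico]; omega
    · rw [Finset.mem_val, Finset.mem_Ico]; omega
  · obtain ⟨c, hc, h1, h2, -, h4⟩ := hblock j hj
    obtain ⟨c', hc', h1', h2', -⟩ := hblock i (by omega)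
    have hcc : c' = c := by rw [hc, hc', hd]
    exact h4 i j (by omega) hij (by omega)

/-- Merge the sorted blocks of the segments whose length is in register 34. -/
def mergeLevel : Prog :=
  .const 30 0 ;; .loop (.lt 30 0) (
    .add 31 30 34 ;; .ite (.lt 31 0) .skip (.move 31 0) ;; mergeSegment ;; .add 30 30 34)

theorem mergeSegment_wr : ∀ r ∈ mergeSegment.wr, 10 ≤ r ∧ r < 50 ∧ (r < 30 ∨ 34 < r) := by
  intro r hr
  simp only [mergeSegment, Prog.wr, List.mem_append] at hr
  simp only [takeSamples, assignStrips, cellFlag, findStrip, prefixSums, moveToStrips, sortStrips,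
    Prog.wr, List.mem_append, List.mem_singleton, List.not_mem_nil] at hr
  by_cases h0 : r ∈ (mergeSort 0).wr
  · have := mergeSort_wr 0 r h0
    omega
  by_cases h2 : r ∈ (mergeSort 2).wr
  · have := mergeSort_wr 2 r h2
    omega
  simp only [h0, h2, false_or, or_false] at hr
  omega

/-- A segment costs in proportion to its length plus `s * s`, and `s * s ≤ μ`, so `8000 * D * μ` per
segment suffices. Divisibility of `μ` by `s * s` ensures that segments consist of whole blocks,
except at the end of the input. -/
theorem wp_mergeLevel {m : State} {s μ : ℕ} (h0 : m.reg 0 = n) (h1 : m.reg 1 = 1)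
    (h2 : m.reg 2 = 0) (h32 : m.reg 32 = s) (h33 : m.reg 33 = s * s) (h34 : m.reg 34 = μ)
    (hs : 0 < s) (hBμ : s * s ∣ μ) (hμ0 : 0 < μ) (hμ : min μ n ≤ 2 ^ s)
    (hw : 2 * n + μ + s + 3 < 2 ^ w) (h : SortedBlocks τ (m.arr 0) (s * s)) :
    wp τ w mergeLevel m fun t m' => t ≤ 8010 * (twinWidth τ + 1) * (n + μ) + 2 ∧
      SortedBlocks τ (m'.arr 0) μ := by
  have hB : 0 < s * s := Nat.mul_pos hs hs
  have hBle : s * s ≤ μ := Nat.le_of_dvd hμ0 hBμ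
  have hwr : ∀ r, (r < 10 ∨ 31 < r ∧ r < 35) → r ∉ (Prog.add 31 30 34 ;;
      Prog.ite (.lt 31 0) .skip (.move 31 0) ;; mergeSegment ;; Prog.add 30 30 34).wr := by
    intro r hr hr'
    simp only [Prog.wr, List.mem_append, List.mem_singleton, List.not_mem_nil] at hr'
    by_cases h : r ∈ mergeSegment.wr
    · have := mergeSegment_wr r h
      omega
    · simp only [h, false_or] at hr'
      omega
  simp only [mergeLevel, wp]
  refine ⟨by omega, ?_⟩
  refine wp_call (wp_while (fun m' => μ ∣ m'.reg 30 ∧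
    (∀ c, μ ∣ c → c < m'.reg 30 → c ≤ n →
      seg (m'.arr 0) c (min (c + μ) n) = seg id c (min (c + μ) n) ∧
        Asc τ (m'.arr 0) c (min (c + μ) n)) ∧
    ∀ p, m'.reg 30 ≤ p → m'.arr 0 p = m.arr 0 p)
    -- With `n + μ` instead of `n`, every round lowers the difference by exactly `μ`, also the last
    -- one, which may step past `n`.
    (fun m' => 8010 * (twinWidth τ + 1) * (n + μ - m'.reg 30)) ?_ ?_) ?_
  · simp
  · rintro m' hf ⟨g1, g2, g3⟩ hc
    have e0 : m'.reg 0 = n := (hf.reg 0 (hwr 0 (by omega))).trans (by simp [h0])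
    have e1 : m'.reg 1 = 1 := (hf.reg 1 (hwr 1 (by omega))).trans (by simp [h1])
    have e2 : m'.reg 2 = 0 := (hf.reg 2 (hwr 2 (by omega))).trans (by simp [h2])
    have e32 : m'.reg 32 = s := (hf.reg 32 (hwr 32 (by omega))).trans (by simp [h32])
    have e33 : m'.reg 33 = s * s := (hf.reg 33 (hwr 33 (by omega))).trans (by simp [h33])
    have e34 : m'.reg 34 = μ := (hf.reg 34 (hwr 34 (by omega))).trans (by simp [h34])
    simp only [holds, e0] at hc
    obtain ⟨a, ha⟩ : ∃ a, m'.reg 30 = a := ⟨_, rfl⟩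
    rw [ha] at g1 g2 g3 hc
    have hBS : SortedBlocks τ (m.arr 0) (s * s) := h
    have hmain : ∀ m₁ : State, m₁.reg 0 = n → m₁.reg 1 = 1 → m₁.reg 2 = 0 → m₁.reg 32 = s →
        m₁.reg 33 = s * s → m₁.reg 34 = μ → m₁.reg 30 = a → m₁.reg 31 = min (a + μ) n →
        m₁.arr = m'.arr → wp τ w (mergeSegment ;; .add 30 30 34) m₁ fun t m'' =>
          t ≤ 8000 * (twinWidth τ + 1) * μ + 1 ∧ m''.reg 30 = a + μ ∧
          (∀ c, μ ∣ c → c < a + μ → c ≤ n →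
            seg (m''.arr 0) c (min (c + μ) n) = seg id c (min (c + μ) n) ∧
              Asc τ (m''.arr 0) c (min (c + μ) n)) ∧
          ∀ p, a + μ ≤ p → m''.arr 0 p = m.arr 0 p := by
      intro m₁ k0 k1 k2 k32 k33 k34 k30 k31 ke
      simp only [wp]
      have hsegeq : ∀ p, a ≤ p → p < min (a + μ) n → m.arr 0 p = m'.arr 0 p :=
        fun p hp _ => (g3 p hp).symm
      have hbs := hBS.blockSorted hB a (min_le_right (a + μ) n)
      have hbs' : BlockSorted τ (m'.arr 0) a (min (a + μ) n) (s * s) := by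
        refine ⟨fun j hj hje => ?_, fun j hj hje => ?_, fun i j hi hie hj hje => ?_,
          fun i j hi hij hje => ?_⟩
        · rw [g3 j hj]; exact hbs.lt j hj hje
        · rw [g3 j hj]; exact hbs.div_eq j hj hje
        · rw [g3 j hj, g3 i hi]; exact hbs.inj i j hi hie hj hje
        · rw [g3 j (hi.trans hij), g3 i hi]; exact hbs.asc i j hi hij hje
      refine wp_call (wp_mergeSegment k1 k2 k30 k31 k32 k33 (congrFun ke 0) hs (hBμ.trans g1)
        (by omega) (by omega) (by omega) hbs') ?_
      rintro t m'' ⟨ht, r1, r2, r3⟩ f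
      have e30 : m''.reg 30 = a := (f.reg 30 fun h => by
        have := mergeSegment_wr 30 h; omega).trans k30
      have e34 : m''.reg 34 = μ := (f.reg 34 fun h => by
        have := mergeSegment_wr 34 h; omega).trans k34
      simp only [e30, e34, State.arr_set, State.reg_set, if_true]
      refine ⟨by omega, ?_, trivial, ?_, ?_⟩
      · have : 4000 * (twinWidth τ + 1) * (min (a + μ) n - a + s * s) ≤
            4000 * (twinWidth τ + 1) * (2 * μ) := Nat.mul_le_mul_left _ (by omega)
        linarith
      · intro c hc hca hcn
        rcases lt_or_ge c a with hlt | hge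
        · have hcμ : c + μ ≤ a := by
            obtain ⟨x, rfl⟩ := hc
            obtain ⟨y, rfl⟩ := g1
            have : x < y := lt_of_mul_lt_mul_left hlt (Nat.zero_le _)
            calc μ * x + μ = μ * (x + 1) := by ring
              _ ≤ _ := Nat.mul_le_mul_left _ this
          obtain ⟨q1, q2⟩ := g2 c hc hlt hcn
          have heq : ∀ p, c ≤ p → p < min (c + μ) n → m''.arr 0 p = m'.arr 0 p :=
            fun p _ hp => r3 p (Or.inl (by omega))
          refine ⟨(seg_congr heq).trans q1, fun p q hp hpq hq => ?_⟩
          rw [heq p hp (by omega), heq q (by omega) hq]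
          exact q2 p q hp hpq hq
        · have hca : c = a := by
            obtain ⟨x, rfl⟩ := hc
            obtain ⟨y, rfl⟩ := g1
            have h1 : y ≤ x := le_of_mul_le_mul_left hge hμ0
            have h2 : μ * x < μ * (y + 1) := by rw [mul_add, mul_one]; exact hca
            have h3 : x < y + 1 := lt_of_mul_lt_mul_left h2 (Nat.zero_le _)
            rw [show x = y by omega]
          subst hca
          refine ⟨?_, r2⟩
          obtain ⟨k, hk⟩ := hBμ
          rw [r1, ← seg_congr hsegeq]
          have := hBS.seg_eq ((Dvd.intro _ hk.symm).trans g1) hcn k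
          rwa [mul_comm k, ← hk] at this
      · intro p hp
        rw [r3 p (Or.inr (by omega)), g3 p (by omega)]
    have harith : 8010 * (twinWidth τ + 1) * (n + μ - a) =
        8010 * (twinWidth τ + 1) * μ + 8010 * (twinWidth τ + 1) * (n + μ - (a + μ)) := by
      rw [← mul_add]; congr 1; omega
    have harith2 : 8010 * (twinWidth τ + 1) * μ =
        8000 * (twinWidth τ + 1) * μ + 10 * ((twinWidth τ + 1) * μ) := by ring
    have harith3 : 1 ≤ (twinWidth τ + 1) * μ := Nat.mul_pos (Nat.succ_pos _) hμ0
    simp only [ha]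
    generalize hq : (mergeSegment ;; Prog.add 30 30 34) = q at hmain ⊢
    simp only [wp]
    refine ⟨by simp [ha, e34]; omega, fun hlt => ?_, fun hge => ?_⟩
    · simp only [holds, State.reg_set, ha, e34, e0] at hlt
      simp only [if_true] at hlt
      refine wp_mono (hmain _ (by simp [e0]) (by simp [e1]) (by simp [e2]) (by simp [e32])
        (by simp [e33]) (by simp [e34]) (by simp [ha])
        (by simp [e34, ha]; simp at hlt; omega) (by simp)) ?_
      rintro t m'' ⟨ht, r1, r2, r3⟩
      rw [r1]
      exact ⟨⟨(Nat.dvd_add_self_right).2 g1, r2, r3⟩, by omega⟩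
    · simp only [holds, State.reg_set, ha, e34, e0] at hge
      refine wp_mono (hmain _ (by simp [e0]) (by simp [e1]) (by simp [e2]) (by simp [e32])
        (by simp [e33]) (by simp [e34]) (by simp [ha])
        (by simp [e0]; simp at hge; omega) (by simp)) ?_
      rintro t m'' ⟨ht, r1, r2, r3⟩
      rw [r1]
      exact ⟨⟨(Nat.dvd_add_self_right).2 g1, r2, r3⟩, by omega⟩
  · rintro t m' ⟨⟨g1, g2, g3⟩, hc, ht⟩ hf
    have e0 : m'.reg 0 = n := (hf.reg 0 (hwr 0 (by omega))).trans (by simp [h0])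
    simp only [holds, e0, not_lt] at hc
    refine ⟨?_, fun a ha han => ?_⟩
    · simp only [State.reg_set, if_true, Nat.sub_zero] at ht
      omega
    · rcases lt_or_ge a (m'.reg 30) with hlt | hge
      · exact g2 a ha hlt han
      · rw [show min (a + μ) n = a by omega, seg_self, seg_self]
        exact ⟨rfl, fun p q hp hpq hq => by omega⟩

end CompRAM

/-! ### Searching for the key of a block -/

namespace TwinWidth

variable {n : ℕ} {τ : Equiv.Perm (Fin n)}

/-- A slot at index `k < b` is at most `k`, so it is a genuine digit in base `b`, and division
removes the last digits. -/
theorem key_div {a b j : ℕ} (k : ℕ) (hjk : j ≤ k) (hkb : k ≤ b) :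
    key τ a b k / b ^ (k - j) = key τ a b j := by
  induction k, hjk using Nat.le_induction with
  | base => simp
  | succ k hjk ih =>
    have h1 := slot_le τ a k
    rw [Nat.succ_sub hjk, pow_succ', ← Nat.div_div_eq_div_mul, key, add_comm (_ * b),
      Nat.add_mul_div_right _ _ (by omega), Nat.div_eq_of_lt (show slot τ a k < b by omega), zero_add, ih (by omega)]

/-- The relative orders of the first elements of two blocks agree. -/
def SameOrder (τ : Equiv.Perm (Fin n)) (a a' j : ℕ) : Prop :=
  ∀ x < j, ∀ y < j, val τ (a + x) < val τ (a + y) ↔ val τ (a' + x) < val τ (a' + y)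

theorem val_add_ne {a x y : ℕ} (h : x ≠ y) : val τ (a + x) ≠ val τ (a + y) := fun h' =>
  h (Nat.add_left_cancel (val_injective τ h'))

/-- By induction the first `j` elements of both blocks are ordered alike. The elements below the
`j`-th one form an initial segment of this common order. Of two initial segments one contains the
other, so equal sizes, that is equal slots, make them equal. -/
theorem sameOrder_of_key_eq {a a' b : ℕ} (j : ℕ) (hj : j ≤ b) (h : key τ a b j = key τ a' b j) :
    SameOrder τ a a' j := by
  induction j with
  | zero => intro x hx; omega
  | succ j ih =>
    have h1 := slot_le τ a j
    have h2 := slot_le τ a' j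
    simp only [key] at h
    have hmod := congrArg (· % b) h
    simp only [Nat.mul_add_mod_self_right, Nat.mod_eq_of_lt (show slot τ a j < b by omega),
      Nat.mod_eq_of_lt (show slot τ a' j < b by omega)] at hmod
    rw [hmod] at h
    have ih := ih (by omega) (Nat.eq_of_mul_eq_mul_right (by omega) (Nat.add_right_cancel h))
    have hS : ((Finset.range j).filter fun x => val τ (a + x) < val τ (a + j)) =
        ((Finset.range j).filter fun x => val τ (a' + x) < val τ (a' + j)) := by
      by_cases hsub : ((Finset.range j).filter fun x => val τ (a + x) < val τ (a + j)) ⊆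
          ((Finset.range j).filter fun x => val τ (a' + x) < val τ (a' + j))
      · exact Finset.eq_of_subset_of_card_le hsub hmod.ge
      · obtain ⟨x, hx, hx'⟩ := Finset.not_subset.1 hsub
        simp only [Finset.mem_filter, Finset.mem_range, not_and, not_lt] at hx hx'
        refine (Finset.eq_of_subset_of_card_le (fun y hy => ?_) hmod.le).symm
        simp only [Finset.mem_filter, Finset.mem_range] at hy ⊢
        exact ⟨hy.1, ((ih y hy.1 x hx.1).2 (hy.2.trans_le (hx' hx.1))).trans hx.2⟩
    have hj' : ∀ x < j, val τ (a + x) < val τ (a + j) ↔ val τ (a' + x) < val τ (a' + j) := by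
      intro x hx
      have := Finset.ext_iff.1 hS x
      simpa [hx] using this
    intro x hx y hy
    rcases Nat.lt_succ_iff_lt_or_eq.1 hx with hx | rfl
    · rcases Nat.lt_succ_iff_lt_or_eq.1 hy with hy | rfl
      · exact ih x hx y hy
      · exact hj' x hx
    · rcases Nat.lt_succ_iff_lt_or_eq.1 hy with hy | rfl
      · have h3 := hj' y hy
        have h4 := val_add_ne (τ := τ) (a := a) hy.ne
        have h5 := val_add_ne (τ := τ) (a := a') hy.ne
        omega
      · simp

/-- `v` is the predecessor of the `j`-th element of the block at `a` among the first `i`, or `j` if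
there is none. -/
structure IsPred (τ : Equiv.Perm (Fin n)) (a j i v : ℕ) : Prop where
  eq_or : v = j ∨ v < i ∧ val τ (a + v) < val τ (a + j)
  max : ∀ x < i, val τ (a + x) < val τ (a + j) → v < i ∧ val τ (a + x) ≤ val τ (a + v)

/-- `v` is the successor of the `j`-th element of the block at `a` among the first `i`, or `j` if
there is none. -/
structure IsSucc (τ : Equiv.Perm (Fin n)) (a j i v : ℕ) : Prop where
  eq_or : v = j ∨ v < i ∧ val τ (a + j) < val τ (a + v)
  min : ∀ x < i, val τ (a + j) < val τ (a + x) → v < i ∧ val τ (a + v) ≤ val τ (a + x)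

theorem IsPred.le {a j i v : ℕ} (h : IsPred τ a j i v) (hi : i ≤ j) : v ≤ j := by
  rcases h.eq_or with h | h <;> omega

theorem IsSucc.le {a j i v : ℕ} (h : IsSucc τ a j i v) (hi : i ≤ j) : v ≤ j := by
  rcases h.eq_or with h | h <;> omega

section compare

variable {a a' j v : ℕ}

/-- The predecessor and successor known for the representative `a'` delimit the gap into which its
`j`-th element falls. As the first `j` elements are ordered alike in both blocks, comparing the
`j`-th element at `a` with the same two places tells whether its gap is lower, higher or the same.
The four lemmas here give the resulting inequalities of slots. A missing neighbour is represented by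
`j` itself, for which the strict comparison cannot occur. -/
theorem IsPred.slot_lt (h : IsPred τ a' j j v) (ho : SameOrder τ a a' j)
    (hlt : val τ (a + j) < val τ (a + v)) : slot τ a j < slot τ a' j := by
  rcases h.eq_or with rfl | ⟨hv, hv'⟩
  · exact absurd hlt (lt_irrefl _)
  refine Finset.card_lt_card ⟨fun x hx => ?_, fun hsub => ?_⟩
  · simp only [Finset.mem_filter, Finset.mem_range] at hx ⊢
    exact ⟨hx.1, ((ho x hx.1 v hv).1 (hx.2.trans hlt)).trans hv'⟩
  · have := hsub (Finset.mem_filter.2 ⟨Finset.mem_range.2 hv, hv'⟩)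
    exact absurd hlt (Finset.mem_filter.1 this).2.not_gt

theorem IsPred.slot_le (h : IsPred τ a' j j v) (ho : SameOrder τ a a' j)
    (hle : val τ (a + v) ≤ val τ (a + j)) : slot τ a' j ≤ slot τ a j := by
  refine Finset.card_le_card fun x hx => ?_
  simp only [Finset.mem_filter, Finset.mem_range] at hx ⊢
  obtain ⟨hv, hxv⟩ := h.max x hx.1 hx.2
  have h1 := ho v hv x hx.1
  have h2 := val_add_ne (τ := τ) (a := a) hv.ne
  exact ⟨hx.1, by omega⟩

theorem IsSucc.slot_lt (h : IsSucc τ a' j j v) (ho : SameOrder τ a a' j)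
    (hlt : val τ (a + v) < val τ (a + j)) : slot τ a' j < slot τ a j := by
  rcases h.eq_or with rfl | ⟨hv, hv'⟩
  · exact absurd hlt (lt_irrefl _)
  refine Finset.card_lt_card ⟨fun x hx => ?_, fun hsub => ?_⟩
  · simp only [Finset.mem_filter, Finset.mem_range] at hx ⊢
    exact ⟨hx.1, ((ho x hx.1 v hv).2 (hx.2.trans hv')).trans hlt⟩
  · have := hsub (Finset.mem_filter.2 ⟨Finset.mem_range.2 hv, hlt⟩)
    exact absurd hv' (Finset.mem_filter.1 this).2.not_gt

theorem IsSucc.slot_le (h : IsSucc τ a' j j v) (ho : SameOrder τ a a' j)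
    (hle : val τ (a + j) ≤ val τ (a + v)) : slot τ a j ≤ slot τ a' j := by
  refine Finset.card_le_card fun x hx => ?_
  simp only [Finset.mem_filter, Finset.mem_range] at hx ⊢
  refine ⟨hx.1, ?_⟩
  by_contra hge
  have h2 := val_add_ne (τ := τ) (a := a') hx.1.ne
  obtain ⟨hv, hxv⟩ := h.min x hx.1 (by omega)
  have h1 := ho x hx.1 v hv
  omega

end compare

/-- The key of the block at `a` is in the interval `[x, y)`, whose elements have the same first `j`
digits. -/
structure KeySearch (τ : Equiv.Perm (Fin n)) (a b x y j : ℕ) : Prop where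
  hj : j ≤ b
  lo : key τ a b j * b ^ (b - j) ≤ x
  hi : y ≤ (key τ a b j + 1) * b ^ (b - j)
  dvd_lo : b ^ (b - j - 1) ∣ x
  dvd_hi : b ^ (b - j - 1) ∣ y
  le : x ≤ key τ a b b
  lt : key τ a b b < y

section KeySearch

variable {a a' b x y j v : ℕ}

theorem keySearch_zero (τ : Equiv.Perm (Fin n)) (a b : ℕ) : KeySearch τ a b 0 (b ^ b) 0 :=
  ⟨Nat.zero_le _, by simp [key], by simp [key], Nat.dvd_zero _, pow_dvd_pow _ (by omega),
    Nat.zero_le _, key_lt τ a b b le_rfl⟩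

theorem KeySearch.eq_key (h : KeySearch τ a b x y b) : x = key τ a b b := by
  have h1 := h.lo
  have h2 := h.le
  simp only [Nat.sub_self, pow_zero, mul_one] at h1
  omega

theorem KeySearch.key_eq (h : KeySearch τ a b x y j) (hx : x ≤ key τ a' b b)
    (hy : key τ a' b b < y) : key τ a b j = key τ a' b j := by
  rw [← key_div (τ := τ) (a := a') b h.hj le_rfl]
  exact (Nat.div_eq_of_lt_le (h.lo.trans hx) (hy.trans_le h.hi)).symm

/-- The first `j` digits agree with those of the representative and the next one is smaller. So the
key lies below the representative's key with all digits after the `j`-th one cleared. -/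
theorem KeySearch.pred_lt (h : KeySearch τ a b x y j) (hj : j < b) (hx : x ≤ key τ a' b b)
    (hy : key τ a' b b < y) (hv : IsPred τ a' j j v) (hlt : val τ (a + j) < val τ (a + v)) :
    KeySearch τ a b x (key τ a' b b / b ^ (b - j - 1) * b ^ (b - j - 1)) j := by
  have hk := h.key_eq hx hy
  have hs := hv.slot_lt (sameOrder_of_key_eq j h.hj hk) hlt
  have hz := Nat.div_mul_le_self (key τ a' b b) (b ^ (b - j - 1))
  refine ⟨h.hj, h.lo, by have := h.hi; omega, h.dvd_lo, Dvd.intro_left _ rfl, h.le, ?_⟩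
  have h1 := key_div (τ := τ) (a := a) (j := j + 1) b hj le_rfl
  have h2 := key_div (τ := τ) (a := a') (j := j + 1) b hj le_rfl
  rw [Nat.sub_sub, h2, ← Nat.div_lt_iff_lt_mul (Nat.pow_pos (by omega)), h1, key, key, hk]
  omega

/-- Here the next digit is larger, so the key is at least the representative's prefix of `j + 1`
digits increased by one in its last place. -/
theorem KeySearch.lt_succ (h : KeySearch τ a b x y j) (hj : j < b) (hx : x ≤ key τ a' b b)
    (hy : key τ a' b b < y) (hv : IsSucc τ a' j j v) (hlt : val τ (a + v) < val τ (a + j)) :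
    KeySearch τ a b (key τ a' b b / b ^ (b - j - 1) * b ^ (b - j - 1) + b ^ (b - j - 1)) y j := by
  have hk := h.key_eq hx hy
  have hs := hv.slot_lt (sameOrder_of_key_eq j h.hj hk) hlt
  have hz := Nat.lt_div_mul_add (a := key τ a' b b) (b := b ^ (b - j - 1)) (Nat.pow_pos (by omega))
  refine ⟨h.hj, by have := h.lo; omega, h.hi, (Dvd.intro_left _ rfl).add dvd_rfl, h.dvd_hi, ?_,
    h.lt⟩
  have h1 := key_div (τ := τ) (a := a) (j := j + 1) b hj le_rfl
  have h2 := key_div (τ := τ) (a := a') (j := j + 1) b hj le_rfl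
  rw [← Nat.succ_mul, Nat.sub_sub, h2, ← Nat.le_div_iff_mul_le (Nat.pow_pos (by omega)), h1, key,
    key, hk]
  omega

/-- Neither comparison is strict in the excluding direction, so the digits agree, and the interval
becomes the set of all numbers with this prefix of `j + 1` digits. -/
theorem KeySearch.digit {v' : ℕ} (h : KeySearch τ a b x y j) (hj : j < b)
    (hx : x ≤ key τ a' b b) (hy : key τ a' b b < y) (hv : IsPred τ a' j j v)
    (hv' : IsSucc τ a' j j v') (hle : val τ (a + v) ≤ val τ (a + j))
    (hle' : val τ (a + j) ≤ val τ (a + v')) :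
    KeySearch τ a b (key τ a' b b / b ^ (b - j - 1) * b ^ (b - j - 1))
      (key τ a' b b / b ^ (b - j - 1) * b ^ (b - j - 1) + b ^ (b - j - 1)) (j + 1) := by
  have hk := h.key_eq hx hy
  have ho := sameOrder_of_key_eq j h.hj hk
  have hs := (hv.slot_le ho hle).antisymm (hv'.slot_le ho hle')
  have h1 := key_div (τ := τ) (a := a) (j := j + 1) b hj le_rfl
  have h2 := key_div (τ := τ) (a := a') (j := j + 1) b hj le_rfl
  have h3 : key τ a b (j + 1) = key τ a' b (j + 1) := by rw [key, key, hk, hs]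
  rw [← h3] at h2
  rw [Nat.sub_sub, h2]
  have hpos : 0 < b ^ (b - (j + 1)) := Nat.pow_pos (by omega)
  refine ⟨hj, le_rfl, by rw [Nat.succ_mul], ?_, ?_, ?_, ?_⟩
  · exact (pow_dvd_pow _ (Nat.sub_le _ _)).trans (Dvd.intro_left _ rfl)
  · exact (pow_dvd_pow _ (Nat.sub_le _ _)).trans ((Dvd.intro_left _ rfl).add dvd_rfl)
  · rw [← h1]; exact Nat.div_mul_le_self _ _
  · rw [← h1]; exact Nat.lt_div_mul_add hpos

/-- The ends of the interval are multiples of the weight of digit `j`. So rounding a number of the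
interval down, or up as in the next lemma, does not leave it. -/
theorem KeySearch.le_floor (h : KeySearch τ a b x y j) {M : ℕ} (hx : x ≤ M) :
    x ≤ M / b ^ (b - j - 1) * b ^ (b - j - 1) := by
  obtain ⟨k, rfl⟩ := h.dvd_lo
  rcases Nat.eq_zero_or_pos (b ^ (b - j - 1)) with h0 | h0
  · simp [h0]
  rw [mul_comm]
  exact Nat.mul_le_mul_right _ ((Nat.le_div_iff_mul_le h0).2 (by rwa [mul_comm]))

theorem KeySearch.ceil_le (h : KeySearch τ a b x y j) {M : ℕ} (hy : M < y) :
    M / b ^ (b - j - 1) * b ^ (b - j - 1) + b ^ (b - j - 1) ≤ y := by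
  obtain ⟨k, rfl⟩ := h.dvd_hi
  rcases Nat.eq_zero_or_pos (b ^ (b - j - 1)) with h0 | h0
  · simp [h0]
  rw [← Nat.succ_mul, mul_comm _ k]
  exact Nat.mul_le_mul_right _ ((Nat.div_lt_iff_lt_mul h0).2 (by rwa [mul_comm]))

end KeySearch

end TwinWidth

/-! ### Sorting blocks by what was learned from earlier blocks -/

namespace CompRAM

open TwinWidth (val val_injective val_of_lt twinWidth slot key slot_le key_lt card_keys_le IsPred
  IsSucc KeySearch SameOrder sameOrder_of_key_eq keySearch_zero val_add_ne)

variable {n : ℕ} {τ : Equiv.Perm (Fin n)} {w : ℕ}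

/-- The number of elements of `S` less than `x`. -/
def below (S : Finset ℕ) (x : ℕ) : ℕ := (S.filter fun K => K < x).card

theorem below_mono (S : Finset ℕ) : Monotone (below S) := fun _ _ h =>
  Finset.card_le_card (Finset.monotone_filter_right _ fun _ _ h' => h'.trans_le h)

theorem below_le (S : Finset ℕ) (x : ℕ) : below S x ≤ S.card := Finset.card_filter_le _ _

theorem below_zero (S : Finset ℕ) : below S 0 = 0 := by simp [below]

theorem below_succ (S : Finset ℕ) (x : ℕ) :
    below S (x + 1) = below S x + if x ∈ S then 1 else 0 := by
  unfold below
  split_ifs with h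
  · rw [← Finset.card_insert_of_notMem (a := x) (by simp)]
    congr 1
    ext K
    simp only [Finset.mem_filter, Finset.mem_insert]
    constructor
    · rintro ⟨h1, h2⟩
      rcases Nat.lt_succ_iff_lt_or_eq.1 h2 with h2 | h2
      · exact Or.inr ⟨h1, h2⟩
      · exact Or.inl h2
    · rintro (rfl | ⟨h1, h2⟩)
      · exact ⟨h, Nat.lt_succ_self _⟩
      · exact ⟨h1, by omega⟩
  · rw [add_zero]
    congr 1
    refine Finset.filter_congr fun K hK => ?_
    have : K ≠ x := fun h' => h (h' ▸ hK)
    omega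

/-- The counting function rises by at most one at each step, and only at elements of `S`, so every
intermediate value is the rank of an element. -/
theorem exists_below_eq {S : Finset ℕ} {x i : ℕ} (y : ℕ) (hx : below S x ≤ i)
    (hy : i < below S y) : ∃ M ∈ S, below S M = i ∧ x ≤ M ∧ M < y := by
  induction y with
  | zero => rw [below_zero] at hy; omega
  | succ y ih =>
    rcases lt_or_ge i (below S y) with h | h
    · obtain ⟨M, h1, h2, h3, h4⟩ := ih h
      exact ⟨M, h1, h2, h3, by omega⟩
    · have hs := below_succ S y
      by_cases hyS : y ∈ S
      · rw [if_pos hyS] at hs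
        refine ⟨y, hyS, by omega, ?_, Nat.lt_succ_self y⟩
        by_contra hlt
        have := below_mono S (show y + 1 ≤ x by omega)
        omega
      · rw [if_neg hyS] at hs; omega

/-- The tables of what was learned about the patterns of blocks before position `a`: the set `S` of
their keys, representatives, numbers of smaller keys, the sorted list of keys, and predecessors and
successors at the positions of the representatives. -/
structure Tables (τ : Equiv.Perm (Fin n)) (b a : ℕ) (S : Finset ℕ)
    (rep cnt list pred succ : ℕ → ℕ) : Prop where
  rep_eq : ∀ K < b ^ b, K ∉ S → rep K = 0
  rep : ∀ K ∈ S, ∃ a', rep K = a' + 1 ∧ b ∣ a' ∧ a' + b ≤ a ∧ key τ a' b b = K ∧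
    ∀ j < b, IsPred τ a' j j (pred (a' + j)) ∧ IsSucc τ a' j j (succ (a' + j))
  cnt : ∀ x ≤ b ^ b, cnt x = below S x
  list : ∀ K ∈ S, list (below S K) = K

theorem Tables.lt {b a : ℕ} {S : Finset ℕ} {rep cnt list pred succ : ℕ → ℕ}
    (h : Tables τ b a S rep cnt list pred succ) {K : ℕ} (hK : K ∈ S) : K < b ^ b := by
  obtain ⟨a', -, -, -, rfl, -⟩ := h.rep K hK
  exact key_lt τ a' b b le_rfl

/-- Every key in the dictionary belongs to an actual block of the permutation, so the bound on the
number of patterns applies. -/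
theorem Tables.card_le {b a : ℕ} {S : Finset ℕ} {rep cnt list pred succ : ℕ → ℕ}
    (h : Tables τ b a S rep cnt list pred succ) (ha : a ≤ n) :
    S.card ≤ 2 ^ (96 * (twinWidth τ + 1) * b) := by
  refine (Finset.card_le_card fun K hK => ?_).trans
    (card_keys_le τ ((Finset.range (n + 1)).filter fun a' => a' + b ≤ n)
      fun a' ha' => (Finset.mem_filter.1 ha').2)
  obtain ⟨a', -, -, h3, h4, -⟩ := h.rep K hK
  exact Finset.mem_image.2 ⟨a', Finset.mem_filter.2 ⟨Finset.mem_range.2 (by omega), by omega⟩, h4⟩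

/-- One step of the search for the key of the block at the position in register 60. -/
def searchStep : Prog :=
  .div 70 68 50 ;; .add 71 63 64 ;; .div 71 71 77 ;; .load 71 7 71 ;;
  .div 72 71 70 ;; .mul 72 72 70 ;; .load 73 5 71 ;; .sub 73 73 1 ;; .add 73 73 67 ;;
  .add 74 60 67 ;; .load 75 8 73 ;; .add 75 60 75 ;; .load 76 9 73 ;; .add 76 60 76 ;;
  .ite (.elemLE 75 74)
    (.ite (.elemLE 74 76) (.move 65 72 ;; .add 66 72 70 ;; .move 68 70 ;; .add 67 67 1)
      (.add 65 72 70))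
    (.move 66 72) ;;
  .load 63 6 65 ;; .load 64 6 66

/-- The number of steps that remain in a search. -/
def searchPotential (S : Finset ℕ) (b x y j : ℕ) : ℕ :=
  Nat.log 2 (2 * (below S y - below S x)) + (b - j)

/-- The registers of a search. -/
structure SearchState (τ : Equiv.Perm (Fin n)) (a b : ℕ) (S : Finset ℕ) (m : State)
    (x y j : ℕ) : Prop where
  search : KeySearch τ a b x y j
  r63 : m.reg 63 = below S x
  r64 : m.reg 64 = below S y
  r65 : m.reg 65 = x
  r66 : m.reg 66 = y
  r67 : m.reg 67 = j
  r68 : m.reg 68 = b ^ (b - j)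
  hy : y ≤ b ^ b

/-- The median known key of the interval is compared by means of its representative. If the next
digits differ, at least half of the known keys are discarded; if they agree, one more digit is
known. Either way the potential falls by one. -/
theorem wp_searchStep {m : State} {a b x y j : ℕ} {S : Finset ℕ} (h1 : m.reg 1 = 1)
    (h77 : m.reg 77 = 2) (h50 : m.reg 50 = b) (h60 : m.reg 60 = a) (hab : a + b ≤ n)
    (hT : Tables τ b a S (m.arr 5) (m.arr 6) (m.arr 7) (m.arr 8) (m.arr 9))
    (hw : 2 * n + 2 * b ^ b + 3 < 2 ^ w) (hs : SearchState τ a b S m x y j) (hj : j < b)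
    (hcnt : below S x < below S y) :
    wp τ w searchStep m fun t m' => t ≤ 22 ∧ ∃ x' y' j', SearchState τ a b S m' x' y' j' ∧
      searchPotential S b x' y' j' + 1 ≤ searchPotential S b x y j := by
  have hw0 : w ≠ 0 := by rintro rfl; simp at hw
  obtain ⟨M, hMS, hM, hxM, hMy⟩ := exists_below_eq (i := (below S x + below S y) / 2) y
    (S := S) (x := x) (by omega) (by omega)
  obtain ⟨a', g1, -, g3, g4, g5⟩ := hT.rep M hMS
  obtain ⟨gp, gs⟩ := g5 j hj
  have hMb := hT.lt hMS
  have hSy : below S y ≤ b ^ b := by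
    have : ∀ z, below S z ≤ z := fun z => by
      induction z with
      | zero => rw [below_zero]
      | succ z ih => rw [below_succ]; split_ifs <;> omega
    exact (this y).trans hs.hy
  have hlist := hT.list M hMS
  rw [hM] at hlist
  have hW : b ^ (b - j) / b = b ^ (b - j - 1) := by
    rw [Nat.pow_sub_one (by omega) (by omega)]
  have hxz := hs.search.le_floor hxM
  have hzy := hs.search.ceil_le hMy
  have hzM := Nat.div_mul_le_self M (b ^ (b - j - 1))
  have hMz := Nat.lt_div_mul_add (a := M) (b := b ^ (b - j - 1)) (Nat.pow_pos (by omega))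
  subst g4
  have k1 := fun h => hs.search.pred_lt hj hxM hMy gp h
  have k2 := fun h => hs.search.lt_succ hj hxM hMy gs h
  have k3 := fun h h' => hs.search.digit hj hxM hMy gp gs h h'
  have hyb := hs.hy
  have hpj := gp.le le_rfl
  have hsj := gs.le le_rfl
  have hb1 := below_mono S hxz
  have hb2 := below_mono S hzy
  have hb3 := below_mono S hzM
  -- Moving the lower end to `z + W` discards `M` itself too, as the halving requires.
  have hb4 := below_mono S (Nat.succ_le_of_lt hMz)
  rw [below_succ, if_pos hMS] at hb4
  generalize hz : key τ a' b b / b ^ (b - j - 1) * b ^ (b - j - 1) = z at *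
  generalize hWdef : b ^ (b - j - 1) = W at *
  have hpos : 0 < W := by omega
  simp only [searchStep, wp]
  simp [h1, h77, h50, h60, hs.r63, hs.r64, hs.r65, hs.r66, hs.r67, hs.r68, hW, hlist, g1, hz]
  refine ⟨by omega, by omega, by omega, by omega, by omega, by omega, fun _ _ hv => ⟨fun _ _ hv' =>
    ⟨by omega, by omega, ?_⟩, fun hv' => ⟨by omega, ?_⟩⟩, fun hv => ?_⟩
  · refine ⟨z, z + W, j + 1, ⟨k3 hv hv', by simp [hT.cnt z (by omega)],
      by simp [hT.cnt (z + W) (by omega)], by simp, by simp, by simp, by simp; exact hWdef.symm,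
      by omega⟩, ?_⟩
    have := Nat.log_mono_right (b := 2) (show 2 * (below S (z + W) - below S z) ≤
      2 * (below S y - below S x) by omega)
    unfold searchPotential
    omega
  · refine ⟨z + W, y, j, ⟨k2 (hv' (by omega) (by omega)), by simp [hT.cnt (z + W) (by omega)],
      by simp [hT.cnt y hyb], by simp, by simp [hs.r66], by simp [hs.r67],
      by simp [hs.r68], by omega⟩, ?_⟩
    have := log_two_mul_succ_le (k := below S y - below S x)
      (k' := below S y - below S (z + W)) (by omega) (by omega)
    unfold searchPotential
    omega
  · refine ⟨x, z, j, ⟨k1 (hv (by omega) (by omega)), by simp [hT.cnt x (by omega)],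
      by simp [hT.cnt z (by omega)], by simp [hs.r65], by simp, by simp [hs.r67],
      by simp [hs.r68], by omega⟩, ?_⟩
    have := log_two_mul_succ_le (k := below S y - below S x)
      (k' := below S z - below S x) (by omega) (by omega)
    unfold searchPotential
    omega

/-- Search for the key of the block at the position in register 60. Register 69 becomes 1 if the key
is found, and then register 65 is the key. -/
def search : Prog :=
  .const 77 2 ;; .const 69 0 ;; .const 65 0 ;; .move 66 51 ;; .const 67 0 ;; .move 68 51 ;;
  .load 63 6 65 ;; .load 64 6 66 ;;
  .loop (.lt 63 64) (.ite (.lt 67 50) searchStep (.const 69 1 ;; .move 63 64))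

theorem wp_search {m : State} {a b : ℕ} {S : Finset ℕ} (h1 : m.reg 1 = 1)
    (h50 : m.reg 50 = b) (h51 : m.reg 51 = b ^ b) (h60 : m.reg 60 = a) (hab : a + b ≤ n)
    (hT : Tables τ b a S (m.arr 5) (m.arr 6) (m.arr 7) (m.arr 8) (m.arr 9))
    (hw : 2 * n + 2 * b ^ b + 3 < 2 ^ w) :
    wp τ w search m fun t m' => t ≤ 24 * (Nat.log 2 (2 * S.card) + b) + 9 ∧
      (m'.reg 69 = 1 ∧ m'.reg 65 = key τ a b b ∧ key τ a b b ∈ S ∨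
        m'.reg 69 = 0 ∧ key τ a b b ∉ S) := by
  have hw0 : w ≠ 0 := by rintro rfl; simp at hw
  simp only [search, wp]
  refine ⟨by omega, by omega, by omega, by omega, ?_⟩
  refine wp_call (wp_while (fun m' =>
    m'.reg 69 = 0 ∧ (∃ x y j, SearchState τ a b S m' x y j) ∨
      m'.reg 69 = 1 ∧ m'.reg 63 = m'.reg 64 ∧ m'.reg 65 = key τ a b b ∧ key τ a b b ∈ S)
    (fun m' => 24 * (Nat.log 2 (2 * (m'.reg 64 - m'.reg 63)) + (b - m'.reg 67))) ?_ ?_) ?_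
  · refine Or.inl ⟨by simp, 0, b ^ b, 0, keySearch_zero τ a b, by simp [hT.cnt 0 (Nat.zero_le _)],
      by simp [h51, hT.cnt (b ^ b) le_rfl], by simp, by simp [h51], by simp, by simp [h51], le_rfl⟩
  · intro m' hf hI hc
    simp only [holds] at hc
    have e1 : m'.reg 1 = 1 := (hf.reg 1 (by simp [searchStep])).trans (by simp [h1])
    have e50 : m'.reg 50 = b := (hf.reg 50 (by simp [searchStep])).trans (by simp [h50])
    have e60 : m'.reg 60 = a := (hf.reg 60 (by simp [searchStep])).trans (by simp [h60])
    have e77 : m'.reg 77 = 2 := (hf.reg 77 (by simp [searchStep])).trans (by simp)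
    have eA : m'.arr = m.arr := funext fun A => (hf.arr A (by simp [searchStep])).trans (by simp)
    rcases hI with ⟨g1, x, y, j, hs⟩ | ⟨-, g2, -⟩
    swap
    · omega
    rw [hs.r63, hs.r64] at hc
    simp only [wp]
    refine ⟨fun hlt => ?_, fun hge => ?_⟩
    · simp only [holds, hs.r67, e50] at hlt
      refine wp_call (wp_searchStep e1 e77 e50 e60 hab (by rw [eA]; exact hT) hw hs hlt hc) ?_
      rintro t m'' ⟨ht, x', y', j', hs', hpot⟩ hf'
      refine ⟨Or.inl ⟨(hf'.reg 69 (by simp [searchStep])).trans g1, x', y', j', hs'⟩, ?_⟩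
      rw [hs.r63, hs.r64, hs.r67, hs'.r63, hs'.r64, hs'.r67]
      unfold searchPotential at hpot
      omega
    -- All digits are known, so the interval contains a single number. The loop test says that the
    -- interval contains a known key, which must be this number.
    · simp only [holds, hs.r67, e50] at hge
      have hj : j = b := by have := hs.search.hj; omega
      subst hj
      have hx := hs.search.eq_key
      have hy : y = x + 1 := by
        have h1 := hs.search.hi
        have h2 := hs.search.lt
        simp only [Nat.sub_self, pow_zero, mul_one] at h1
        omega
      have hKS : x ∈ S := by
        by_contra hn
        rw [hy, below_succ, if_neg hn] at hc
        omega
      simp [hs.r63, hs.r64, hs.r65, ← hx, hKS, hs.r67]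
      refine ⟨by omega, ?_⟩
      have : 0 < Nat.log 2 (2 * (below S y - below S x)) := Nat.log_pos (by norm_num) (by omega)
      omega
  · rintro t m' ⟨hI, hc, ht⟩ hf
    simp [h51, hT.cnt (b ^ b) le_rfl, hT.cnt 0 (Nat.zero_le _)] at ht
    have := Nat.log_mono_right (b := 2) (show 2 * (below S (b ^ b) - below S 0) ≤ 2 * S.card by
      have := below_le S (b ^ b); omega)
    refine ⟨by omega, ?_⟩
    rcases hI with ⟨g1, x, y, j, hs⟩ | ⟨g1, g2, g3⟩
    -- The key always lies in the interval, so an interval without known keys shows that it is new.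
    · refine Or.inr ⟨g1, fun hK => ?_⟩
      simp only [holds, hs.r63, hs.r64] at hc
      have h1 := below_mono S hs.search.le
      have h2 := below_mono S (Nat.succ_le_of_lt hs.search.lt)
      rw [below_succ, if_pos hK] at h2
      omega
    · exact Or.inl ⟨g1, g3⟩

end CompRAM

/-! ### Copying a known pattern, and learning a new one -/

namespace CompRAM

open TwinWidth (val val_injective val_of_lt twinWidth slot key slot_le key_lt card_keys_le IsPred
  IsSucc KeySearch SameOrder sameOrder_of_key_eq keySearch_zero val_add_ne)

variable {n : ℕ} {τ : Equiv.Perm (Fin n)} {w : ℕ}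

/-- Sort the elements at the positions from register 10 to register 11 from scratch. -/
def sortRange : Prog :=
  .move 80 10 ;; .loop (.lt 80 11) (.store 0 80 80 ;; .add 80 80 1) ;; mergeSort 0

theorem wp_sortRange {m : State} {lo hi : ℕ} (h1 : m.reg 1 = 1) (h10 : m.reg 10 = lo)
    (h11 : m.reg 11 = hi) (hlo : lo ≤ hi) (hi_le : hi ≤ n) (hw : 2 * hi + 3 < 2 ^ w) :
    wp τ w sortRange m fun t m' =>
      t ≤ 3 * (hi - lo) + 2 + (80 * (hi - lo) + 13) * (Nat.log 2 (hi - lo) + 1) ∧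
      seg (m'.arr 0) lo hi = seg id lo hi ∧ Asc τ (m'.arr 0) lo hi ∧
      ∀ p, p < lo ∨ hi ≤ p → m'.arr 0 p = m.arr 0 p := by
  have hw0 : w ≠ 0 := by rintro rfl; simp at hw
  simp only [sortRange, wp]
  refine wp_call (wp_for (i := 80) (e := 11) hi (fun i m' => (∀ p, lo ≤ p → p < i → m'.arr 0 p = p) ∧
    ∀ p, p < lo ∨ hi ≤ p → m'.arr 0 p = m.arr 0 p) (fun _ => 1) (by decide) (by decide) (by simp)
    (by simp) (by simp) (by simp [h1]) (by simp [h11]) (by simp [h10, hlo]) (by omega) ?_ ?_) ?_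
  · simp [h10]
    intro p hp hp'; omega
  · rintro i m' hf hi' hie h80 ⟨g1, g2⟩
    simp [h10] at hi'
    simp [wp, h80]
    refine ⟨fun p hp hpi => ?_, fun p hp => ?_⟩
    · rcases hpi.lt_or_eq with hpi | rfl
      · rw [Function.update_of_ne (by omega)]; exact g1 p hp hpi
      · rw [Function.update_self]
    · rw [Function.update_of_ne (by omega)]; exact g2 p hp
  · rintro t₁ m₁ ⟨ht₁, -, g1, g2⟩ f₁
    simp [h10] at ht₁
    refine wp_mono (wp_mergeSort (lo := lo) (hi := hi) (by decide)
      ((f₁.reg 1 (by simp)).trans (by simp [h1])) ((f₁.reg 10 (by simp)).trans (by simp [h10]))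
      ((f₁.reg 11 (by simp)).trans (by simp [h11])) hlo hw
      fun p hp hpi => by rw [g1 p hp hpi]; omega) ?_
    rintro t₂ m₂ ⟨ht₂, k1, k2, k3⟩
    have hlog := log_desc_le (τ := τ) (m₁.arr 0) lo hi
    have := ht₂.trans (Nat.mul_le_mul_left _ (Nat.add_le_add_right hlog 1))
    refine ⟨by omega, ?_, k2, fun p hp => (k3 p hp).trans (g2 p hp)⟩
    rw [k1]
    exact seg_congr g1

theorem seg_eq_map_range (f : ℕ → ℕ) (a b : ℕ) :
    seg f a (a + b) = (Finset.range b).val.map fun i => f (a + i) := by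
  induction b with
  | zero => simp [seg_self]
  | succ b ih =>
    rw [← add_assoc, seg_succ f (Nat.le_add_right a b), ih, Finset.range_val, Finset.range_val,
      Multiset.range_succ, Multiset.map_cons]

/-- A sorted block shows how to sort another one with the same key. -/
theorem sorted_of_key_eq {A X : ℕ → ℕ} {a a' b : ℕ} (hk : key τ a b b = key τ a' b b)
    (hX : ∀ i < b, X (a + i) = A (a' + i) - a' + a)
    (hseg : seg A a' (a' + b) = seg id a' (a' + b)) (hasc : Asc τ A a' (a' + b)) :
    seg X a (a + b) = seg id a (a + b) ∧ Asc τ X a (a + b) := by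
  have hmem : ∀ i < b, a' ≤ A (a' + i) ∧ A (a' + i) < a' + b := by
    intro i hi
    have : A (a' + i) ∈ seg id a' (a' + b) := hseg ▸ mem_seg.2 ⟨a' + i, by omega, by omega, rfl⟩
    obtain ⟨k, h1, h2, h3⟩ := mem_seg.1 this
    simp only [id] at h3
    omega
  constructor
  · have h1 : seg X a (a + b) = (seg A a' (a' + b)).map fun v => v - a' + a := by
      rw [seg_eq_map_range, seg_eq_map_range, Multiset.map_map]
      refine Multiset.map_congr rfl fun i hi => ?_
      exact hX i (by simpa using hi)
    rw [h1, hseg, seg_eq_map_range, seg_eq_map_range, Multiset.map_map]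
    refine Multiset.map_congr rfl fun i _ => ?_
    simp only [Function.comp, id]
    omega
  · intro p q hp hpq hq
    obtain ⟨i, rfl⟩ := Nat.exists_eq_add_of_le hp
    obtain ⟨k, rfl⟩ := Nat.exists_eq_add_of_le (hp.trans hpq)
    rw [hX i (by omega), hX k (by omega)]
    obtain ⟨h1, h2⟩ := hmem i (by omega)
    obtain ⟨h3, h4⟩ := hmem k (by omega)
    have h5 := hasc (a' + i) (a' + k) (by omega) (by omega) (by omega)
    obtain ⟨x, hx⟩ := Nat.exists_eq_add_of_le h1
    obtain ⟨y, hy⟩ := Nat.exists_eq_add_of_le h3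
    rw [hx, hy] at h5 ⊢
    rw [Nat.add_sub_cancel_left, Nat.add_sub_cancel_left, add_comm x, add_comm y]
    -- Ascending order at the representative is carried over to the new block by the equality of the
    -- relative orders.
    have h6 := sameOrder_of_key_eq b le_rfl hk y (by omega) x (by omega)
    omega

/-- Sort the block from register 60 to register 61, whose key is in register 65, like the
representative of the key. -/
def copyPattern : Prog :=
  .load 82 5 65 ;; .sub 82 82 1 ;; .move 73 82 ;; .move 80 60 ;;
  .loop (.lt 80 61) ((.load 81 0 73 ;; .sub 81 81 82 ;; .add 81 81 60 ;; .store 0 80 81 ;;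
    .add 73 73 1) ;; .add 80 80 1)

theorem wp_copyPattern {m : State} {a a' b : ℕ} {A : ℕ → ℕ} (h1 : m.reg 1 = 1)
    (h60 : m.reg 60 = a) (h61 : m.reg 61 = a + b) (hrep : m.arr 5 (m.reg 65) = a' + 1)
    (hA : m.arr 0 = A) (ha' : a' + b ≤ a) (hab : a + b ≤ n) (hw : 2 * n + 3 < 2 ^ w)
    (hk : key τ a b b = key τ a' b b) (hseg : seg A a' (a' + b) = seg id a' (a' + b))
    (hasc : Asc τ A a' (a' + b)) :
    wp τ w copyPattern m fun t m' => t ≤ 7 * b + 5 ∧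
      seg (m'.arr 0) a (a + b) = seg id a (a + b) ∧ Asc τ (m'.arr 0) a (a + b) ∧
      ∀ p, p < a ∨ a + b ≤ p → m'.arr 0 p = A p := by
  have hmem : ∀ i < b, a' ≤ A (a' + i) ∧ A (a' + i) < a' + b := by
    intro i hi
    have : A (a' + i) ∈ seg id a' (a' + b) := hseg ▸ mem_seg.2 ⟨a' + i, by omega, by omega, rfl⟩
    obtain ⟨k, h1, h2, h3⟩ := mem_seg.1 this
    simp only [id] at h3
    omega
  simp only [copyPattern, wp]
  refine wp_call (wp_for (i := 80) (e := 61) (a + b) (fun i m' => m'.reg 73 + a = a' + i ∧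
    (∀ k < b, a + k < i → m'.arr 0 (a + k) = A (a' + k) - a' + a) ∧
    ∀ p, p < a ∨ i ≤ p → m'.arr 0 p = A p) (fun _ => 5) (by decide) (by decide) (by simp)
    (by simp) (by simp) (by simp [h1]) (by simp [h61]) (by simp [h60]) (by omega) ?_ ?_) ?_
  · simp [h60, hrep, h1, hA]
  · rintro i m' hf hi' hie h80 ⟨g1, g2, g3⟩
    simp [h60] at hi'
    obtain ⟨k, rfl⟩ := Nat.exists_eq_add_of_le hi'
    have hkb : k < b := by omega
    have e73 : m'.reg 73 = a' + k := by omega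
    have e1 : m'.reg 1 = 1 := (hf.reg 1 (by simp)).trans (by simp [h1])
    have e60 : m'.reg 60 = a := (hf.reg 60 (by simp)).trans (by simp [h60])
    have e82 : m'.reg 82 = a' := (hf.reg 82 (by simp)).trans (by simp [hrep, h1])
    have hAk : m'.arr 0 (a' + k) = A (a' + k) := g3 _ (Or.inl (by omega))
    have := hmem k hkb
    simp [wp, h80, e73, e1, e60, e82, hAk]
    refine ⟨by omega, by omega, by omega, fun k' hk' hle => ?_, fun p hp => ?_⟩
    · rcases Nat.lt_succ_iff_lt_or_eq.1 (show k' < k + 1 by omega) with hlt | rfl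
      · rw [Function.update_of_ne (by omega)]; exact g2 k' hk' (by omega)
      · rw [Function.update_self]
    · rw [Function.update_of_ne (by omega)]; exact g3 p (by omega)
  · rintro t m' ⟨ht, -, -, g2, g3⟩ hf
    simp [h60] at ht
    obtain ⟨r1, r2⟩ := sorted_of_key_eq hk (fun i hi => g2 i hi (by omega)) hseg hasc
    exact ⟨by omega, r1, r2, g3⟩

/-- Update the predecessor, the successor and the slot of the `j`-th element of the block at register
60 by its `i`-th element, where `i` and `j` are in registers 83 and 67. -/
def learnScan : Prog :=
  .add 88 60 83 ;;
  .ite (.elemLE 88 74)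
    (.add 85 85 1 ;; .ite (.eq 86 67) (.move 86 83)
      (.add 89 60 86 ;; .ite (.elemLE 89 88) (.move 86 83) .skip))
    (.ite (.eq 87 67) (.move 87 83)
      (.add 89 60 87 ;; .ite (.elemLE 88 89) (.move 87 83) .skip))

/-- The state of the scan of the elements before the `j`-th one. -/
structure ScanInv (τ : Equiv.Perm (Fin n)) (a j i d v v' : ℕ) : Prop where
  slot_eq : d = ((Finset.range i).filter fun x => val τ (a + x) < val τ (a + j)).card
  pred : IsPred τ a j i v
  succ : IsSucc τ a j i v'

section ScanInv

variable {a j i d v v' : ℕ}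

theorem card_filter_range_succ (p : ℕ → Prop) [DecidablePred p] (i : ℕ) :
    ((Finset.range (i + 1)).filter p).card =
      ((Finset.range i).filter p).card + if p i then 1 else 0 := by
  rw [Finset.range_add_one, Finset.filter_insert]
  split_ifs with h
  · rw [Finset.card_insert_of_notMem (by simp)]
  · rfl

theorem ScanInv.step_lt (h : ScanInv τ a j i d v v') (hlt : val τ (a + i) < val τ (a + j)) {u : ℕ}
    (hu : u = i ∧ (v = j ∨ val τ (a + v) ≤ val τ (a + i)) ∨
      u = v ∧ v ≠ j ∧ val τ (a + i) ≤ val τ (a + v)) (hij : i < j) :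
    ScanInv τ a j (i + 1) (d + 1) u v' := by
  obtain ⟨h1, ⟨h2, h3⟩, ⟨h4, h5⟩⟩ := h
  refine ⟨by rw [card_filter_range_succ, if_pos hlt, h1], ⟨?_, ?_⟩, ⟨by omega, ?_⟩⟩
  · rcases hu with ⟨rfl, -⟩ | ⟨rfl, -⟩
    · exact Or.inr ⟨Nat.lt_succ_self _, hlt⟩
    · omega
  · intro x hx hxj
    rcases Nat.lt_succ_iff_lt_or_eq.1 hx with hx | rfl
    · have := h3 x hx hxj
      rcases hu with ⟨rfl, hu⟩ | ⟨rfl, hu⟩ <;> omega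
    · rcases hu with ⟨rfl, hu⟩ | ⟨rfl, hu⟩ <;> omega
  · intro x hx hxj
    rcases Nat.lt_succ_iff_lt_or_eq.1 hx with hx | rfl
    · have := h5 x hx hxj
      omega
    · omega

theorem ScanInv.step_gt (h : ScanInv τ a j i d v v') (hlt : val τ (a + j) < val τ (a + i)) {u : ℕ}
    (hu : u = i ∧ (v' = j ∨ val τ (a + i) ≤ val τ (a + v')) ∨
      u = v' ∧ v' ≠ j ∧ val τ (a + v') ≤ val τ (a + i)) (hij : i < j) :
    ScanInv τ a j (i + 1) d v u := by
  obtain ⟨h1, ⟨h2, h3⟩, ⟨h4, h5⟩⟩ := h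
  refine ⟨by rw [card_filter_range_succ, if_neg (by omega), h1, add_zero], ⟨by omega, ?_⟩, ⟨?_, ?_⟩⟩
  · intro x hx hxj
    rcases Nat.lt_succ_iff_lt_or_eq.1 hx with hx | rfl
    · have := h3 x hx hxj
      omega
    · omega
  · rcases hu with ⟨rfl, -⟩ | ⟨rfl, -⟩
    · exact Or.inr ⟨Nat.lt_succ_self _, hlt⟩
    · omega
  · intro x hx hxj
    rcases Nat.lt_succ_iff_lt_or_eq.1 hx with hx | rfl
    · have := h5 x hx hxj
      rcases hu with ⟨rfl, hu⟩ | ⟨rfl, hu⟩ <;> omega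
    · rcases hu with ⟨rfl, hu⟩ | ⟨rfl, hu⟩ <;> omega

end ScanInv

theorem wp_learnScan {m : State} {a j i d v v' : ℕ} (h1 : m.reg 1 = 1) (h60 : m.reg 60 = a)
    (h67 : m.reg 67 = j) (h83 : m.reg 83 = i) (h74 : m.reg 74 = a + j) (h85 : m.reg 85 = d)
    (h86 : m.reg 86 = v) (h87 : m.reg 87 = v') (hij : i < j) (hj : a + j < n)
    (hw : 2 * n + 3 < 2 ^ w) (h : ScanInv τ a j i d v v') :
    wp τ w learnScan m fun t m' => t ≤ 8 ∧
      ScanInv τ a j (i + 1) (m'.reg 85) (m'.reg 86) (m'.reg 87) := by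
  have hv := h.pred.le hij.le
  have hv' := h.succ.le hij.le
  have hd : d ≤ i := by
    rw [h.slot_eq]
    exact (Finset.card_filter_le _ _).trans (Finset.card_range i).le
  have hne := val_add_ne (τ := τ) (a := a) hij.ne
  simp [learnScan, wp, h1, h60, h67, h83, h74, h85, h86, h87]
  refine ⟨by omega, fun _ _ hle => ⟨by omega, fun he => ?_, fun he => ⟨by omega, fun _ _ hc => ?_,
    fun hc => ?_⟩⟩, fun hlt => ⟨fun he => ?_, fun he => ⟨by omega, fun _ _ hc => ?_, fun hc => ?_⟩⟩⟩
  · exact h.step_lt (by omega) (Or.inl ⟨rfl, Or.inl he⟩) hij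
  · exact h.step_lt (by omega) (Or.inl ⟨rfl, Or.inr hc⟩) hij
  · exact h.step_lt (by omega) (Or.inr ⟨rfl, he, (hc (by omega) (by omega)).le⟩) hij
  · exact h.step_gt (hlt (by omega) hj) (Or.inl ⟨rfl, Or.inl he⟩) hij
  · exact h.step_gt (hlt (by omega) hj) (Or.inl ⟨rfl, Or.inr hc⟩) hij
  · exact h.step_gt (hlt (by omega) hj) (Or.inr ⟨rfl, he, (hc (by omega) (by omega)).le⟩) hij

/-- Compute the key of the block at the position in register 60, and make the block the
representative of its key. -/
def learnPattern : Prog :=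
  .const 84 0 ;; .const 67 0 ;;
  .loop (.lt 67 50) (
    (.const 85 0 ;; .move 86 67 ;; .move 87 67 ;; .const 83 0 ;; .add 74 60 67 ;;
      .loop (.lt 83 67) (learnScan ;; .add 83 83 1) ;;
      .mul 84 84 50 ;; .add 84 84 85 ;; .store 8 74 86 ;; .store 9 74 87) ;;
    .add 67 67 1) ;;
  .add 89 60 1 ;; .store 5 84 89

/-- Comparing each element with all earlier ones of the block takes quadratic time, which is
affordable since it is done only once per pattern. Only cells of arrays 8 and 9 inside the new block
are written, so the neighbours stored for earlier representatives survive. -/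
theorem wp_learnPattern {m : State} {a b : ℕ} (h1 : m.reg 1 = 1) (h50 : m.reg 50 = b)
    (h60 : m.reg 60 = a) (hab : a + b ≤ n) (hw : 2 * n + 2 * b ^ b + 3 < 2 ^ w) :
    wp τ w learnPattern m fun t m' => t ≤ b * (10 * b + 12) + 5 ∧
      m'.arr 5 = Function.update (m.arr 5) (key τ a b b) (a + 1) ∧
      (∀ j < b, IsPred τ a j j (m'.arr 8 (a + j)) ∧ IsSucc τ a j j (m'.arr 9 (a + j))) ∧
      ∀ p < a, m'.arr 8 p = m.arr 8 p ∧ m'.arr 9 p = m.arr 9 p := by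
  have hw0 : w ≠ 0 := by rintro rfl; simp at hw
  simp only [learnPattern, wp]
  refine ⟨by omega, by omega, ?_⟩
  refine wp_call (wp_for (i := 67) (e := 50) b (fun j m' => m'.reg 84 = key τ a b j ∧
    (∀ k < j, IsPred τ a k k (m'.arr 8 (a + k)) ∧ IsSucc τ a k k (m'.arr 9 (a + k))) ∧
    ∀ p < a, m'.arr 8 p = m.arr 8 p ∧ m'.arr 9 p = m.arr 9 p)
    (fun _ => 10 * b + 10) (by decide) (by decide) (by simp [learnScan])
    (by simp [learnScan]) (by simp [learnScan]) (by simp [h1]) (by simp [h50]) (by simp)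
    (by omega) ?_ ?_) ?_
  · simp [key]
  · rintro j m' hf - hj h67 ⟨g1, g2, g3⟩
    have e1 : m'.reg 1 = 1 := (hf.reg 1 (by simp [learnScan])).trans (by simp [h1])
    have e50 : m'.reg 50 = b := (hf.reg 50 (by simp [learnScan])).trans (by simp [h50])
    have e60 : m'.reg 60 = a := (hf.reg 60 (by simp [learnScan])).trans (by simp [h60])
    simp only [wp]
    refine ⟨by omega, by omega, by simp [e60, h67]; omega, ?_⟩
    refine wp_call (wp_for (i := 83) (e := 67) j (fun i m₁ =>
      ScanInv τ a j i (m₁.reg 85) (m₁.reg 86) (m₁.reg 87)) (fun _ => 8) (by decide) (by decide)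
      (by simp [learnScan]) (by simp [learnScan]) (by simp [learnScan]) (by simp [e1])
      (by simp [h67]) (by simp) (by omega) ?_ ?_) ?_
    · simp [h67]
      exact ⟨by simp, ⟨Or.inl rfl, by simp⟩, ⟨Or.inl rfl, by simp⟩⟩
    · rintro i m₁ hf₁ - hij h83 hI
      refine wp_mono (wp_learnScan ((hf₁.reg 1 (by simp [learnScan])).trans (by simp [e1]))
        ((hf₁.reg 60 (by simp [learnScan])).trans (by simp [e60]))
        ((hf₁.reg 67 (by simp [learnScan])).trans (by simp [h67])) h83
        ((hf₁.reg 74 (by simp [learnScan])).trans (by simp [e60, h67])) rfl rfl rfl hij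
        (by omega) (by omega) hI) ?_
      rintro t m₂ ⟨ht, hI'⟩
      exact ⟨ht, by simpa using hI'⟩
    · rintro t₁ m₁ ⟨ht₁, -, hI⟩ f₁
      simp at ht₁
      have k84 : m₁.reg 84 = key τ a b j := (f₁.reg 84 (by simp [learnScan])).trans (by simp [g1])
      have k50 : m₁.reg 50 = b := (f₁.reg 50 (by simp [learnScan])).trans (by simp [e50])
      have k74 : m₁.reg 74 = a + j := (f₁.reg 74 (by simp [learnScan])).trans (by simp [e60, h67])
      have k8 : m₁.arr 8 = m'.arr 8 := (f₁.arr 8 (by simp [learnScan])).trans (by simp)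
      have k9 : m₁.arr 9 = m'.arr 9 := (f₁.arr 9 (by simp [learnScan])).trans (by simp)
      have hslot : m₁.reg 85 = slot τ a j := hI.slot_eq
      have hkey := key_lt τ a b (j + 1) hj
      have hpow : b ^ (j + 1) ≤ b ^ b := Nat.pow_le_pow_right (by omega) hj
      rw [key] at hkey
      simp [k84, k50, k74, k8, k9, hslot]
      refine ⟨by omega, by omega, by omega, by rw [key], fun k hk => ?_, fun p hp => ?_⟩
      · rcases Nat.lt_succ_iff_lt_or_eq.1 (Nat.lt_succ_of_le hk) with hk | rfl
        · rw [Function.update_of_ne (by omega), Function.update_of_ne (by omega)]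
          exact g2 k hk
        · rw [Function.update_self, Function.update_self]
          exact ⟨hI.pred, hI.succ⟩
      · rw [Function.update_of_ne (by omega), Function.update_of_ne (by omega)]
        exact g3 p hp
  · rintro t m' ⟨ht, -, g1, g2, g3⟩ hf
    have e1 : m'.reg 1 = 1 := (hf.reg 1 (by simp [learnScan])).trans (by simp [h1])
    have e60 : m'.reg 60 = a := (hf.reg 60 (by simp [learnScan])).trans (by simp [h60])
    have e5 : m'.arr 5 = m.arr 5 := (hf.arr 5 (by simp [learnScan])).trans (by simp)
    simp at ht
    simp [e1, e60, e5, g1]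
    exact ⟨by omega, by linarith, g2, g3⟩

/-- Recompute the numbers of smaller keys and the list of keys. -/
def rebuildTables : Prog :=
  .const 91 0 ;; .const 90 0 ;;
  .loop (.lt 90 51) (
    (.store 6 90 91 ;; .load 92 5 90 ;; .ite (.eq 92 2) .skip (.store 7 91 90 ;; .add 91 91 1)) ;;
    .add 90 90 1) ;;
  .store 6 51 91

theorem wp_rebuildTables {m : State} {N : ℕ} {S : Finset ℕ} (h1 : m.reg 1 = 1)
    (h2 : m.reg 2 = 0) (h51 : m.reg 51 = N) (hS : ∀ K ∈ S, K < N)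
    (hrep : ∀ K < N, m.arr 5 K = 0 ↔ K ∉ S) (hw : 2 * N + 3 < 2 ^ w) :
    wp τ w rebuildTables m fun t m' => t ≤ 7 * N + 4 ∧ (∀ x ≤ N, m'.arr 6 x = below S x) ∧
      ∀ K ∈ S, m'.arr 7 (below S K) = K := by
  have hw0 : w ≠ 0 := by rintro rfl; simp at hw
  have hbelow : ∀ z, below S z ≤ z := fun z => by
    induction z with
    | zero => rw [below_zero]
    | succ z ih => rw [below_succ]; split_ifs <;> omega
  simp only [rebuildTables, wp]
  refine ⟨by omega, by omega, ?_⟩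
  refine wp_call (wp_for (i := 90) (e := 51) N (fun x m' => m'.reg 91 = below S x ∧
    (∀ y < x, m'.arr 6 y = below S y) ∧ ∀ K ∈ S, K < x → m'.arr 7 (below S K) = K)
    (fun _ => 5) (by decide) (by decide) (by simp) (by simp) (by simp) (by simp [h1])
    (by simp [h51]) (by simp) (by omega) ?_ ?_) ?_
  · simp [below_zero]
  · rintro x m' hf - hx h90 ⟨g1, g2, g3⟩
    have e1 : m'.reg 1 = 1 := (hf.reg 1 (by simp)).trans (by simp [h1])
    have e2 : m'.reg 2 = 0 := (hf.reg 2 (by simp)).trans (by simp [h2])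
    have e5 : m'.arr 5 = m.arr 5 := (hf.arr 5 (by simp)).trans (by simp)
    have hbx := hbelow x
    have hcnt : ∀ y ≤ x, Function.update (m'.arr 6) x (below S x) y = below S y := by
      intro y hy
      rcases hy.lt_or_eq with hy | rfl
      · rw [Function.update_of_ne (by omega)]; exact g2 y hy
      · rw [Function.update_self]
    simp [wp, h90, e1, e2, e5, g1, hrep x hx, below_succ]
    refine ⟨fun hxS => ⟨?_, hcnt, fun K hK hKx => ?_⟩, fun hxS => ⟨by omega, ?_, hcnt,
      fun K hK hKx => ?_⟩⟩
    · exact hxS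
    · have : K ≠ x := fun h => hxS (h ▸ hK)
      exact g3 K hK (by omega)
    · exact hxS
    · rcases hKx.lt_or_eq with hKx | rfl
      · have h3 := below_mono S (Nat.succ_le_of_lt hKx)
        rw [below_succ, if_pos hK] at h3
        rw [Function.update_of_ne (by omega)]
        exact g3 K hK hKx
      · rw [Function.update_self]
  · rintro t m' ⟨ht, -, g1, g2, g3⟩ hf
    have e51 : m'.reg 51 = N := (hf.reg 51 (by simp)).trans (by simp [h51])
    simp at ht
    simp [e51, g1]
    refine ⟨by omega, fun x hx => ?_, fun K hK => g3 K hK (hS K hK)⟩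
    rcases hx.lt_or_eq with hx | rfl
    · rw [Function.update_of_ne (by omega)]; exact g2 x hx
    · rw [Function.update_self]

end CompRAM

/-! ### The amortised cost of sorting all short blocks -/

namespace CompRAM

open TwinWidth (val val_injective val_of_lt twinWidth slot key slot_le key_lt card_keys_le IsPred
  IsSucc KeySearch SameOrder sameOrder_of_key_eq keySearch_zero val_add_ne)

variable {n : ℕ} {τ : Equiv.Perm (Fin n)} {w : ℕ}

/-- Sort the block from register 60 to register 61, from scratch if its key is new. -/
def sortBlock : Prog :=
  search ;; .ite (.eq 69 1) copyPattern
    (.move 10 60 ;; .move 11 61 ;; sortRange ;; learnPattern ;; rebuildTables)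

/-- The memory after sorting the blocks before `a`, which have the keys in `S`. -/
structure BlocksInv (τ : Equiv.Perm (Fin n)) (b a : ℕ) (S : Finset ℕ) (m : State) : Prop where
  tables : Tables τ b a S (m.arr 5) (m.arr 6) (m.arr 7) (m.arr 8) (m.arr 9)
  sorted : ∀ c, b ∣ c → c + b ≤ a → seg (m.arr 0) c (c + b) = seg id c (c + b) ∧
    Asc τ (m.arr 0) c (c + b)

/-- A bound on the time to sort a block from scratch, and to learn from it. -/
def learnTime (b : ℕ) : ℕ :=
  3 * b + 2 + (80 * b + 13) * (Nat.log 2 b + 1) + (b * (10 * b + 12) + 5) + (7 * b ^ b + 4)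

theorem BlocksInv.sorted_succ {b a : ℕ} {S : Finset ℕ} {m m' : State} (h : BlocksInv τ b a S m)
    (hba : b ∣ a) (hseg : seg (m'.arr 0) a (a + b) = seg id a (a + b))
    (hasc : Asc τ (m'.arr 0) a (a + b)) (hout : ∀ p < a, m'.arr 0 p = m.arr 0 p) (c : ℕ)
    (hc : b ∣ c) (hca : c + b ≤ a + b) :
    seg (m'.arr 0) c (c + b) = seg id c (c + b) ∧ Asc τ (m'.arr 0) c (c + b) := by
  rcases (show c ≤ a by omega).lt_or_eq with hlt | rfl
  · have hle : c + b ≤ a := by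
      obtain ⟨x, rfl⟩ := hc
      obtain ⟨y, rfl⟩ := hba
      rw [← Nat.mul_succ]
      exact Nat.mul_le_mul_left _ (lt_of_mul_lt_mul_left hlt (Nat.zero_le _))
    obtain ⟨h1, h2⟩ := h.sorted c hc hle
    refine ⟨(seg_congr fun p _ hp => hout p (by omega)).trans h1, fun p q hp hpq hq => ?_⟩
    rw [hout p (by omega), hout q (by omega)]
    exact h2 p q hp hpq hq
  · exact ⟨hseg, hasc⟩

/-- The set of known keys can be read off the memory, so a potential which depends only on the
memory can refer to its size. -/
theorem Tables.filter_eq {b a : ℕ} {S : Finset ℕ} {rep cnt list pred succ : ℕ → ℕ}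
    (h : Tables τ b a S rep cnt list pred succ) :
    ((Finset.range (b ^ b)).filter fun K => rep K ≠ 0) = S := by
  ext K
  rw [Finset.mem_filter, Finset.mem_range]
  refine ⟨fun hK => by_contra fun hS => hK.2 (h.rep_eq K hK.1 hS), fun hK => ⟨h.lt hK, ?_⟩⟩
  obtain ⟨a', h1, -⟩ := h.rep K hK
  omega

theorem Tables.card_le_pow {b a : ℕ} {S : Finset ℕ} {rep cnt list pred succ : ℕ → ℕ}
    (h : Tables τ b a S rep cnt list pred succ) : S.card ≤ b ^ b := by
  rw [← h.filter_eq]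
  exact (Finset.card_filter_le _ _).trans (Finset.card_range _).le

theorem Tables.mono {b a a' : ℕ} {S : Finset ℕ} {rep cnt list pred succ : ℕ → ℕ}
    (h : Tables τ b a S rep cnt list pred succ) (ha : a ≤ a') :
    Tables τ b a' S rep cnt list pred succ := by
  refine ⟨h.rep_eq, fun K hK => ?_, h.cnt, h.list⟩
  obtain ⟨c, h1, h2, h3, h4⟩ := h.rep K hK
  exact ⟨c, h1, h2, h3.trans ha, h4⟩

theorem Tables.insert {b a : ℕ} {S : Finset ℕ} {rep cnt list pred succ cnt' list' pred' succ' : ℕ → ℕ}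
    (h : Tables τ b a S rep cnt list pred succ) (hba : b ∣ a)
    (hnew : ∀ j < b, IsPred τ a j j (pred' (a + j)) ∧ IsSucc τ a j j (succ' (a + j)))
    (hold : ∀ p < a, pred' p = pred p ∧ succ' p = succ p)
    (hcnt : ∀ x ≤ b ^ b, cnt' x = below (insert (key τ a b b) S) x)
    (hlist : ∀ K ∈ insert (key τ a b b) S, list' (below (insert (key τ a b b) S) K) = K)
    (hK : key τ a b b ∉ S) :
    Tables τ b (a + b) (insert (key τ a b b) S) (Function.update rep (key τ a b b) (a + 1)) cnt'
      list' pred' succ' := by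
  refine ⟨fun K hKb hKS => ?_, fun K hKS => ?_, hcnt, hlist⟩
  · rw [Finset.mem_insert, not_or] at hKS
    rw [Function.update_of_ne hKS.1]
    exact h.rep_eq K hKb hKS.2
  · rcases Finset.mem_insert.1 hKS with rfl | hKS
    · exact ⟨a, Function.update_self .., hba, le_rfl, rfl, hnew⟩
    · obtain ⟨c, h1, h2, h3, h4, h5⟩ := h.rep K hKS
      refine ⟨c, ?_, h2, by omega, h4, fun j hj => ?_⟩
      · rw [Function.update_of_ne (by rintro rfl; exact hK hKS)]; exact h1
      · rw [(hold (c + j) (by omega)).1, (hold (c + j) (by omega)).2]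
        exact h5 j hj

/-- Amortisation: a known pattern costs a search and a copy, both within `O(D * b)` since `log |S|`
is. The time spent on a new pattern is charged to the growth of `S` by one element. -/
theorem wp_sortBlock {m : State} {a b : ℕ} {S : Finset ℕ} (h1 : m.reg 1 = 1) (h2 : m.reg 2 = 0)
    (h50 : m.reg 50 = b) (h51 : m.reg 51 = b ^ b) (h60 : m.reg 60 = a) (h61 : m.reg 61 = a + b)
    (hb : 0 < b) (hba : b ∣ a) (hab : a + b ≤ n) (hw : 2 * n + 2 * b ^ b + 3 < 2 ^ w)
    (h : BlocksInv τ b a S m) :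
    wp τ w sortBlock m fun t m' => ∃ S', BlocksInv τ b (a + b) S' m' ∧
      t + learnTime b * S.card ≤ 2400 * (twinWidth τ + 1) * b + learnTime b * S'.card := by
  have hw0 : w ≠ 0 := by rintro rfl; simp at hw
  have hT := h.tables
  have hlog : Nat.log 2 (2 * S.card) ≤ 96 * ((twinWidth τ + 1) * b) + 1 := by
    have hc := hT.card_le (by omega)
    refine (Nat.log_mono_right (Nat.mul_le_mul_left 2 hc)).trans ?_
    rw [← pow_succ', Nat.log_pow (by norm_num), mul_assoc]
  have hDb : b ≤ (twinWidth τ + 1) * b := Nat.le_mul_of_pos_left _ (Nat.succ_pos _)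
  have hDb' : 2400 * (twinWidth τ + 1) * b = 2400 * ((twinWidth τ + 1) * b) := by ring
  simp only [sortBlock, wp]
  refine wp_call (wp_search h1 h50 h51 h60 hab hT hw) ?_
  rintro t₁ m₁ ⟨ht₁, hres⟩ f₁
  have e1 : m₁.reg 1 = 1 := (f₁.reg 1 (by simp [search, searchStep])).trans h1
  have e2 : m₁.reg 2 = 0 := (f₁.reg 2 (by simp [search, searchStep])).trans h2
  have e50 : m₁.reg 50 = b := (f₁.reg 50 (by simp [search, searchStep])).trans h50
  have e51 : m₁.reg 51 = b ^ b := (f₁.reg 51 (by simp [search, searchStep])).trans h51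
  have e60 : m₁.reg 60 = a := (f₁.reg 60 (by simp [search, searchStep])).trans h60
  have e61 : m₁.reg 61 = a + b := (f₁.reg 61 (by simp [search, searchStep])).trans h61
  have eA : m₁.arr = m.arr := funext fun A => f₁.arr A (by simp [search, searchStep])
  refine ⟨fun hc => ?_, fun hc => ?_⟩
  · simp only [holds, e1] at hc
    obtain ⟨-, g65, hKS⟩ : m₁.reg 69 = 1 ∧ m₁.reg 65 = key τ a b b ∧ key τ a b b ∈ S := by
      rcases hres with h | h
      · exact h
      · omega
    obtain ⟨a', k1, k2, k3, k4, -⟩ := hT.rep _ hKS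
    obtain ⟨k5, k6⟩ := h.sorted a' k2 k3
    refine wp_call (wp_copyPattern e1 e60 e61 (by rw [eA, g65, k1]) (congrFun eA 0) k3 hab
      (by omega) k4.symm k5 k6) ?_
    rintro t₂ m₂ ⟨ht₂, r1, r2, r3⟩ f₂
    have eA' : ∀ A, A ≠ 0 → m₂.arr A = m.arr A := fun A hA =>
      (f₂.arr A (by simp [copyPattern, hA])).trans (congrFun eA A)
    refine ⟨S, ⟨?_, h.sorted_succ hba r1 r2 fun p hp => r3 p (Or.inl hp)⟩, by omega⟩
    rw [eA' 5 (by decide), eA' 6 (by decide), eA' 7 (by decide), eA' 8 (by decide),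
      eA' 9 (by decide)]
    exact hT.mono (Nat.le_add_right _ _)
  · simp only [holds, e1] at hc
    have hKS : key τ a b b ∉ S := by
      rcases hres with h | h
      · exact absurd h.1 hc
      · exact h.2
    refine wp_call (wp_sortRange (lo := a) (hi := a + b) (by simp [e1]) (by simp [e60])
      (by simp [e61]) (Nat.le_add_right _ _) hab (by omega)) ?_
    rintro t₂ m₂ ⟨ht₂, r1, r2, r3⟩ f₂
    have hwr : ∀ r, 11 < r ∧ r < 80 ∧ 25 < r ∨ r < 10 → m₂.reg r = m₁.reg r := by
      intro r hr
      rw [f₂.reg r]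
      · simp [show r ≠ 10 by omega, show r ≠ 11 by omega]
      · intro hr'
        simp only [sortRange, Prog.wr, List.mem_append, List.mem_singleton, List.not_mem_nil] at hr'
        by_cases hm : r ∈ (mergeSort 0).wr
        · have := mergeSort_wr 0 r hm
          omega
        · simp only [hm, or_false, false_or] at hr'
          omega
    have eA₂ : ∀ A, 1 < A → m₂.arr A = m.arr A := by
      intro A hA
      rw [f₂.arr A, State.arr_set, State.arr_set, eA]
      intro hA'
      simp only [sortRange, Prog.wa, List.mem_append, List.mem_singleton, List.not_mem_nil] at hA'
      by_cases hm : A ∈ (mergeSort 0).wa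
      · have := mergeSort_wa 0 A hm
        omega
      · simp only [hm, or_false, false_or] at hA'
        omega
    refine wp_call (wp_learnPattern ((hwr 1 (by omega)).trans e1) ((hwr 50 (by omega)).trans e50)
      ((hwr 60 (by omega)).trans e60) hab hw) ?_
    rintro t₃ m₃ ⟨ht₃, q1, q2, q3⟩ f₃
    have e1₃ : m₃.reg 1 = 1 := (f₃.reg 1 (by simp [learnPattern, learnScan])).trans
      ((hwr 1 (by omega)).trans e1)
    have e2₃ : m₃.reg 2 = 0 := (f₃.reg 2 (by simp [learnPattern, learnScan])).trans
      ((hwr 2 (by omega)).trans e2)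
    have e51₃ : m₃.reg 51 = b ^ b := (f₃.reg 51 (by simp [learnPattern, learnScan])).trans
      ((hwr 51 (by omega)).trans e51)
    have e0₃ : m₃.arr 0 = m₂.arr 0 := f₃.arr 0 (by simp [learnPattern, learnScan])
    rw [eA₂ 5 (by decide)] at q1
    rw [eA₂ 8 (by decide), eA₂ 9 (by decide)] at q3
    refine wp_call (wp_rebuildTables (S := insert (key τ a b b) S) e1₃ e2₃ e51₃ ?_ ?_ (by omega)) ?_
    · intro K hK
      rcases Finset.mem_insert.1 hK with rfl | hK
      · exact key_lt τ a b b le_rfl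
      · exact hT.lt hK
    · intro K hK
      rw [q1, Finset.mem_insert]
      by_cases hKK : K = key τ a b b
      · subst hKK
        simp
      · rw [Function.update_of_ne hKK]
        simp only [hKK, false_or]
        refine ⟨fun h0 hKS => ?_, hT.rep_eq K hK⟩
        obtain ⟨a', h', -⟩ := hT.rep K hKS
        omega
    rintro t₄ m₄ ⟨ht₄, p1, p2⟩ f₄
    have e0₄ : m₄.arr 0 = m₂.arr 0 := (f₄.arr 0 (by simp [rebuildTables])).trans e0₃
    refine ⟨insert (key τ a b b) S, ⟨?_, h.sorted_succ hba (by rw [e0₄]; exact r1)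
      (by rw [e0₄]; exact r2) fun p hp => ?_⟩, ?_⟩
    · rw [f₄.arr 5 (by simp [rebuildTables]), f₄.arr 8 (by simp [rebuildTables]),
        f₄.arr 9 (by simp [rebuildTables]), q1]
      exact hT.insert hba q2 q3 p1 p2 hKS
    · rw [e0₄, r3 p (Or.inl hp), State.arr_set, State.arr_set, eA]
    · rw [Nat.add_sub_cancel_left] at ht₂
      have hL : learnTime b = 3 * b + 2 + (80 * b + 13) * (Nat.log 2 b + 1) +
        (b * (10 * b + 12) + 5) + (7 * b ^ b + 4) := rfl
      rw [Finset.card_insert_of_notMem hKS, hDb', Nat.mul_succ]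
      omega

/-- Sort all blocks of the length in register 50. -/
def sortBlocks : Prog :=
  .const 60 0 ;; .move 61 50 ;; .add 62 0 1 ;;
  .loop (.lt 61 62) (sortBlock ;; .move 60 61 ;; .add 61 61 50) ;;
  .move 10 60 ;; .move 11 0 ;; sortRange

theorem sortBlock_wr : ∀ r ∈ sortBlock.wr, 10 ≤ r ∧ (r ≤ 25 ∨ 62 < r ∧ r ≤ 92) := by
  intro r hr
  simp only [sortBlock, search, searchStep, copyPattern, sortRange, learnPattern, learnScan,
    rebuildTables, Prog.wr, List.mem_append, List.mem_singleton, List.not_mem_nil] at hr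
  by_cases hm : r ∈ (mergeSort 0).wr
  · have := mergeSort_wr 0 r hm
    omega
  · simp only [hm, or_false, false_or] at hr
    omega

/-- The dictionary can grow at most `b ^ b` times. One further `learnTime b` covers the incomplete
last block, which is sorted from scratch. -/
theorem wp_sortBlocks {m : State} {b : ℕ} (h0 : m.reg 0 = n) (h1 : m.reg 1 = 1)
    (h2 : m.reg 2 = 0) (h50 : m.reg 50 = b) (h51 : m.reg 51 = b ^ b) (hb : 0 < b)
    (h5 : ∀ K, m.arr 5 K = 0) (h6 : ∀ K, m.arr 6 K = 0)
    (hw : 2 * n + b + 2 * b ^ b + 3 < 2 ^ w) :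
    wp τ w sortBlocks m fun t m' =>
      t ≤ 2410 * (twinWidth τ + 1) * n + learnTime b * (b ^ b + 1) + 8 ∧
      SortedBlocks τ (m'.arr 0) b := by
  have hw0 : w ≠ 0 := by rintro rfl; simp at hw
  have hwr : ∀ r, (r < 10 ∨ 25 < r ∧ r < 60 ∨ r = 62) →
      r ∉ (sortBlock ;; Prog.move 60 61 ;; Prog.add 61 61 50).wr := by
    intro r hr hr'
    simp only [Prog.wr, List.mem_append, List.mem_singleton] at hr'
    by_cases h : r ∈ sortBlock.wr
    · have := sortBlock_wr r h
      omega
    · simp only [h, false_or] at hr'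
      omega
  simp only [sortBlocks, wp]
  refine ⟨by omega, by simp [h0, h1]; omega, ?_⟩
  refine wp_call (wp_while (fun m' => b ∣ m'.reg 60 ∧ m'.reg 60 ≤ n ∧ m'.reg 61 = m'.reg 60 + b ∧
    ∃ S, BlocksInv τ b (m'.reg 60) S m')
    -- The second summand is the learning time still to be spent: keys without a representative,
    -- that is, zero cells of array 5.
    (fun m' => 2410 * (twinWidth τ + 1) * (n - m'.reg 60) + learnTime b *
      (b ^ b - ((Finset.range (b ^ b)).filter fun K => m'.arr 5 K ≠ 0).card)) ?_ ?_) ?_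
  · simp only [State.reg_set]
    refine ⟨by simp, by simp, by simp [h50], ∅, ⟨fun K _ _ => h5 K, by simp, fun x _ => ?_, by simp⟩,
      fun c _ hc => ?_⟩
    · rw [State.arr_set, State.arr_set, State.arr_set, h6]; simp [below]
    · simp at hc; omega
  · rintro m' hf ⟨g1, g2, g3, S, hS⟩ hc
    have e0 : m'.reg 0 = n := (hf.reg 0 (hwr 0 (by omega))).trans (by simp [h0])
    have e1 : m'.reg 1 = 1 := (hf.reg 1 (hwr 1 (by omega))).trans (by simp [h1])
    have e2 : m'.reg 2 = 0 := (hf.reg 2 (hwr 2 (by omega))).trans (by simp [h2])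
    have e50 : m'.reg 50 = b := (hf.reg 50 (hwr 50 (by omega))).trans (by simp [h50])
    have e51 : m'.reg 51 = b ^ b := (hf.reg 51 (hwr 51 (by omega))).trans (by simp [h51])
    have e62 : m'.reg 62 = n + 1 := (hf.reg 62 (hwr 62 (by omega))).trans (by simp [h0, h1])
    simp only [holds, e62, g3] at hc
    obtain ⟨a, ha⟩ : ∃ a, m'.reg 60 = a := ⟨_, rfl⟩
    rw [ha] at g1 g2 g3 hc hS
    simp only [wp]
    refine wp_call (wp_sortBlock e1 e2 e50 e51 ha g3 hb g1 (by omega) (by omega) hS) ?_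
    rintro t m'' ⟨S', hS', ht⟩ f
    have k61 : m''.reg 61 = a + b := (f.reg 61 fun h => by
      have := sortBlock_wr 61 h; omega).trans g3
    have k50 : m''.reg 50 = b := (f.reg 50 fun h => by
      have := sortBlock_wr 50 h; omega).trans e50
    simp [k61, k50]
    refine ⟨by omega, ⟨g1, by omega, S', hS'.tables, hS'.sorted⟩, ?_⟩
    have q1 := hS.tables.filter_eq
    have q2 := hS'.tables.filter_eq
    have q3 := hS.tables.card_le_pow
    have q4 := hS'.tables.card_le_pow
    simp only [ne_eq] at q1 q2
    rw [q1, q2, ha]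
    have q5 : learnTime b * S.card + learnTime b * (b ^ b - S.card) = learnTime b * b ^ b := by
      rw [← mul_add, Nat.add_sub_of_le q3]
    have q6 : learnTime b * S'.card + learnTime b * (b ^ b - S'.card) = learnTime b * b ^ b := by
      rw [← mul_add, Nat.add_sub_of_le q4]
    have q7 : 2410 * (twinWidth τ + 1) * (n - a) = 2400 * (twinWidth τ + 1) * b +
        10 * ((twinWidth τ + 1) * b) + 2410 * (twinWidth τ + 1) * (n - (a + b)) := by
      rw [show n - a = b + (n - (a + b)) by omega]; ring
    have q8 : 1 ≤ (twinWidth τ + 1) * b := Nat.mul_pos (Nat.succ_pos _) hb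
    omega
  · rintro t₁ m₁ ⟨⟨g1, g2, g3, S, hS⟩, hc, ht₁⟩ f₁
    have e0 : m₁.reg 0 = n := (f₁.reg 0 (hwr 0 (by omega))).trans (by simp [h0])
    have e1 : m₁.reg 1 = 1 := (f₁.reg 1 (hwr 1 (by omega))).trans (by simp [h1])
    have e62 : m₁.reg 62 = n + 1 := (f₁.reg 62 (hwr 62 (by omega))).trans (by simp [h0, h1])
    simp only [holds, e62, g3] at hc
    obtain ⟨a, ha⟩ : ∃ a, m₁.reg 60 = a := ⟨_, rfl⟩
    rw [ha] at g1 g2 g3 hc hS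
    refine wp_mono (wp_sortRange (lo := a) (hi := n) (by simp [e1]) (by simp [ha]) (by simp [e0])
      g2 le_rfl (by omega)) ?_
    rintro t₂ m₂ ⟨ht₂, r1, r2, r3⟩
    simp only [State.arr_set] at r3
    refine ⟨?_, fun c hbc hcn => ?_⟩
    · simp [h5] at ht₁
      have q1 : learnTime b * (b ^ b + 1) = learnTime b * b ^ b + learnTime b := by ring
      have q2 : (80 * (n - a) + 13) * (Nat.log 2 (n - a) + 1) ≤
          (80 * b + 13) * (Nat.log 2 b + 1) := by
        gcongr <;> omega
      have q3 : 3 * b + 2 + (80 * b + 13) * (Nat.log 2 b + 1) ≤ learnTime b := by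
        unfold learnTime; omega
      omega
    · rcases lt_or_ge c a with hlt | hge
      · have hle : c + b ≤ a := by
          obtain ⟨x, rfl⟩ := hbc
          obtain ⟨y, rfl⟩ := g1
          rw [← Nat.mul_succ]
          exact Nat.mul_le_mul_left _ (lt_of_mul_lt_mul_left hlt (Nat.zero_le _))
        obtain ⟨k1, k2⟩ := hS.sorted c hbc hle
        rw [min_eq_left (by omega)]
        refine ⟨(seg_congr fun p _ hp => r3 p (Or.inl (by omega))).trans k1,
          fun p q hp hpq hq => ?_⟩
        rw [r3 p (Or.inl (by omega)), r3 q (Or.inl (by omega))]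
        exact k2 p q hp hpq hq
      · have hca : c = a := by
          obtain ⟨x, rfl⟩ := hbc
          obtain ⟨y, rfl⟩ := g1
          have h1 : y ≤ x := le_of_mul_le_mul_left hge hb
          have h2 : b * x < b * (y + 1) := by rw [mul_add, mul_one]; omega
          have h3 : x < y + 1 := lt_of_mul_lt_mul_left h2 (Nat.zero_le _)
          rw [show x = y by omega]
        subst hca
        rw [min_eq_right (by omega)]
        exact ⟨r1, r2⟩

end CompRAM

/-! ### Choosing the lengths of the blocks -/

namespace CompRAM

open TwinWidth (val val_injective val_of_lt twinWidth)

variable {n : ℕ} {τ : Equiv.Perm (Fin n)} {w : ℕ}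

/-- `s` is the least power of two with `m ≤ 2 ^ s`. -/
structure IsLogPow (m s : ℕ) : Prop where
  le : m ≤ 2 ^ s
  pow : ∃ k, s = 2 ^ k
  lt : s = 1 ∨ 2 ^ (s / 2) < m

theorem IsLogPow.pos {m s : ℕ} (h : IsLogPow m s) : 0 < s := by
  obtain ⟨k, rfl⟩ := h.pow
  exact Nat.pow_pos (by norm_num)

theorem IsLogPow.cases {m s : ℕ} (h : IsLogPow m s) :
    s = 1 ∨ ∃ y, s = 2 * y ∧ (∃ k, y = 2 ^ k) ∧ 2 ^ y < m := by
  rcases h.lt with h1 | h1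
  · exact Or.inl h1
  · obtain ⟨k, rfl⟩ := h.pow
    rcases k with _ | k
    · exact Or.inl rfl
    · refine Or.inr ⟨2 ^ k, pow_succ' 2 k, ⟨k, rfl⟩, ?_⟩
      rwa [pow_succ', Nat.mul_div_cancel_left _ (by norm_num)] at h1

theorem sq_le_two_pow {y : ℕ} (hy : 4 ≤ y) : y * y ≤ 2 ^ y := by
  induction y, hy using Nat.le_induction with
  | base => norm_num
  | succ y hy ih => rw [pow_succ]; nlinarith

/-- A power of two of this kind is less than twice the logarithm, up to the case `s = 1`, and
squares of logarithms are dominated by the number itself. -/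
theorem IsLogPow.sq_le {m s : ℕ} (h : IsLogPow m s) : s * s ≤ 8 * (m + 1) := by
  rcases h.cases with rfl | ⟨y, rfl, -, hy⟩
  · omega
  · rcases lt_or_ge y 4 with h4 | h4
    · interval_cases y <;> omega
    · have := sq_le_two_pow h4
      nlinarith

/-- Both numbers are powers of two, so it suffices that the iterated logarithm does not exceed the
first one. Divisibility is what makes the longer blocks consist of whole shorter ones. -/
theorem IsLogPow.dvd {m s r : ℕ} (h : IsLogPow m s) (hr : IsLogPow (s * s) r) : r ∣ s := by
  obtain ⟨i, rfl⟩ := h.pow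
  rcases hr.cases with rfl | ⟨y, rfl, ⟨k, rfl⟩, hy⟩
  · exact one_dvd _
  · rw [← pow_succ']
    refine pow_dvd_pow 2 ?_
    by_contra hlt
    have h1 : 2 ^ i ≤ 2 ^ k := Nat.pow_le_pow_right (by norm_num) (by omega)
    have h2 : 2 ^ (2 ^ k) < 2 ^ k * 2 ^ k := hy.trans_le (Nat.mul_le_mul h1 h1)
    rcases k with _ | _ | k
    · norm_num at h2
    · norm_num at h2
    · have h4 : 4 ≤ 2 ^ (k + 1 + 1) := by
        rw [pow_succ, pow_succ]
        have := Nat.one_le_two_pow (n := k)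
        omega
      have := sq_le_two_pow h4
      omega

theorem pow_six_le_two_pow {y : ℕ} (hy : 120 ≤ y) : 1764 * y ^ 6 ≤ 2 ^ y := by
  have h1 : y ≤ 2 ^ (3 + y / 8) := by
    have : y / 8 < 2 ^ (y / 8) := Nat.lt_two_pow_self
    rw [pow_add]
    omega
  calc 1764 * y ^ 6 ≤ 2 ^ 11 * (2 ^ (3 + y / 8)) ^ 6 :=
        Nat.mul_le_mul (by norm_num) (Nat.pow_le_pow_left h1 6)
    _ = 2 ^ (11 + (3 + y / 8) * 6) := by rw [← pow_mul, ← pow_add]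
    _ ≤ 2 ^ y := Nat.pow_le_pow_right (by norm_num) (by omega)

/-- Since `r` is about the logarithm of `s * s`, any fixed power of `r` is far smaller than `s`. The
logarithm of the left side is `O(r ^ 3)`, hence below `s / 2`, and `2 ^ (s / 2) < m` when `s ≠ 1`.
The finitely many small `r` are absorbed by the constant. -/
theorem exists_forall_pow_le : ∃ C, ∀ m s r : ℕ, IsLogPow m s → IsLogPow (s * s) r →
    (r * r) ^ (2 * (r * r) + 2) ≤ C * (m + 1) := by
  refine ⟨(Finset.range 240).sup (fun r => (r * r) ^ (2 * (r * r) + 2)) + 1,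
    fun m s r hs hr => ?_⟩
  rw [add_mul, one_mul]
  rcases lt_or_ge r 240 with hlt | hge
  · have h1 := Finset.le_sup (f := fun r => (r * r) ^ (2 * (r * r) + 2)) (Finset.mem_range.2 hlt)
    exact (h1.trans (Nat.le_mul_of_pos_right _ (Nat.succ_pos m))).trans (Nat.le_add_right _ _)
  · refine le_trans ?_ (Nat.le_add_left _ _)
    rcases hr.cases with rfl | ⟨y, rfl, -, hy⟩
    · omega
    have h6 := pow_six_le_two_pow (show 120 ≤ y by omega)
    -- Here `1764 = 42 ^ 2`. With `s = 2 * z` this gives `21 * y ^ 3 < z`, which exceeds the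
    -- exponent `16 * y ^ 3 + 4 * y` reached below.
    have hs1 : 42 * y ^ 3 < s := by
      by_contra hle
      have := Nat.mul_le_mul (not_lt.1 hle) (not_lt.1 hle)
      have h7 : 42 * y ^ 3 * (42 * y ^ 3) = 1764 * y ^ 6 := by ring
      omega
    have hy3 : 0 < y ^ 3 := Nat.pow_pos (by omega)
    rcases hs.cases with rfl | ⟨z, rfl, -, hz⟩
    · omega
    have h2y : 2 * y ≤ 2 ^ y := by
      have := sq_le_two_pow (show 4 ≤ y by omega)
      nlinarith
    have hy2 : 1 ≤ y ^ 2 := Nat.pow_pos (by omega)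
    calc (2 * y * (2 * y)) ^ (2 * (2 * y * (2 * y)) + 2)
        ≤ (2 ^ y * 2 ^ y) ^ (2 * (2 * y * (2 * y)) + 2) :=
          Nat.pow_le_pow_left (Nat.mul_le_mul h2y h2y) _
      _ = 2 ^ (2 * y * (2 * (2 * y * (2 * y)) + 2)) := by rw [← pow_add, ← pow_mul, two_mul y]
      _ ≤ 2 ^ z := Nat.pow_le_pow_right (by norm_num) (by nlinarith)
      _ ≤ m + 1 := by omega

/-- Both the rebuilding of the tables and the number of patterns contribute a factor `b ^ b`;
everything else is within a constant times `b ^ 2`. -/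
theorem learnTime_mul_le {b : ℕ} (hb : 0 < b) :
    learnTime b * (b ^ b + 1) ≤ 500 * b ^ (2 * b + 2) := by
  have h1 : Nat.log 2 b + 1 ≤ 2 * b := by
    have := Nat.log_le_self 2 b
    omega
  have h2 : (80 * b + 13) * (Nat.log 2 b + 1) ≤ 186 * b ^ 2 :=
    (Nat.mul_le_mul (show 80 * b + 13 ≤ 93 * b by omega) h1).trans_eq (by ring)
  have h3 : 1 ≤ b ^ b := Nat.pow_pos hb
  have h4 : b ≤ b ^ 2 := Nat.le_self_pow (by norm_num) b
  have h5 : b ^ 2 ≤ b ^ 2 * b ^ b := Nat.le_mul_of_pos_right _ h3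
  have h6 : b ^ b ≤ b ^ 2 * b ^ b := Nat.le_mul_of_pos_left _ (by omega)
  have h7 : b * (10 * b + 12) = 10 * b ^ 2 + 12 * b := by ring
  have h8 : learnTime b ≤ 229 * (b ^ 2 * b ^ b) := by
    unfold learnTime
    omega
  calc learnTime b * (b ^ b + 1) ≤ 229 * (b ^ 2 * b ^ b) * (2 * b ^ b) :=
        Nat.mul_le_mul h8 (by omega)
    _ = 458 * b ^ (2 * b + 2) := by rw [pow_add, two_mul b, pow_add]; ring
    _ ≤ _ := Nat.mul_le_mul_right _ (by norm_num)

/-- Compute the least power of two whose exponential is at least register 95, in register 94. -/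
def logPow : Prog :=
  .const 93 2 ;; .const 94 1 ;; .loop (.lt 93 95) (.mul 93 93 93 ;; .add 94 94 94)

theorem wp_logPow {m : State} {x : ℕ} (h95 : m.reg 95 = x) (hw : x * x + 2 * x + 3 < 2 ^ w) :
    wp τ w logPow m fun t m' => t ≤ 3 * x + 3 ∧ IsLogPow x (m'.reg 94) := by
  simp only [logPow, wp]
  refine ⟨by omega, by omega, ?_⟩
  refine wp_call (wp_while (fun m' => m'.reg 93 = 2 ^ m'.reg 94 ∧ (∃ k, m'.reg 94 = 2 ^ k) ∧
    -- The exponent doubles only after the test showed that the present power is too small. This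
    -- keeps the exponent least among powers of two.
    (m'.reg 94 = 1 ∨ 2 ^ (m'.reg 94 / 2) < x)) (fun m' => 3 * (x - m'.reg 93)) ?_ ?_) ?_
  · simp
    exact ⟨0, rfl⟩
  · rintro m' hf ⟨g1, ⟨k, g2⟩, g3⟩ hc
    have e95 : m'.reg 95 = x := (hf.reg 95 (by simp)).trans (by simp [h95])
    simp only [holds, e95] at hc
    have h1 : m'.reg 94 < 2 ^ m'.reg 94 := Nat.lt_two_pow_self
    have h2 : m'.reg 93 * m'.reg 93 ≤ x * x := Nat.mul_le_mul hc.le hc.le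
    have h3 : 0 < m'.reg 94 := by rw [g2]; exact Nat.pow_pos (by norm_num)
    have h4 : m'.reg 93 + 1 ≤ m'.reg 93 * m'.reg 93 := by nlinarith
    simp [wp]
    refine ⟨by omega, by omega, ⟨?_, ⟨k + 1, ?_⟩, Or.inr ?_⟩, by omega⟩
    · rw [pow_add, ← g1]
    · rw [g2, pow_succ]; ring
    · rw [show (m'.reg 94 + m'.reg 94) / 2 = m'.reg 94 by omega, ← g1]; exact hc
  · rintro t m' ⟨⟨g1, g2, g3⟩, hc, ht⟩ hf
    have e95 : m'.reg 95 = x := (hf.reg 95 (by simp)).trans (by simp [h95])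
    simp only [holds, e95, not_lt, g1] at hc
    simp at ht
    exact ⟨by omega, hc, g2, g3⟩

/-- Raise register 50 to its own power, in register 51. -/
def selfPow : Prog :=
  .const 51 1 ;; .const 96 0 ;; .loop (.lt 96 50) (.mul 51 51 50 ;; .add 96 96 1)

theorem wp_selfPow {m : State} {b : ℕ} (h1 : m.reg 1 = 1) (h50 : m.reg 50 = b) (hb : 0 < b)
    (hw : b + b ^ b + 3 < 2 ^ w) :
    wp τ w selfPow m fun t m' => t ≤ 3 * b + 3 ∧ m'.reg 51 = b ^ b := by
  simp only [selfPow, wp]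
  refine ⟨by omega, by omega, ?_⟩
  refine wp_call (wp_for (i := 96) (e := 50) b (fun k m' => m'.reg 51 = b ^ k) (fun _ => 1)
    (by decide) (by decide) (by simp) (by simp) (by simp) (by simp [h1]) (by simp [h50]) (by simp)
    (by omega) (by simp) ?_) ?_
  · rintro k m' hf - hk h96 hI
    have e50 : m'.reg 50 = b := (hf.reg 50 (by simp)).trans (by simp [h50])
    have := Nat.pow_le_pow_right hb (show k + 1 ≤ b from hk)
    simp [wp, e50, hI, ← pow_succ]
    omega
  · rintro t m' ⟨ht, -, h⟩ -
    simp at ht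
    exact ⟨by omega, h⟩

end CompRAM

/-! ### The complete algorithm -/

namespace CompRAM

open TwinWidth (val val_injective val_of_lt twinWidth)

variable {n : ℕ} {τ : Equiv.Perm (Fin n)} {w : ℕ}

/-- Choose the lengths of the blocks: `b` in register 50 and `s₁ * s₁` in register 98, where
`b = s₂ * s₂` for the value `s₂` of register 99, and `s₁` is the value of register 97. -/
def chooseLengths : Prog :=
  .const 1 1 ;; .const 2 0 ;; .move 95 0 ;; logPow ;; .move 97 94 ;; .mul 98 97 97 ;;
  .move 95 98 ;; logPow ;; .move 99 94 ;; .mul 50 99 99 ;; selfPow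

theorem wp_chooseLengths {m : State} {C : ℕ} (h0 : m.reg 0 = n)
    (hC : ∀ m s r : ℕ, IsLogPow m s → IsLogPow (s * s) r →
      (r * r) ^ (2 * (r * r) + 2) ≤ C * (m + 1))
    (hw : (C + 500) * ((n + 1) * (n + 1)) < 2 ^ w) :
    wp τ w chooseLengths m fun t m' => t ≤ 80 * (n + 1) ∧ m'.reg 0 = n ∧ m'.reg 1 = 1 ∧
      m'.reg 2 = 0 ∧ ∃ s r, IsLogPow n s ∧ IsLogPow (s * s) r ∧ m'.reg 97 = s ∧
        m'.reg 98 = s * s ∧ m'.reg 99 = r ∧ m'.reg 50 = r * r ∧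
        m'.reg 51 = (r * r) ^ (r * r) ∧ m'.arr = m.arr := by
  have hN : n + 1 ≤ (n + 1) * (n + 1) := Nat.le_mul_of_pos_left _ (Nat.succ_pos n)
  have hw1 : C * (n + 1) + 500 * ((n + 1) * (n + 1)) < 2 ^ w := by nlinarith
  have hn2 : n * n + 2 * n + 1 = (n + 1) * (n + 1) := by ring
  have hw0 : w ≠ 0 := by rintro rfl; simp at hw1
  simp only [chooseLengths, wp]
  refine ⟨by omega, by omega, ?_⟩
  refine wp_call (wp_logPow (x := n) (by simp [h0]) (by omega)) ?_
  rintro t₁ m₁ ⟨ht₁, hs⟩ f₁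
  obtain ⟨s, hsr⟩ : ∃ s, m₁.reg 94 = s := ⟨_, rfl⟩
  rw [hsr] at hs
  have hsq := hs.sq_le
  have hsq2 : s * s * (s * s) ≤ 64 * ((n + 1) * (n + 1)) :=
    (Nat.mul_le_mul hsq hsq).trans_eq (by ring)
  have k0 : m₁.reg 0 = n := (f₁.reg 0 (by simp [logPow])).trans (by simp [h0])
  have k1 : m₁.reg 1 = 1 := (f₁.reg 1 (by simp [logPow])).trans (by simp)
  have k2 : m₁.reg 2 = 0 := (f₁.reg 2 (by simp [logPow])).trans (by simp)
  have kA : m₁.arr = m.arr := funext fun A => (f₁.arr A (by simp [logPow])).trans (by simp)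
  refine ⟨by simp [hsr]; omega, ?_⟩
  refine wp_call (wp_logPow (x := s * s) (by simp [hsr]) (by omega)) ?_
  rintro t₂ m₂ ⟨ht₂, hr⟩ f₂
  obtain ⟨r, hrr⟩ : ∃ r, m₂.reg 94 = r := ⟨_, rfl⟩
  rw [hrr] at hr
  have hrs : r * r ≤ s * s := by
    have := Nat.le_of_dvd hs.pos (hs.dvd hr)
    exact Nat.mul_le_mul this this
  have hpos : 0 < r * r := Nat.mul_pos hr.pos hr.pos
  have hpow : (r * r) ^ (r * r) ≤ C * (n + 1) :=
    (Nat.pow_le_pow_right hpos (by omega)).trans (hC n s r hs hr)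
  have l0 : m₂.reg 0 = n := (f₂.reg 0 (by simp [logPow])).trans (by simp [k0])
  have l1 : m₂.reg 1 = 1 := (f₂.reg 1 (by simp [logPow])).trans (by simp [k1])
  have l2 : m₂.reg 2 = 0 := (f₂.reg 2 (by simp [logPow])).trans (by simp [k2])
  have l97 : m₂.reg 97 = s := (f₂.reg 97 (by simp [logPow])).trans (by simp [hsr])
  have l98 : m₂.reg 98 = s * s := (f₂.reg 98 (by simp [logPow])).trans (by simp [hsr])
  have lA : m₂.arr = m.arr := funext fun A => (f₂.arr A (by simp [logPow])).trans (by simp [kA])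
  refine ⟨by simp [hrr]; omega, ?_⟩
  refine wp_call (wp_selfPow (b := r * r) (by simp [l1]) (by simp [hrr]) hpos (by omega)) ?_
  rintro t₃ m₃ ⟨ht₃, h51⟩ f₃
  refine ⟨by omega, (f₃.reg 0 (by simp [selfPow])).trans (by simp [l0]),
    (f₃.reg 1 (by simp [selfPow])).trans (by simp [l1]),
    (f₃.reg 2 (by simp [selfPow])).trans (by simp [l2]), s, r, hs, hr,
    (f₃.reg 97 (by simp [selfPow])).trans (by simp [l97]),
    (f₃.reg 98 (by simp [selfPow])).trans (by simp [l98]),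
    (f₃.reg 99 (by simp [selfPow])).trans (by simp [hrr]),
    (f₃.reg 50 (by simp [selfPow])).trans (by simp [hrr]), h51,
    funext fun A => (f₃.arr A (by simp [selfPow])).trans (by simp [lA])⟩

theorem sortBlocks_wr : ∀ r ∈ sortBlocks.wr, 10 ≤ r ∧ (r ≤ 25 ∨ 60 ≤ r ∧ r ≤ 92) := by
  intro r hr
  by_cases h : r ∈ sortBlock.wr
  · have := sortBlock_wr r h
    omega
  by_cases hm : r ∈ (mergeSort 0).wr
  · have := mergeSort_wr 0 r hm
    omega
  simp only [sortBlocks, sortRange, Prog.wr, List.mem_append, List.mem_singleton, List.not_mem_nil,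
    h, hm, or_false, false_or] at hr
  omega

theorem mergeLevel_wr : ∀ r ∈ mergeLevel.wr, 10 ≤ r ∧ r < 50 := by
  intro r hr
  by_cases h : r ∈ mergeSegment.wr
  · have := mergeSegment_wr r h
    omega
  simp only [mergeLevel, Prog.wr, List.mem_append, List.mem_singleton, List.not_mem_nil,
    h, false_or] at hr
  omega

/-- Sort the input. -/
def sortInput : Prog :=
  chooseLengths ;; sortBlocks ;;
  .move 32 99 ;; .move 33 50 ;; .move 34 98 ;; mergeLevel ;;
  .move 32 97 ;; .move 33 98 ;; .div 34 0 98 ;; .add 34 34 1 ;; .mul 34 34 98 ;; mergeLevel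

theorem wp_sortInput {m : State} {C : ℕ} (h0 : m.reg 0 = n) (h5 : ∀ K, m.arr 5 K = 0)
    (h6 : ∀ K, m.arr 6 K = 0)
    (hC : ∀ m s r : ℕ, IsLogPow m s → IsLogPow (s * s) r →
      (r * r) ^ (2 * (r * r) + 2) ≤ C * (m + 1))
    (hw : (2 * C + 500) * ((n + 1) * (n + 1)) < 2 ^ w) :
    wp τ w sortInput m fun t m' =>
      t ≤ (500 * C + 300000) * (twinWidth τ + 1) * (n + 1) ∧
      seg (m'.arr 0) 0 n = seg id 0 n ∧ Asc τ (m'.arr 0) 0 n := by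
  have hN : n + 1 ≤ (n + 1) * (n + 1) := Nat.le_mul_of_pos_left _ (Nat.succ_pos n)
  have hw1 : 2 * (C * (n + 1)) + 500 * ((n + 1) * (n + 1)) < 2 ^ w := by nlinarith
  simp only [sortInput, wp]
  refine wp_call (wp_chooseLengths h0 hC ((Nat.mul_le_mul_right _ (by omega)).trans_lt hw)) ?_
  rintro t₁ m₁ ⟨ht₁, k0, k1, k2, s, r, hs, hr, k97, k98, k99, k50, k51, kA⟩ -
  have hsq := hs.sq_le
  have hdvd : r * r ∣ s * s := mul_dvd_mul (hs.dvd hr) (hs.dvd hr)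
  have hspos : 0 < s * s := Nat.mul_pos hs.pos hs.pos
  have hrs : r * r ≤ s * s := Nat.le_of_dvd hspos hdvd
  have hrpos : 0 < r * r := Nat.mul_pos hr.pos hr.pos
  have hs1 : s ≤ s * s := Nat.le_mul_of_pos_right _ hs.pos
  have hr1 : r ≤ r * r := Nat.le_mul_of_pos_right _ hr.pos
  have hpow := hC n s r hs hr
  have hpow' : (r * r) ^ (r * r) ≤ C * (n + 1) :=
    (Nat.pow_le_pow_right hrpos (by omega)).trans hpow
  have hlearn := (learnTime_mul_le hrpos).trans (Nat.mul_le_mul_left 500 hpow)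
  refine wp_call (wp_sortBlocks (τ := τ) k0 k1 k2 k50 k51 hrpos (fun K => by rw [kA, h5])
    (fun K => by rw [kA, h6]) (by omega)) ?_
  rintro t₂ m₂ ⟨ht₂, hS₂⟩ f₂
  have l : ∀ r, r < 10 ∨ 25 < r ∧ r < 60 ∨ 92 < r → m₂.reg r = m₁.reg r := fun r hr =>
    f₂.reg r fun h => by have := sortBlocks_wr r h; omega
  refine wp_call (wp_mergeLevel (τ := τ) (s := r) (μ := s * s) (by simp [l, k0]) (by simp [l, k1])
    (by simp [l, k2]) (by simp [l, k99]) (by simp [l, k50]) (by simp [l, k98]) hr.pos hdvd hspos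
    ((min_le_left _ _).trans hr.le) (by omega) hS₂) ?_
  rintro t₃ m₃ ⟨ht₃, hS₃⟩ f₃
  have l' : ∀ r, r < 10 ∨ 92 < r → m₃.reg r = m₁.reg r := by
    intro r hr
    rw [f₃.reg r fun h => by have := mergeLevel_wr r h; omega]
    simp [l r (by omega), show r ≠ 32 by omega, show r ≠ 33 by omega, show r ≠ 34 by omega]
  have hdiv : n / (s * s) * (s * s) ≤ n := Nat.div_mul_le_self _ _
  have hdiv' : n < n / (s * s) * (s * s) + s * s := Nat.lt_div_mul_add hspos
  have hdiv2 : n / (s * s) ≤ n := Nat.div_le_self _ _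
  refine ⟨by simp [l', k0, k1, k98]; omega, by simp [l', k0, k1, k98, add_mul]; omega, ?_⟩
  -- On the last level the segment length is the first multiple of `s * s` beyond `n`, so that a
  -- single segment covers the whole input.
  refine wp_mono (wp_mergeLevel (τ := τ) (s := s) (μ := n / (s * s) * (s * s) + s * s)
    (by simp [l', k0]) (by simp [l', k1]) (by simp [l', k2]) (by simp [l', k97]) (by simp [l', k98])
    (by simp [l', k0, k1, k98, add_mul]) hs.pos ((Dvd.intro_left _ rfl).add dvd_rfl) (by omega)
    ((min_le_right _ _).trans hs.le) (by omega) hS₃) ?_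
  rintro t₄ m₄ ⟨ht₄, hS₄⟩
  have hfin := hS₄ 0 (Nat.dvd_zero _) (Nat.zero_le _)
  rw [show min (0 + (n / (s * s) * (s * s) + s * s)) n = n by omega] at hfin
  refine ⟨?_, hfin⟩
  obtain ⟨D, hD⟩ : ∃ D, twinWidth τ + 1 = D := ⟨_, rfl⟩
  rw [hD] at ht₂ ht₃ ht₄ ⊢
  have d1 : n + 1 ≤ D * (n + 1) := Nat.le_mul_of_pos_left _ (by omega)
  have d2 : C * (n + 1) ≤ C * (D * (n + 1)) := Nat.mul_le_mul_left _ d1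
  have d3 : 2410 * D * n ≤ 2410 * (D * (n + 1)) := by
    rw [mul_assoc]; exact Nat.mul_le_mul_left _ (Nat.mul_le_mul_left _ (Nat.le_succ n))
  have d4 : 8010 * D * (n + s * s) ≤ 8010 * (D * (9 * (n + 1))) := by
    rw [mul_assoc]; exact Nat.mul_le_mul_left _ (Nat.mul_le_mul_left _ (by omega))
  have d5 : 8010 * D * (n + (n / (s * s) * (s * s) + s * s)) ≤ 8010 * (D * (10 * (n + 1))) := by
    rw [mul_assoc]; exact Nat.mul_le_mul_left _ (Nat.mul_le_mul_left _ (by omega))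
  have d6 : (500 * C + 300000) * D * (n + 1) =
      500 * (C * (D * (n + 1))) + 300000 * (D * (n + 1)) := by ring
  have d7 : D * (9 * (n + 1)) = 9 * (D * (n + 1)) := by ring
  have d8 : D * (10 * (n + 1)) = 10 * (D * (n + 1)) := by ring
  omega

/-- The listed positions are a rearrangement of all positions, so the list is injective, and an
injection of a finite set into itself is a permutation. -/
theorem isSortedOutput_of_asc {m : State} (hseg : seg (m.arr 0) 0 n = seg id 0 n)
    (hasc : Asc τ (m.arr 0) 0 n) : IsSortedOutput τ m := by
  have hlt : ∀ k, k < n → m.arr 0 k < n := by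
    intro k hk
    have : m.arr 0 k ∈ seg id 0 n := hseg ▸ mem_seg.2 ⟨k, Nat.zero_le _, hk, rfl⟩
    obtain ⟨i, -, hi, hik⟩ := mem_seg.1 this
    simp only [id] at hik
    omega
  have hnd : (seg (m.arr 0) 0 n).Nodup := by
    rw [hseg, seg, Multiset.map_id]; exact Finset.nodup _
  have hinj : Function.Injective fun k : Fin n => (⟨m.arr 0 k, hlt k k.isLt⟩ : Fin n) := by
    intro i j hij
    have hij : m.arr 0 i = m.arr 0 j := congrArg Fin.val hij
    refine Fin.ext (Multiset.inj_on_of_nodup_map hnd i ?_ j ?_ hij)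
    · rw [Finset.mem_val, Finset.mem_Ico]; exact ⟨Nat.zero_le _, i.isLt⟩
    · rw [Finset.mem_val, Finset.mem_Ico]; exact ⟨Nat.zero_le _, j.isLt⟩
  refine ⟨Equiv.ofBijective _ (Finite.injective_iff_bijective.1 hinj), fun k => rfl,
    fun i j hij => ?_⟩
  have := hasc i j (Nat.zero_le _) hij j.isLt
  rw [val_of_lt τ (hlt i i.isLt), val_of_lt τ (hlt j j.isLt)] at this
  exact this

end CompRAM

theorem corollary2 :
    ∃ (p : CompRAM.Prog) (c C : ℕ), 0 < c ∧
      ∀ (n d : ℕ) (τ : Equiv.Perm (Fin n)), TwinWidth.twinWidth τ = d →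
        ∀ w : ℕ, (n + 2) ^ c ≤ 2 ^ w →
          CompRAM.SortsWithin w p τ (C * (d + 1) * (n + 1)) := by
  obtain ⟨C, hC⟩ := CompRAM.exists_forall_pow_le
  -- Words must hold numbers up to `(2 * C + 500) * (n + 1) ^ 2`. Two factors `n + 2` cover the
  -- square, and the other `2 * C + 500` factors, each at least two, exceed the constant because `k
  -- < 2 ^ k`.
  refine ⟨CompRAM.sortInput, 2 * C + 502, 500 * C + 300000, by omega, ?_⟩
  rintro n d τ rfl w hw
  have hw' : (2 * C + 500) * ((n + 1) * (n + 1)) < 2 ^ w := by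
    refine lt_of_lt_of_le ?_ hw
    rw [show 2 * C + 502 = (2 * C + 500) + 2 by ring, pow_add, sq]
    refine Nat.mul_lt_mul_of_lt_of_le ?_ (Nat.mul_le_mul (by omega) (by omega)) (by positivity)
    exact Nat.lt_two_pow_self.trans_le (Nat.pow_le_pow_left (by omega) _)
  have hn : n < 2 ^ w := by nlinarith
  obtain ⟨t, m, he, -, ht, hseg, hasc⟩ := CompRAM.wp_sound
    (CompRAM.wp_sortInput (τ := τ) (w := w) (m := CompRAM.State.init n) rfl (fun _ => rfl)
      (fun _ => rfl) hC hw') ⟨fun r => by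
        simp only [CompRAM.State.init]; split_ifs; exacts [hn, by omega], fun _ _ => by
        simp only [CompRAM.State.init]; omega⟩
  exact ⟨t, m, he, ht, CompRAM.isSortedOutput_of_asc hseg hasc⟩
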